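/- Let $R$ be a (unital, associative, not necessarily commutative) ring that is free as a $\mathbb{Z}$-module, with $\mathbb{Z}$-basis $I$. Let $\mathcal{G}_\infty^{\mathbb{Q}}(R)=\bigotimes_{i\ge 1}U(\mathbb{Q}\otimes_{\mathbb{Z}}R)$ be the tensor product of copies, indexed by $i\ge1$, of the universal enveloping algebra of $\mathbb{Q}\otimes R$ (a Lie algebra under the commutator), and let $T_i(r)$ denote the image of $r\in\mathbb{Q}\otimes R$ in the $i$-th factor. For a power series $x$ with coefficients in $\mathbb{Q}\otimes R$ (in commuting variables) and constant term $1$, put $\Theta_l(x)=\exp(T_l(\log x))$, where $T_l$ is applied to coefficients. For $U\in R$ define $$E_U(t)=\sum_{r\ge0}e_r(U)t^r=\prod_{l\ge1}\Theta_l\bigl(1-(-t)^lU\bigr)\in\mathcal{G}_\infty^{\mathbb{Q}}(R)[[t]].$$ For each $U\in I$ take a countably infinite set of variables $x_{U,1},x_{U,2},\dots$, and for a symmetric function $f$ write $f^{(U)}$ for $f$ in these variables. Let $p_l$ be the power sums and $s_\lambda$ the Schur functions. Then there is a unique family of elements $Z_{\vec\lambda}\in\mathcal{G}_\infty^{\mathbb{Q}}(R)$,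 indexed by the $I$-indexed multipartitions $\vec\lambda$ of finite size, such that $$\sum_{\vec\lambda}\Bigl(\prod_{U\in I}s_{\vec\lambda(U)}^{(U)}\Bigr)\otimes Z_{\vec\lambda}=\prod_{l\ge1}\Theta_l\Bigl(1+\sum_{U\in I}p_l^{(U)}U\Bigr),$$ and their $\mathbb{Z}$-span $\mathcal{G}_\infty^{\mathbb{Z}}(R)$ is a subring of $\mathcal{G}_\infty^{\mathbb{Q}}(R)$ that contains $e_r(U)$ for all $U\in R$, $r\ge0$. There is a unique Hopf algebra structure $(\Delta,\varepsilon,S)$ on the ring $\mathcal{G}_\infty^{\mathbb{Z}}(R)$ over $\mathbb{Z}$ such that, for all $U\in R$, $$\Delta(E_U(t))=E_U(t)\otimes E_U(t),\qquad \varepsilon(E_U(t))=1,\qquad S(E_U(t))=E_U(t)^{-1},$$ where the structure maps are applied to coefficients. That is, the generating functions $E_U(t)$ are grouplike. Moreover, $\mathcal{G}_\infty^{\mathbb{Z}}(R)$ spans $\mathcal{G}_\infty^{\mathbb{Q}}(R)$ over $\mathbb{Q}$, the structure extends to a Hopf algebra structure on the $\mathbb{Q}$-algebra $\mathcal{G}_\infty^{\mathbb{Q}}(R)$,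 and there the elements $T_i(U)$, for $i\ge1$ and $U\in R$, are primitive: $\Delta(T_i(U))=T_i(U)\otimes1+1\otimes T_i(U)$. -/

import Mathlib

open scoped TensorProduct

namespace LimGroth

universe u v w

noncomputable section

/-! ### The rational algebra `𝒢_∞^ℚ(R) = ⨂_{i ≥ 1} U(ℚ ⊗ R_i)` -/

/-- The `ℚ`-algebra `ℚ ⊗_ℤ R`. -/
def RatR (R : Type u) [Ring R] : Type u := ℚ ⊗[ℤ] R

instance (R : Type u) [Ring R] : Ring (RatR R) := inferInstanceAs (Ring (ℚ ⊗[ℤ] R))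

instance (R : Type u) [Ring R] : Algebra ℚ (RatR R) := inferInstanceAs (Algebra ℚ (ℚ ⊗[ℤ] R))

/-- The image `1 ⊗ U` of `U ∈ R` in `ℚ ⊗ R`. -/
def RatR.of {R : Type u} [Ring R] (U : R) : RatR R := (1 : ℚ) ⊗ₜ[ℤ] U

/-- The Lie ring structure given by the commutator. -/
instance (R : Type u) [Ring R] : LieRing (RatR R) := LieRing.ofAssociativeRing

instance (R : Type u) [Ring R] : LieAlgebra ℚ (RatR R) := LieAlgebra.ofAssociativeAlgebra

/-- The universal enveloping algebra `U(ℚ ⊗ R)`. -/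
abbrev Env (R : Type u) [Ring R] : Type u := UniversalEnvelopingAlgebra ℚ (RatR R)

/-- The relations imposing that different factors of a free product of algebras commute. -/
inductive CommRel (k : Type u) [CommRing k] {J : Type v} [DecidableEq J] (B : J → Type w)
    [∀ j, Ring (B j)] [∀ j, Algebra k (B j)] :
    LinearAlgebra.FreeProduct k B → LinearAlgebra.FreeProduct k B → Prop
  | comm (i j : J) (hij : i ≠ j) (a : B i) (b : B j) :
      CommRel k B
        (LinearAlgebra.FreeProduct.ι k B i a * LinearAlgebra.FreeProduct.ι k B j b)
        (LinearAlgebra.FreeProduct.ι k B j b * LinearAlgebra.FreeProduct.ι k B i a)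

/-- The tensor product of a (possibly infinite) family of unital `k`-algebras, i.e. the direct
limit of the tensor products over finite subfamilies (along `x ↦ x ⊗ 1`): the universal algebra
receiving maps from all the factors such that the images of different factors commute. -/
def TensorFamily (k : Type u) [CommRing k] {J : Type v} [DecidableEq J] (B : J → Type w)
    [∀ j, Ring (B j)] [∀ j, Algebra k (B j)] := RingQuot (CommRel k B)

section TensorFamily

variable (k : Type u) [CommRing k] {J : Type v} [DecidableEq J] (B : J → Type w)
    [∀ j, Ring (B j)] [∀ j, Algebra k (B j)]

instance : Ring (TensorFamily k B) := inferInstanceAs (Ring (RingQuot (CommRel k B)))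

instance : Algebra k (TensorFamily k B) := inferInstanceAs (Algebra k (RingQuot (CommRel k B)))

/-- The canonical map from a factor to the tensor product. -/
def TensorFamily.incl (j : J) : B j →ₐ[k] TensorFamily k B :=
  (RingQuot.mkAlgHom k (CommRel k B)).comp (LinearAlgebra.FreeProduct.ι k B j)

end TensorFamily

/-- `𝒢_∞^ℚ(R)`, the tensor product of copies of `U(ℚ ⊗ R)` indexed by the positive integers. -/
def GQ (R : Type u) [Ring R] : Type u := TensorFamily ℚ (fun _ : ℕ+ => Env R)

instance (R : Type u) [Ring R] : Ring (GQ R) :=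
  inferInstanceAs (Ring (TensorFamily ℚ (fun _ : ℕ+ => Env R)))

instance (R : Type u) [Ring R] : Algebra ℚ (GQ R) :=
  inferInstanceAs (Algebra ℚ (TensorFamily ℚ (fun _ : ℕ+ => Env R)))

section

attribute [local instance 100] LieRing.ofAssociativeRing

/-- `T_i(r)`: the image of `r ∈ ℚ ⊗ R` in the `i`-th factor of `𝒢_∞^ℚ(R)`. -/
def T {R : Type u} [Ring R] (i : ℕ+) : RatR R →ₗ[ℚ] GQ R :=
  (TensorFamily.incl ℚ (fun _ : ℕ+ => Env R) i).toLinearMap ∘ₗ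
    (UniversalEnvelopingAlgebra.ι ℚ : RatR R →ₗ⁅ℚ⁆ Env R).toLinearMap

end

/-! ### Power series with coefficients in a noncommutative algebra -/

section Series

variable {σ : Type v} {A : Type u} [Ring A] [Algebra ℚ A]

/-- `exp y = ∑_{k ≥ 0} y ^ k / k!` for a power series `y` without constant term; then `y ^ k` does
not contribute to the coefficient of a monomial of degree less than `k`. -/
def expSeries (y : MvPowerSeries σ A) : MvPowerSeries σ A :=
  fun m => ∑ k ∈ Finset.range (m.degree + 1), ((k.factorial : ℚ)⁻¹) • MvPowerSeries.coeff m (y ^ k)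

/-- `log x = ∑_{k ≥ 1} (-1) ^ (k - 1) (x - 1) ^ k / k` for a power series `x` with constant term
`1`; then `(x - 1) ^ k` does not contribute to the coefficient of a monomial of degree less
than `k`. -/
def logSeries (x : MvPowerSeries σ A) : MvPowerSeries σ A :=
  fun m => ∑ k ∈ Finset.Icc 1 m.degree,
    ((-1 : ℚ) ^ (k - 1) / (k : ℚ)) • MvPowerSeries.coeff m ((x - 1) ^ k)

/-- The product `∏_{l ≥ 1} F_l` (in the order `F_1 F_2 F_3 ⋯`) for power series `F_l` such that
`F_l - 1` only has terms of degree at least `l`; then only the factors with `l ≤ d` contribute to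
the coefficient of a monomial of degree `d`. -/
def prodSeries (F : ℕ+ → MvPowerSeries σ A) : MvPowerSeries σ A :=
  fun m => MvPowerSeries.coeff m ((List.range m.degree).map fun l => F l.succPNat).prod

end Series

variable {R : Type u} [Ring R]

/-- `T_l` applied to the coefficients of a power series. -/
def TSeries {σ : Type v} (l : ℕ+) (y : MvPowerSeries σ (RatR R)) : MvPowerSeries σ (GQ R) :=
  fun m => T l (MvPowerSeries.coeff m y)

/-- `Θ_l(x) = exp (T_l (log x))`. -/
def Theta {σ : Type v} (l : ℕ+) (x : MvPowerSeries σ (RatR R)) : MvPowerSeries σ (GQ R) :=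
  expSeries (TSeries l (logSeries x))

/-- `E_U(t) = ∑_{r ≥ 0} e_r(U) t ^ r = ∏_{l ≥ 1} Θ_l(1 - (-t) ^ l U)`, for `U ∈ R`. -/
def E (U : R) : PowerSeries (GQ R) :=
  prodSeries fun l : ℕ+ =>
    Theta l (1 - (-PowerSeries.X) ^ (l : ℕ) * PowerSeries.C (RatR.of U) : PowerSeries (RatR R))

/-! ### Symmetric functions in the variables `x_{U, i}`, for `U` in a basis and `i ∈ ℕ` -/

section Symmetric

variable {ι : Type v}

/-- The power sum `p_l^{(U)} = ∑_i x_{U, i} ^ l`, for `l ≥ 1`. -/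
def psum (l : ℕ+) (U : ι) : MvPowerSeries (ι × ℕ) ℤ :=
  open scoped Classical in
  fun m => if ∃ i : ℕ, m = Finsupp.single (U, i) (l : ℕ) then 1 else 0

/-- The complete symmetric function `h_n^{(U)}`, the sum of all monomials of degree `n` in the
variables `x_{U, i}`; it is zero for `n < 0`. -/
def hsum (n : ℤ) (U : ι) : MvPowerSeries (ι × ℕ) ℤ :=
  open scoped Classical in
  fun m => if (m.degree : ℤ) = n ∧ ∀ v ∈ m.support, v.1 = U then 1 else 0

/-- The Schur function `s_μ^{(U)} = det (h_{μ_i - i + j}^{(U)})_{1 ≤ i, j ≤ l(μ)}`. -/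
def schur (μ : YoungDiagram) (U : ι) : MvPowerSeries (ι × ℕ) ℤ :=
  Matrix.det (Matrix.of fun i j : Fin (μ.colLen 0) =>
    hsum ((μ.rowLen (i : ℕ) : ℤ) - ((i : ℕ) : ℤ) + ((j : ℕ) : ℤ)) U)

/-- Multipartitions of finite size indexed by `ι`; partitions are given by Young diagrams. -/
def Multipartition (ι : Type v) : Type v :=
  {lam : ι → YoungDiagram // (Function.support fun U => (lam U).card).Finite}

/-- The product `∏_U s_{λ(U)}^{(U)}`, all but finitely many factors of which are `1`. -/
def schurProd (lam : Multipartition ι) : MvPowerSeries (ι × ℕ) ℤ :=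
  ∏ U ∈ lam.2.toFinset, schur (lam.1 U) U

/-- The series `∑_U p_l^{(U)} U`, where `U` runs over the basis `b` of `R`. Each monomial occurs in
at most one of the `p_l^{(U)}`, so the sum defining a coefficient has at most one nonzero term. -/
def psumBasis (b : Module.Basis ι ℤ R) (l : ℕ+) : MvPowerSeries (ι × ℕ) (RatR R) :=
  fun m => ∑ᶠ U : ι, MvPowerSeries.coeff m (psum l U) • RatR.of (b U)

/-- The family `Z` satisfies
`∑_λ (∏_U s_{λ(U)}^{(U)}) ⊗ Z_λ = ∏_{l ≥ 1} exp (T_l (log (1 + ∑_U p_l^{(U)} U)))`.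
The two sides are compared coefficient by coefficient; a given monomial occurs in only finitely
many of the products of Schur functions. -/
def IsZFamily (b : Module.Basis ι ℤ R) (Z : Multipartition ι → GQ R) : Prop :=
  ∀ m : ι × ℕ →₀ ℕ,
    ∑ᶠ lam : Multipartition ι, MvPowerSeries.coeff m (schurProd lam) • Z lam =
      MvPowerSeries.coeff m (prodSeries fun l : ℕ+ => Theta l (1 + psumBasis b l))

end Symmetric

/-! ### Hopf algebra structures -/

/-- A Hopf algebra structure on a given `k`-algebra `A`. -/
@[ext]
structure HopfStructure (k : Type u) (A : Type v) [CommRing k] [Ring A] [Algebra k A] where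
  comul : A →ₐ[k] A ⊗[k] A
  counit : A →ₐ[k] k
  antipode : A →ₗ[k] A
  coassoc : (Algebra.TensorProduct.assoc k k k A A A).toAlgHom.comp
      ((Algebra.TensorProduct.map comul (.id k A)).comp comul)
      = (Algebra.TensorProduct.map (.id k A) comul).comp comul
  rTensor_counit : (Algebra.TensorProduct.map counit (.id k A)).comp comul
      = (Algebra.TensorProduct.lid k A).symm
  lTensor_counit : (Algebra.TensorProduct.map (.id k A) counit).comp comul
      = (Algebra.TensorProduct.rid k k A).symm
  mul_antipode_rTensor : LinearMap.mul' k A ∘ₗ antipode.rTensor A ∘ₗ comul.toLinearMap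
      = Algebra.linearMap k A ∘ₗ counit.toLinearMap
  mul_antipode_lTensor : LinearMap.mul' k A ∘ₗ antipode.lTensor A ∘ₗ comul.toLinearMap
      = Algebra.linearMap k A ∘ₗ counit.toLinearMap

/-- The corresponding Hopf algebra in the sense of Mathlib. -/
abbrev HopfStructure.toHopfAlgebra {k : Type u} {A : Type v} [CommRing k] [Ring A] [Algebra k A]
    (H : HopfStructure k A) : HopfAlgebra k A :=
  { Bialgebra.ofAlgHom H.comul H.counit H.coassoc H.rTensor_counit H.lTensor_counit with
    antipode := H.antipode
    mul_antipode_rTensor_comul := H.mul_antipode_rTensor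
    mul_antipode_lTensor_comul := H.mul_antipode_lTensor }

/-- For a power series `F` over `A`: `Δ(F) = F ⊗ F`, `ε(F) = 1` and `S(F) = F⁻¹`, where the
structure maps are applied to the coefficients of `F`, and `F ⊗ F` is the product of the series
with coefficients `f ⊗ 1` and `1 ⊗ f`. -/
structure HopfStructure.IsGrouplike {k : Type u} {A : Type v} [CommRing k] [Ring A] [Algebra k A]
    (H : HopfStructure k A) (F : PowerSeries A) : Prop where
  comul_eq : PowerSeries.map (H.comul : A →+* A ⊗[k] A) F =
    PowerSeries.map
        ((Algebra.TensorProduct.includeLeft : A →ₐ[k] A ⊗[k] A) : A →+* A ⊗[k] A) F *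
      PowerSeries.map
        ((Algebra.TensorProduct.includeRight : A →ₐ[k] A ⊗[k] A) : A →+* A ⊗[k] A) F
  counit_eq : PowerSeries.map (H.counit : A →+* k) F = 1
  antipode_mul : (PowerSeries.mk fun n => H.antipode (PowerSeries.coeff n F)) * F = 1
  mul_antipode : F * (PowerSeries.mk fun n => H.antipode (PowerSeries.coeff n F)) = 1

/-- A power series over `𝒢_∞^ℚ(R)` whose coefficients lie in a subring, as a series over it. -/
def restrictSeries {A : Subalgebra ℤ (GQ R)} (F : PowerSeries (GQ R))
    (hF : ∀ n, PowerSeries.coeff n F ∈ A) : PowerSeries A :=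
  PowerSeries.mk fun n => ⟨PowerSeries.coeff n F, hF n⟩

/-- The map `A ⊗_ℤ A → 𝒢_∞^ℚ(R) ⊗_ℚ 𝒢_∞^ℚ(R)` induced by the inclusion of a subring `A`. -/
def tensorIncl (A : Subalgebra ℤ (GQ R)) : A ⊗[ℤ] A →ₐ[ℤ] GQ R ⊗[ℚ] GQ R :=
  (Algebra.TensorProduct.mapOfCompatibleSMul ℚ ℤ ℤ (GQ R) (GQ R)).comp
    (Algebra.TensorProduct.map A.val A.val)

/-- The Hopf algebra structure `HQ` on `𝒢_∞^ℚ(R)` extends the structure `H` on the subring `A`. -/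
structure HopfStructure.Extends {A : Subalgebra ℤ (GQ R)} (HQ : HopfStructure ℚ (GQ R))
    (H : HopfStructure ℤ A) : Prop where
  comul_eq : ∀ a : A, HQ.comul (a : GQ R) = tensorIncl A (H.comul a)
  counit_eq : ∀ a : A, HQ.counit (a : GQ R) = (H.counit a : ℚ)
  antipode_eq : ∀ a : A, HQ.antipode (a : GQ R) = (H.antipode a : GQ R)

end

end LimGroth

open LimGroth

/-! Over `ℚ` the algebra is universal for commuting families of Lie homomorphisms out of `ℚ ⊗ R`, so
declaring every `T_i(a)` primitive defines a Hopf algebra, `hopfGQ`. The series `T_l(log x)` has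
primitive coefficients, hence its exponential is grouplike, and so is every product `∏ Θ_l(1 + y_l)`
(`thetaProd`). This covers the series `E_U(t)` and the universal series `F = ∏ Θ_l(1 + ∑ p_l^{(U)}
U)`. What remains is integrality and uniqueness.

The elements `Z_λ`: the series `F` is symmetric in each alphabet, so only its coefficients at sorted
exponents matter. The bialternant identity, derived from the Jacobi-Trudi determinant, inverts over
`ℤ` the matrix of coefficients of Schur functions, degree by degree (`exists_kostka_inverse`).
Therefore the `Z_λ` exist, are unique, and have the same `ℤ`-span as the coefficients of `F`
(`exists_isZFamily`).

The span is a ring: `Θ_l` is multiplicative (`expSeries_mapCoeff_logSeries_mul`). This is seen by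
comparing logarithmic derivatives, which involve only commutators and therefore pass through `T_l`.
Hence the product of `F` in two alphabets is the Θ-product in which the monomials `x`, `x'` and `x
x'` carry `U`, `V` and `U V`. The central integrality statement `coeff_thetaProd_monoSum_mem` says
that a Θ-product built from finitely many nontrivial monomials carrying arbitrary elements of `R`
has its coefficients in the span. For basis elements it is a specialization of `F`; sums are
obtained by repeating monomials; signs are obtained because the coefficients depend polynomially on
an integer parameter, so that their values at natural numbers control the value at `-1`. The same
statement gives `e_r(U)` in the span.

The Hopf structure: grouplikeness of `F` shows that `Δ`, `ε` and `S` restrict to the span, and the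
axioms descend because the tensor powers of the span over `ℤ` embed into those of the rational
algebra. Finally, the coefficient of `t ^ r` in `E_U(t)` is `± T_r(U)` plus an element of the
algebra generated by `T_1, …, T_{r-1}`, so these coefficients generate everything over `ℚ`;
torsion-freeness then gives uniqueness. -/

namespace LimGroth

/-! ### Formal calculus of power series over a noncommutative `ℚ`-algebra -/

open Finset.HasAntidiagonal (antidiagonal mem_antidiagonal)

noncomputable section

/-! ### Power series without terms of small degree -/

section Tail

variable {σ τ : Type*} {A B : Type*} [Ring A] [Algebra ℚ A] [Ring B] [Algebra ℚ B]

/-- The power series without terms of degree less than `N`. -/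
def tail (σ A : Type*) [Ring A] [Algebra ℚ A] (N : ℕ) : Submodule ℚ (MvPowerSeries σ A) where
  carrier := {f | ∀ m, m.degree < N → MvPowerSeries.coeff m f = 0}
  add_mem' hf hg m hm := by rw [map_add, hf m hm, hg m hm, add_zero]
  zero_mem' m _ := map_zero _
  smul_mem' c f hf m hm := by
    change c • MvPowerSeries.coeff m f = 0
    rw [hf m hm, smul_zero]

theorem coeff_qsmul (c : ℚ) (m : σ →₀ ℕ) (f : MvPowerSeries σ A) :
    MvPowerSeries.coeff m (c • f) = c • MvPowerSeries.coeff m f := rfl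

theorem tail_anti {M N : ℕ} (h : M ≤ N) : tail σ A N ≤ tail σ A M :=
  fun _ hf m hm => hf m (hm.trans_le h)

theorem mem_tail_zero (f : MvPowerSeries σ A) : f ∈ tail σ A 0 := fun _ hm => absurd hm (by simp)

theorem mem_tail_one {f : MvPowerSeries σ A} :
    f ∈ tail σ A 1 ↔ MvPowerSeries.coeff 0 f = 0 := by
  refine ⟨fun h => h 0 (by simp), fun h m hm => ?_⟩
  rw [Nat.lt_one_iff, Finsupp.degree_eq_zero_iff] at hm
  rw [hm, h]

theorem mul_mem_tail {M N : ℕ} {f g : MvPowerSeries σ A} (hf : f ∈ tail σ A M)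
    (hg : g ∈ tail σ A N) : f * g ∈ tail σ A (M + N) := by
  classical
  intro m hm
  rw [MvPowerSeries.coeff_mul]
  refine Finset.sum_eq_zero fun p hp => ?_
  rw [mem_antidiagonal] at hp
  rw [← hp, map_add] at hm
  rcases lt_or_ge p.1.degree M with h | h
  · rw [hf _ h, zero_mul]
  · rw [hg _ (by omega), mul_zero]

theorem mul_mem_tail_left {N : ℕ} {f : MvPowerSeries σ A} (g : MvPowerSeries σ A)
    (hf : f ∈ tail σ A N) : g * f ∈ tail σ A N := by
  simpa using mul_mem_tail (mem_tail_zero g) hf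

theorem mul_mem_tail_right {N : ℕ} {f : MvPowerSeries σ A} (g : MvPowerSeries σ A)
    (hf : f ∈ tail σ A N) : f * g ∈ tail σ A N := by
  simpa using mul_mem_tail hf (mem_tail_zero g)

theorem pow_mem_tail {f : MvPowerSeries σ A} {N : ℕ} (hf : f ∈ tail σ A N) (k : ℕ) :
    f ^ k ∈ tail σ A (k * N) := by
  induction k with
  | zero => simpa using mem_tail_zero _
  | succ k ih => rw [pow_succ, add_mul, one_mul]; exact mul_mem_tail ih hf

theorem pow_mem_tail_one {f : MvPowerSeries σ A} (hf : f ∈ tail σ A 1) (k : ℕ) :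
    f ^ k ∈ tail σ A k := by simpa using pow_mem_tail hf k

/-- Two power series are congruent modulo terms of degree at least `N`. -/
def CongrBelow (N : ℕ) (f g : MvPowerSeries σ A) : Prop := f - g ∈ tail σ A N

/-- The degree filtration is separated. Identities between infinite series are proved modulo each
degree `N`, where every series becomes a finite sum. -/
theorem eq_of_congrBelow {f g : MvPowerSeries σ A} (h : ∀ N, CongrBelow N f g) : f = g := by
  ext m
  have := h (m.degree + 1) m (Nat.lt_succ_self _)
  rwa [map_sub, sub_eq_zero] at this

namespace CongrBelow

variable {N : ℕ} {f g h f' g' : MvPowerSeries σ A}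

theorem coeff (hfg : CongrBelow N f g) {m : σ →₀ ℕ} (hm : m.degree < N) :
    MvPowerSeries.coeff m f = MvPowerSeries.coeff m g := by
  have := hfg m hm
  rwa [map_sub, sub_eq_zero] at this

theorem of_coeff (hfg : ∀ m : σ →₀ ℕ, m.degree < N →
    MvPowerSeries.coeff m f = MvPowerSeries.coeff m g) : CongrBelow N f g := fun m hm => by
  rw [map_sub, hfg m hm, sub_self]

theorem rfl' : CongrBelow N f f := of_coeff fun _ _ => rfl

theorem symm (hfg : CongrBelow N f g) : CongrBelow N g f := of_coeff fun _ hm => (hfg.coeff hm).symm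

theorem trans (hfg : CongrBelow N f g) (hgh : CongrBelow N g h) : CongrBelow N f h :=
  of_coeff fun _ hm => (hfg.coeff hm).trans (hgh.coeff hm)

theorem mono {M : ℕ} (hfg : CongrBelow N f g) (hM : M ≤ N) : CongrBelow M f g :=
  tail_anti hM hfg

theorem mul (hf : CongrBelow N f f') (hg : CongrBelow N g g') :
    CongrBelow N (f * g) (f' * g') := by
  have : f * g - f' * g' = (f - f') * g + f' * (g - g') := by noncomm_ring
  unfold CongrBelow
  rw [this]
  exact add_mem (mul_mem_tail_right _ hf) (mul_mem_tail_left _ hg)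

theorem sum {κ : Type*} {s : Finset κ} {F G : κ → MvPowerSeries σ A}
    (hFG : ∀ k ∈ s, CongrBelow N (F k) (G k)) : CongrBelow N (∑ k ∈ s, F k) (∑ k ∈ s, G k) := by
  unfold CongrBelow
  rw [← Finset.sum_sub_distrib]
  exact sum_mem hFG

end CongrBelow

/-- An additive map of power series which does not lower degrees. -/
def TailPreserving (φ : MvPowerSeries σ A →+ MvPowerSeries τ B) : Prop :=
  ∀ N f, f ∈ tail σ A N → φ f ∈ tail τ B N

theorem TailPreserving.congr {φ : MvPowerSeries σ A →+ MvPowerSeries τ B} (hφ : TailPreserving φ)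
    {N : ℕ} {f g : MvPowerSeries σ A} (h : CongrBelow N f g) : CongrBelow N (φ f) (φ g) := by
  unfold CongrBelow
  rw [← map_sub]
  exact hφ N _ h

/-- A product of two sums may be summed along antidiagonals. -/
theorem congrBelow_sum_antidiagonal (N : ℕ) (a : ℕ → ℕ → MvPowerSeries σ A)
    (ha : ∀ i j, a i j ∈ tail σ A (i + j)) :
    CongrBelow N (∑ k ∈ Finset.range N, ∑ p ∈ antidiagonal k, a p.1 p.2)
      (∑ i ∈ Finset.range N, ∑ j ∈ Finset.range N, a i j) := by
  have h1 : ∑ k ∈ Finset.range N, ∑ p ∈ antidiagonal k, a p.1 p.2 =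
      ∑ p ∈ Finset.range N ×ˢ Finset.range N, if p.1 + p.2 < N then a p.1 p.2 else 0 := by
    rw [← Finset.sum_filter, Finset.sum_sigma']
    refine Finset.sum_bij' (fun x _ => x.2) (fun p _ => ⟨p.1 + p.2, p⟩) ?_ ?_ ?_ ?_ ?_
    · rintro ⟨k, p⟩ h
      simp only [Finset.mem_sigma, Finset.mem_range, mem_antidiagonal] at h
      simp only [Finset.mem_filter, Finset.mem_product, Finset.mem_range]
      omega
    · rintro p h
      simp only [Finset.mem_filter, Finset.mem_product, Finset.mem_range] at h
      simpa using h.2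
    · rintro ⟨k, p⟩ h
      simp only [Finset.mem_sigma, Finset.mem_range, mem_antidiagonal] at h
      obtain ⟨_, rfl⟩ := h
      rfl
    · intros; rfl
    · intros; rfl
  -- The triangle `p.1 + p.2 < N` is compared with the full square; the remaining terms have degree
  -- at least `N`.
  rw [h1, ← Finset.sum_product' (f := a)]
  refine CongrBelow.sum fun p _ => ?_
  split_ifs with h
  · exact CongrBelow.rfl'
  · refine CongrBelow.symm ?_
    unfold CongrBelow
    rw [sub_zero]
    exact tail_anti (not_lt.1 h) (ha _ _)

/-! ### Evaluation of a rational power series in one variable -/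

/-- `∑ k, c k • y ^ k` for a power series `y` without constant term. -/
def evalSeries (c : ℕ → ℚ) (y : MvPowerSeries σ A) : MvPowerSeries σ A :=
  fun m => ∑ k ∈ Finset.range (m.degree + 1), c k • MvPowerSeries.coeff m (y ^ k)

theorem expSeries_eq_evalSeries (y : MvPowerSeries σ A) :
    expSeries y = evalSeries (fun k => (k.factorial : ℚ)⁻¹) y := rfl

/-- The coefficients of `log (1 + x)`. -/
def logCoeff (k : ℕ) : ℚ := (-1 : ℚ) ^ (k - 1) / (k : ℚ)

theorem logSeries_eq_evalSeries (y : MvPowerSeries σ A) :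
    logSeries (1 + y) = evalSeries logCoeff y := by
  funext m
  unfold logSeries evalSeries
  rw [add_sub_cancel_left, Finset.range_eq_Ico, Finset.sum_eq_sum_Ico_succ_bot (by omega)]
  simp [logCoeff, Finset.Ico_add_one_right_eq_Icc]

theorem evalSeries_congr (c : ℕ → ℚ) {y : MvPowerSeries σ A} (hy : y ∈ tail σ A 1) {M N : ℕ}
    (hMN : N ≤ M) : CongrBelow N (evalSeries c y) (∑ k ∈ Finset.range M, c k • y ^ k) := by
  refine CongrBelow.of_coeff fun m hm => ?_
  rw [map_sum]
  change ∑ k ∈ Finset.range (m.degree + 1), c k • MvPowerSeries.coeff m (y ^ k) = _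
  refine Finset.sum_subset (fun k hk => ?_) fun k _ hk => ?_
  · rw [Finset.mem_range] at hk ⊢; omega
  · rw [Finset.mem_range] at hk
    rw [pow_mem_tail_one hy k m (by omega), smul_zero]

theorem evalSeries_mem_tail (c : ℕ → ℚ) (hc : c 0 = 0) {y : MvPowerSeries σ A} {N : ℕ}
    (hy : y ∈ tail σ A N) : evalSeries c y ∈ tail σ A N := by
  intro m hm
  change ∑ k ∈ Finset.range (m.degree + 1), c k • MvPowerSeries.coeff m (y ^ k) = 0
  refine Finset.sum_eq_zero fun k _ => ?_
  rcases Nat.eq_zero_or_pos k with rfl | hk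
  · rw [hc, zero_smul]
  · rw [pow_mem_tail hy k m (hm.trans_le (Nat.le_mul_of_pos_left _ hk)), smul_zero]

theorem logSeries_mem_tail {y : MvPowerSeries σ A} {N : ℕ} (hy : y ∈ tail σ A N) :
    logSeries (1 + y) ∈ tail σ A N := by
  rw [logSeries_eq_evalSeries]
  exact evalSeries_mem_tail _ (by simp [logCoeff]) hy

/-- Compatibility with the degree filtration reduces this to partial sums, and an additive map
between rational vector spaces is automatically `ℚ`-linear. -/
theorem map_evalSeries (φ : MvPowerSeries σ A →+* MvPowerSeries τ B)
    (hφ : TailPreserving (φ : MvPowerSeries σ A →+ MvPowerSeries τ B)) (c : ℕ → ℚ)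
    {y : MvPowerSeries σ A} (hy : y ∈ tail σ A 1) :
    φ (evalSeries c y) = evalSeries c (φ y) := by
  refine eq_of_congrBelow fun N => ?_
  refine (hφ.congr (evalSeries_congr c hy le_rfl)).trans ?_
  refine CongrBelow.symm ((evalSeries_congr c (hφ 1 y hy) le_rfl).trans ?_)
  have : φ (∑ k ∈ Finset.range N, c k • y ^ k) = ∑ k ∈ Finset.range N, c k • φ y ^ k := by
    simp only [map_sum, map_rat_smul, map_pow]
  change CongrBelow N _ (φ _)
  rw [this]
  exact CongrBelow.rfl'

theorem map_expSeries (φ : MvPowerSeries σ A →+* MvPowerSeries τ B)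
    (hφ : TailPreserving (φ : MvPowerSeries σ A →+ MvPowerSeries τ B))
    {y : MvPowerSeries σ A} (hy : y ∈ tail σ A 1) : φ (expSeries y) = expSeries (φ y) :=
  map_evalSeries φ hφ _ hy

theorem map_logSeries (φ : MvPowerSeries σ A →+* MvPowerSeries τ B)
    (hφ : TailPreserving (φ : MvPowerSeries σ A →+ MvPowerSeries τ B))
    {y : MvPowerSeries σ A} (hy : y ∈ tail σ A 1) :
    φ (logSeries (1 + y)) = logSeries (1 + φ y) := by
  rw [logSeries_eq_evalSeries, logSeries_eq_evalSeries, map_evalSeries φ hφ _ hy]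

theorem coeff_zero_evalSeries (c : ℕ → ℚ) (y : MvPowerSeries σ A) :
    MvPowerSeries.coeff 0 (evalSeries c y) = algebraMap ℚ A (c 0) := by
  change ∑ k ∈ Finset.range ((0 : σ →₀ ℕ).degree + 1), c k • MvPowerSeries.coeff 0 (y ^ k) = _
  simp [Algebra.algebraMap_eq_smul_one]

theorem coeff_zero_expSeries (y : MvPowerSeries σ A) :
    MvPowerSeries.coeff 0 (expSeries y) = 1 := by
  rw [expSeries_eq_evalSeries, coeff_zero_evalSeries]; simp

theorem evalSeries_mul (c d : PowerSeries ℚ) {y : MvPowerSeries σ A} (hy : y ∈ tail σ A 1) :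
    evalSeries (fun k => PowerSeries.coeff k (c * d)) y =
      evalSeries (fun k => PowerSeries.coeff k c) y *
        evalSeries (fun k => PowerSeries.coeff k d) y := by
  refine eq_of_congrBelow fun N => ?_
  refine (evalSeries_congr _ hy le_rfl).trans (CongrBelow.symm ?_)
  refine ((evalSeries_congr _ hy le_rfl).mul (evalSeries_congr _ hy le_rfl)).trans ?_
  rw [Finset.sum_mul_sum]
  refine (congrBelow_sum_antidiagonal N _ fun i j => mul_mem_tail
    (Submodule.smul_mem _ _ (pow_mem_tail_one hy i))
    (Submodule.smul_mem _ _ (pow_mem_tail_one hy j))).symm.trans ?_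
  refine CongrBelow.sum fun k _ => ?_
  rw [PowerSeries.coeff_mul, Finset.sum_smul]
  refine CongrBelow.sum fun p hp => ?_
  rw [smul_mul_smul_comm, ← pow_add, mem_antidiagonal.1 hp]
  exact CongrBelow.rfl'

/-- Substitution of a power series without constant term into rational power series. -/
def evalHom (y : MvPowerSeries σ A) (hy : y ∈ tail σ A 1) :
    PowerSeries ℚ →+* MvPowerSeries σ A where
  toFun c := evalSeries (fun k => PowerSeries.coeff k c) y
  map_one' := by
    -- One term more than needed is kept, so that the index `0` is present even for `N = 0`.
    refine eq_of_congrBelow fun N => (evalSeries_congr _ hy (Nat.le_succ N)).trans ?_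
    rw [Finset.sum_eq_single 0] <;> simp +contextual [PowerSeries.coeff_one, CongrBelow.rfl']
  map_zero' := by
    funext m
    simp [evalSeries]
    rfl
  map_add' c d := by
    funext m
    simp [evalSeries, add_smul, Finset.sum_add_distrib]
    rfl
  map_mul' c d := evalSeries_mul c d hy

theorem evalHom_X (y : MvPowerSeries σ A) (hy : y ∈ tail σ A 1) :
    evalHom y hy PowerSeries.X = y := by
  refine eq_of_congrBelow fun N => (evalSeries_congr _ hy (Nat.le_add_right N 2)).trans ?_
  rw [Finset.sum_eq_single 1] <;>
    simp +contextual [PowerSeries.coeff_X, CongrBelow.rfl']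

theorem evalHom_tailPreserving (y : MvPowerSeries σ A) (hy : y ∈ tail σ A 1) :
    TailPreserving (evalHom y hy : MvPowerSeries Unit ℚ →+ MvPowerSeries σ A) := by
  intro N f hf m hm
  change ∑ k ∈ Finset.range (m.degree + 1),
    PowerSeries.coeff k f • MvPowerSeries.coeff m (y ^ k) = 0
  refine Finset.sum_eq_zero fun k hk => ?_
  rw [Finset.mem_range] at hk
  have : PowerSeries.coeff k f = 0 := hf _ (by rw [Finsupp.degree_single]; omega)
  rw [this, zero_smul]

/-! ### The exponential of a sum -/

theorem inv_factorial_mul_choose (i j : ℕ) :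
    ((i + j).factorial : ℚ)⁻¹ * ((i + j).choose i : ℚ) =
      (i.factorial : ℚ)⁻¹ * (j.factorial : ℚ)⁻¹ := by
  have hi : (i.factorial : ℚ) ≠ 0 := by exact_mod_cast Nat.factorial_ne_zero _
  have hj : (j.factorial : ℚ) ≠ 0 := by exact_mod_cast Nat.factorial_ne_zero _
  have hij : ((i + j).factorial : ℚ) ≠ 0 := by exact_mod_cast Nat.factorial_ne_zero _
  have := Nat.add_choose_mul_factorial_mul_factorial i j
  rw [← Nat.choose_symm_add] at this
  field_simp
  exact_mod_cast this

theorem expSeries_add {x y : MvPowerSeries σ A} (hx : x ∈ tail σ A 1) (hy : y ∈ tail σ A 1)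
    (hxy : Commute x y) : expSeries (x + y) = expSeries x * expSeries y := by
  refine eq_of_congrBelow fun N => ?_
  simp only [expSeries_eq_evalSeries]
  refine (evalSeries_congr _ (add_mem hx hy) le_rfl).trans (CongrBelow.symm ?_)
  refine ((evalSeries_congr _ hx le_rfl).mul (evalSeries_congr _ hy le_rfl)).trans ?_
  rw [Finset.sum_mul_sum]
  refine (congrBelow_sum_antidiagonal N _ fun i j => mul_mem_tail
    (Submodule.smul_mem _ _ (pow_mem_tail_one hx i))
    (Submodule.smul_mem _ _ (pow_mem_tail_one hy j))).symm.trans ?_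
  refine CongrBelow.sum fun k _ => ?_
  rw [hxy.add_pow', Finset.smul_sum]
  refine CongrBelow.sum fun p hp => ?_
  rw [mem_antidiagonal] at hp
  subst hp
  rw [smul_mul_smul_comm, ← Nat.cast_smul_eq_nsmul ℚ, smul_smul, inv_factorial_mul_choose]
  exact CongrBelow.rfl'

theorem expSeries_zero : expSeries (0 : MvPowerSeries σ A) = 1 := by
  refine eq_of_congrBelow fun N => ?_
  rw [expSeries_eq_evalSeries]
  refine (evalSeries_congr _ (zero_mem _) (Nat.le_succ N)).trans ?_
  rw [Finset.sum_eq_single 0] <;> simp +contextual [CongrBelow.rfl']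

theorem expSeries_mul_neg {x : MvPowerSeries σ A} (hx : x ∈ tail σ A 1) :
    expSeries x * expSeries (-x) = 1 := by
  rw [← expSeries_add hx (neg_mem hx) (Commute.refl x).neg_right, add_neg_cancel, expSeries_zero]

theorem expSeries_sub_one_mem_tail {x : MvPowerSeries σ A} {N : ℕ} (hx : x ∈ tail σ A N) :
    expSeries x - 1 ∈ tail σ A N := by
  classical
  intro m hm
  rw [map_sub, sub_eq_zero]
  change ∑ k ∈ Finset.range (m.degree + 1), _ = _
  rw [Finset.sum_range_succ', Finset.sum_eq_zero, zero_add]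
  · simp
  · intro k _
    rw [pow_mem_tail hx (k + 1) m (hm.trans_le (Nat.le_mul_of_pos_left _ (by omega))), smul_zero]

end Tail

end

end LimGroth

/-! ### Logarithmic derivatives and multiplicativity of `exp (T (log x))` -/

namespace LimGroth

open Finset.HasAntidiagonal (antidiagonal mem_antidiagonal)

noncomputable section

set_option linter.unusedSectionVars false

/-! ### Iterated commutators -/

section AdIter

variable {A : Type*} [Ring A]

/-- The iterated commutator `[y, [y, …, [y, a]…]]`. -/
def adIter (y : A) (k : ℕ) (a : A) : A := (fun w => y * w - w * y)^[k] a

theorem adIter_zero (y a : A) : adIter y 0 a = a := rfl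

theorem adIter_succ (y a : A) (k : ℕ) :
    adIter y (k + 1) a = y * adIter y k a - adIter y k a * y :=
  Function.iterate_succ_apply' _ _ _

/-- Left multiplication by `y` is the sum of the commuting operators `ad y` and right multiplication
by `y`; this is the binomial expansion of its powers. -/
theorem pow_mul_eq_sum_adIter (y a : A) (n : ℕ) :
    y ^ n * a = ∑ p ∈ antidiagonal n, n.choose p.1 • (adIter y p.1 a * y ^ p.2) := by
  induction n with
  | zero => simp [adIter_zero]
  | succ n ih =>
    rw [Finset.sum_antidiagonal_choose_succ_nsmul (fun i j => adIter y i a * y ^ j), pow_succ',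
      mul_assoc, ih, Finset.mul_sum, ← Finset.sum_add_distrib]
    refine Finset.sum_congr rfl fun p hp => ?_
    rw [← Nat.choose_symm_of_eq_add (mem_antidiagonal.1 hp).symm, ← smul_add, adIter_succ,
      mul_smul_comm, pow_succ']
    congr 1
    noncomm_ring

/-- In the Leibniz rule for `y ^ (n + 1) * y`, the summand `y ^ (n + 1) * D y` is expanded by
`pow_mul_eq_sum_adIter`, and Pascal's rule combines it with the induction hypothesis. -/
theorem derivation_pow_eq_sum_adIter (D : A →+ A) (hD : ∀ f g, D (f * g) = D f * g + f * D g)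
    (y : A) (n : ℕ) :
    D (y ^ (n + 1)) =
      ∑ p ∈ antidiagonal n, (n + 1).choose (p.1 + 1) • (adIter y p.1 (D y) * y ^ p.2) := by
  induction n with
  | zero => simp [adIter_zero]
  | succ n ih =>
    have h : ∑ p ∈ antidiagonal (n + 1), (n + 1).choose (p.1 + 1) •
        (adIter y p.1 (D y) * y ^ p.2) = D (y ^ (n + 1)) * y := by
      -- The extra term of the longer antidiagonal has coefficient `(n + 1).choose (n + 2) = 0`.
      rw [Finset.Nat.sum_antidiagonal_succ', ih, Finset.sum_mul]
      simp only [Nat.choose_succ_self, zero_smul, zero_add]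
      exact Finset.sum_congr rfl fun p _ => by rw [smul_mul_assoc, mul_assoc, pow_succ]
    rw [pow_succ, hD, ← h, pow_mul_eq_sum_adIter, ← Finset.sum_add_distrib]
    refine Finset.sum_congr rfl fun p _ => ?_
    rw [← add_smul, Nat.choose_succ_succ (n + 1), add_comm]

end AdIter

section Euler

variable {σ : Type*} {A B : Type*} [Ring A] [Algebra ℚ A] [Ring B] [Algebra ℚ B]

theorem adIter_mem_tail {y a : MvPowerSeries σ A} (hy : y ∈ tail σ A 1) {N : ℕ}
    (ha : a ∈ tail σ A N) (k : ℕ) : adIter y k a ∈ tail σ A (N + k) := by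
  induction k with
  | zero => exact ha
  | succ k ih =>
    rw [adIter_succ]
    have := mul_mem_tail hy ih
    rw [add_comm, add_assoc] at this
    exact sub_mem this (by simpa only [add_assoc] using mul_mem_tail ih hy)

/-- `∑ k, c k • ad y ^ k a` for a power series `y` without constant term. -/
def adSeries (c : ℕ → ℚ) (y a : MvPowerSeries σ A) : MvPowerSeries σ A :=
  fun m => ∑ k ∈ Finset.range (m.degree + 1), c k • MvPowerSeries.coeff m (adIter y k a)

theorem adSeries_congr (c : ℕ → ℚ) {y : MvPowerSeries σ A} (hy : y ∈ tail σ A 1)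
    (a : MvPowerSeries σ A) (N : ℕ) :
    CongrBelow N (adSeries c y a) (∑ k ∈ Finset.range N, c k • adIter y k a) := by
  refine CongrBelow.of_coeff fun m hm => ?_
  rw [map_sum]
  change ∑ k ∈ Finset.range (m.degree + 1), c k • MvPowerSeries.coeff m (adIter y k a) = _
  refine Finset.sum_subset (fun k hk => ?_) fun k _ hk => ?_
  · rw [Finset.mem_range] at hk ⊢; omega
  · rw [Finset.mem_range] at hk
    rw [adIter_mem_tail hy (mem_tail_zero a) k m (by omega), smul_zero]

theorem adSeries_of_commute (c : ℕ → ℚ) (hc : c 0 = 1) {y a : MvPowerSeries σ A}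
    (h : Commute y a) : adSeries c y a = a := by
  have h0 : ∀ k, adIter y (k + 1) a = 0 := by
    intro k
    induction k with
    | zero => rw [adIter_succ, adIter_zero, h.eq, sub_self]
    | succ k ih => rw [adIter_succ, ih, mul_zero, zero_mul, sub_zero]
  funext m
  change ∑ k ∈ Finset.range (m.degree + 1), _ = _
  rw [Finset.sum_range_succ']
  simp [h0, hc, adIter_zero]
  rfl

theorem adSeries_mem_tail_one (c : ℕ → ℚ) {y a : MvPowerSeries σ A} (hy : y ∈ tail σ A 1)
    (ha : a ∈ tail σ A 1) : adSeries c y a ∈ tail σ A 1 := by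
  intro m hm
  change ∑ k ∈ Finset.range (m.degree + 1), c k • MvPowerSeries.coeff m (adIter y k a) = 0
  exact Finset.sum_eq_zero fun k _ => by
    rw [adIter_mem_tail hy ha k m (by omega), smul_zero]

/-- The derivation multiplying a monomial by its degree. -/
def euler : MvPowerSeries σ A →+ MvPowerSeries σ A where
  toFun f := fun m => m.degree • MvPowerSeries.coeff m f
  map_zero' := by funext m; simp; rfl
  map_add' f g := by funext m; simp; rfl

theorem coeff_euler (m : σ →₀ ℕ) (f : MvPowerSeries σ A) :
    MvPowerSeries.coeff m (euler f) = m.degree • MvPowerSeries.coeff m f := rfl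

theorem euler_mul (f g : MvPowerSeries σ A) : euler (f * g) = euler f * g + f * euler g := by
  classical
  ext m
  rw [coeff_euler, map_add, MvPowerSeries.coeff_mul, MvPowerSeries.coeff_mul,
    MvPowerSeries.coeff_mul, ← Finset.sum_add_distrib, Finset.smul_sum]
  refine Finset.sum_congr rfl fun p hp => ?_
  rw [coeff_euler, coeff_euler, ← mem_antidiagonal.1 hp, map_add, add_smul, smul_mul_assoc,
    mul_smul_comm]

theorem euler_one : euler (1 : MvPowerSeries σ A) = 0 := by
  have := euler_mul (1 : MvPowerSeries σ A) 1
  simpa using this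

theorem euler_tailPreserving : TailPreserving (euler : MvPowerSeries σ A →+ _) := by
  intro N f hf m hm
  rw [coeff_euler, hf m hm, smul_zero]

theorem euler_mem_tail_one (f : MvPowerSeries σ A) : euler f ∈ tail σ A 1 := by
  rw [mem_tail_one, coeff_euler, map_zero, zero_smul]

theorem euler_qsmul (c : ℚ) (f : MvPowerSeries σ A) : euler (c • f) = c • euler f :=
  map_rat_smul _ c f

/-- Uniqueness for a linear differential equation. Since `a` has no constant term, agreement below
degree `N` determines `a * g` in degree `N`, and a positive degree can be divided out over `ℚ`. -/
theorem eq_of_euler_eq {a g h : MvPowerSeries σ A} (ha : a ∈ tail σ A 1)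
    (hg : euler g = a * g) (hh : euler h = a * h)
    (h0 : MvPowerSeries.coeff 0 g = MvPowerSeries.coeff 0 h) : g = h := by
  classical
  have key : ∀ N, CongrBelow N g h := by
    intro N
    induction N with
    | zero => exact mem_tail_zero _
    | succ N ih =>
      refine CongrBelow.of_coeff fun m hm => ?_
      rcases Nat.eq_zero_or_pos m.degree with h1 | h1
      · rw [Finsupp.degree_eq_zero_iff] at h1
        rw [h1, h0]
      have h2 : a * (g - h) ∈ tail σ A (1 + N) := mul_mem_tail ha ih
      have h3 : MvPowerSeries.coeff m (euler (g - h)) = 0 := by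
        rw [map_sub euler, hg, hh, ← mul_sub]
        exact h2 m (by omega)
      rw [coeff_euler, ← Nat.cast_smul_eq_nsmul ℚ, smul_eq_zero, map_sub, sub_eq_zero] at h3
      refine h3.resolve_left ?_
      exact_mod_cast h1.ne'
  exact eq_of_congrBelow key

/-- The power series `(exp x - 1) / x`. -/
def phiCoeff (k : ℕ) : ℚ := ((k + 1).factorial : ℚ)⁻¹

/-- The formula `e^y a e^{-y} = e^{ad y} a`, with the inverse moved to the other side. -/
theorem expSeries_mul {y : MvPowerSeries σ A} (hy : y ∈ tail σ A 1) (a : MvPowerSeries σ A) :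
    expSeries y * a = adSeries (fun k => (k.factorial : ℚ)⁻¹) y a * expSeries y := by
  refine eq_of_congrBelow fun N => ?_
  rw [expSeries_eq_evalSeries]
  refine ((evalSeries_congr _ hy le_rfl).mul CongrBelow.rfl').trans (CongrBelow.symm ?_)
  refine ((adSeries_congr _ hy a N).mul (evalSeries_congr _ hy le_rfl)).trans ?_
  rw [Finset.sum_mul_sum]
  refine (congrBelow_sum_antidiagonal N _ fun i j => mul_mem_tail
    (Submodule.smul_mem _ _ (by simpa using adIter_mem_tail hy (mem_tail_zero a) i))
    (Submodule.smul_mem _ _ (pow_mem_tail_one hy j))).symm.trans ?_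
  rw [Finset.sum_mul]
  refine CongrBelow.sum fun n _ => ?_
  rw [smul_mul_assoc, pow_mul_eq_sum_adIter, Finset.smul_sum]
  refine CongrBelow.sum fun p hp => ?_
  rw [mem_antidiagonal] at hp
  subst hp
  rw [smul_mul_smul_comm, ← Nat.cast_smul_eq_nsmul ℚ, smul_smul, inv_factorial_mul_choose]
  exact CongrBelow.rfl'

/-- The derivative of the exponential: with `D` the Euler derivation, `D(e^y) e^{-y} = ((e^{ad y} -
1) / ad y)(D y)`. The point is that the right side is built from `y` and `D y` by commutators alone.
-/
theorem euler_expSeries {y : MvPowerSeries σ A} (hy : y ∈ tail σ A 1) :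
    euler (expSeries y) = adSeries phiCoeff y (euler y) * expSeries y := by
  refine eq_of_congrBelow fun N => ?_
  rw [expSeries_eq_evalSeries]
  refine (euler_tailPreserving.congr (evalSeries_congr _ hy (Nat.le_succ N))).trans
    (CongrBelow.symm ?_)
  refine ((adSeries_congr _ hy _ N).mul (evalSeries_congr _ hy le_rfl)).trans ?_
  rw [Finset.sum_mul_sum]
  refine (congrBelow_sum_antidiagonal N _ fun i j => mul_mem_tail
    (Submodule.smul_mem _ _ (by simpa using adIter_mem_tail hy (mem_tail_zero _) i))
    (Submodule.smul_mem _ _ (pow_mem_tail_one hy j))).symm.trans ?_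
  rw [map_sum, Finset.sum_range_succ', euler_qsmul, pow_zero, euler_one, smul_zero, add_zero]
  refine CongrBelow.sum fun n _ => ?_
  rw [euler_qsmul, derivation_pow_eq_sum_adIter (euler : MvPowerSeries σ A →+ _) euler_mul,
    Finset.smul_sum]
  refine CongrBelow.sum fun p hp => ?_
  rw [mem_antidiagonal] at hp
  have h : n + 1 = p.1 + 1 + p.2 := by omega
  rw [smul_mul_smul_comm, ← Nat.cast_smul_eq_nsmul ℚ, smul_smul, h, inv_factorial_mul_choose]
  exact CongrBelow.rfl'

theorem euler_expSeries_mul_expSeries {L M : MvPowerSeries σ A} (hL : L ∈ tail σ A 1)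
    (hM : M ∈ tail σ A 1) :
    euler (expSeries L * expSeries M) =
      (adSeries phiCoeff L (euler L) + adSeries (fun k => (k.factorial : ℚ)⁻¹) L
        (adSeries phiCoeff M (euler M))) * (expSeries L * expSeries M) := by
  rw [euler_mul, euler_expSeries hL, euler_expSeries hM, add_mul, ← mul_assoc (expSeries L),
    expSeries_mul hL]
  simp only [mul_assoc]

/-! ### The exponential of the logarithm -/

theorem X_mem_tail_one (A : Type*) [Ring A] [Algebra ℚ A] :
    (PowerSeries.X : PowerSeries A) ∈ tail Unit A 1 :=
  mem_tail_one.2 (MvPowerSeries.coeff_zero_X _)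

theorem powerSeries_coeff_euler (k : ℕ) (f : PowerSeries A) :
    PowerSeries.coeff k (euler (σ := Unit) f : PowerSeries A) = k • PowerSeries.coeff k f := by
  change (Finsupp.single () k).degree • PowerSeries.coeff k f = _
  rw [Finsupp.degree_single]

/-- Both sides have constant term `1` and solve `euler g = euler (log (1 + X)) * g`; over `ℚ` the
commutator terms disappear. -/
theorem expSeries_logSeries_X :
    expSeries (logSeries (1 + PowerSeries.X : PowerSeries ℚ) : MvPowerSeries Unit ℚ) =
      (1 + PowerSeries.X : PowerSeries ℚ) := by
  have hX := X_mem_tail_one ℚ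
  have hL : logSeries (1 + PowerSeries.X : PowerSeries ℚ) ∈ tail Unit ℚ 1 :=
    logSeries_mem_tail hX
  have hcoeff : ∀ k, PowerSeries.coeff k
      (logSeries (1 + PowerSeries.X : PowerSeries ℚ) : PowerSeries ℚ) = logCoeff k := by
    intro k
    rw [logSeries_eq_evalSeries]
    change ∑ j ∈ Finset.range ((Finsupp.single () k).degree + 1),
      logCoeff j • PowerSeries.coeff k (PowerSeries.X ^ j) = _
    rw [Finsupp.degree_single, Finset.sum_eq_single k]
    · simp [PowerSeries.coeff_X_pow]
    · intro j _ hj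
      simp [PowerSeries.coeff_X_pow, hj.symm]
    · simp
  have hD : (1 + PowerSeries.X : PowerSeries ℚ) *
      euler (logSeries (1 + PowerSeries.X : PowerSeries ℚ)) = PowerSeries.X := by
    have he : ∀ k, PowerSeries.coeff k (euler (logSeries (1 + PowerSeries.X : PowerSeries ℚ)) :
        PowerSeries ℚ) = k • logCoeff k := by
      intro k
      rw [← hcoeff, powerSeries_coeff_euler]
    ext k
    rw [add_mul, one_mul, map_add, he]
    rcases k with _ | k
    · simp
    · rw [PowerSeries.coeff_succ_X_mul, he, PowerSeries.coeff_X]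
      rcases k with _ | k
      · simp [logCoeff]
      · have h1 : ((k : ℚ) + 1 + 1) ≠ 0 := by positivity
        have h2 : ((k : ℚ) + 1) ≠ 0 := by positivity
        simp only [logCoeff, nsmul_eq_mul]
        push_cast
        rw [mul_div_cancel₀ _ h1, mul_div_cancel₀ _ h2]
        simp [pow_succ]
  refine eq_of_euler_eq (a := euler (logSeries (1 + PowerSeries.X : PowerSeries ℚ)))
    (euler_mem_tail_one _) ?_ ?_ ?_
  · rw [euler_expSeries hL, adSeries_of_commute _ (by simp [phiCoeff]) (Commute.all _ _)]
  · rw [mul_comm]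
    refine Eq.trans ?_ hD.symm
    rw [map_add, euler_one, zero_add]
    ext k
    rw [powerSeries_coeff_euler, PowerSeries.coeff_X]
    split_ifs with h <;> simp [h]
  · rw [coeff_zero_expSeries]
    refine Eq.symm ((map_add (MvPowerSeries.coeff (0 : Unit →₀ ℕ)) 1 _).trans ?_)
    rw [MvPowerSeries.coeff_zero_one]
    exact (congrArg (1 + ·) (MvPowerSeries.coeff_zero_X ())).trans (add_zero _)

/-- Transported from `ℚ[[X]]` along the substitution `X ↦ y`; only powers of the single element `y`
occur, so noncommutativity of `A` plays no role. -/
theorem expSeries_logSeries {y : MvPowerSeries σ A} (hy : y ∈ tail σ A 1) :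
    expSeries (logSeries (1 + y)) = 1 + y := by
  have hX := X_mem_tail_one ℚ
  have h := congrArg (evalHom y hy) expSeries_logSeries_X
  have hlog := map_logSeries (σ := Unit) (evalHom y hy) (evalHom_tailPreserving y hy) hX
  have hexp := map_expSeries (σ := Unit) (evalHom y hy) (evalHom_tailPreserving y hy)
    (logSeries_mem_tail hX)
  have hy' := evalHom_X y hy
  rw [map_add, map_one, hy'] at h
  rw [hy'] at hlog
  rw [← hlog, ← hexp]
  exact h

/-! ### Lie homomorphisms applied to coefficients -/

/-- A linear map applied to the coefficients of a power series. -/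
def mapCoeff (T : A →ₗ[ℚ] B) : MvPowerSeries σ A →ₗ[ℚ] MvPowerSeries σ B where
  toFun f := fun m => T (MvPowerSeries.coeff m f)
  map_add' f g := by funext m; rw [map_add, map_add]; rfl
  map_smul' c f := by funext m; rw [coeff_qsmul, map_smul]; rfl

theorem coeff_mapCoeff (T : A →ₗ[ℚ] B) (m : σ →₀ ℕ) (f : MvPowerSeries σ A) :
    MvPowerSeries.coeff m (mapCoeff T f) = T (MvPowerSeries.coeff m f) := rfl

theorem mapCoeff_mem_tail (T : A →ₗ[ℚ] B) {N : ℕ} {f : MvPowerSeries σ A}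
    (hf : f ∈ tail σ A N) : mapCoeff T f ∈ tail σ B N := fun m hm => by
  rw [coeff_mapCoeff, hf m hm, map_zero]

/-- A linear map compatible with commutators. -/
def PreservesCommutator (T : A →ₗ[ℚ] B) : Prop :=
  ∀ a b, T (a * b - b * a) = T a * T b - T b * T a

theorem coeff_mul_swap [DecidableEq σ] (f g : MvPowerSeries σ A) (m : σ →₀ ℕ) :
    MvPowerSeries.coeff m (f * g) =
      ∑ p ∈ antidiagonal m, MvPowerSeries.coeff p.2 f * MvPowerSeries.coeff p.1 g := by
  rw [MvPowerSeries.coeff_mul]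
  exact Finset.sum_nbij' Prod.swap Prod.swap
    (fun p hp => by simpa [add_comm] using hp) (fun p hp => by simpa [add_comm] using hp)
    (fun _ _ => rfl) (fun _ _ => rfl) (fun _ _ => rfl)

variable {T : A →ₗ[ℚ] B}

/-- Matching the term `(i, j)` of `f * g` with the term `(j, i)` of `g * f` exhibits each
coefficient of the commutator as a sum of commutators of coefficients. -/
theorem PreservesCommutator.mapCoeff (hT : PreservesCommutator T) :
    PreservesCommutator (mapCoeff T : MvPowerSeries σ A →ₗ[ℚ] _) := by
  classical
  intro f g
  ext m
  rw [coeff_mapCoeff, map_sub, map_sub, map_sub, MvPowerSeries.coeff_mul,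
    coeff_mul_swap, MvPowerSeries.coeff_mul, coeff_mul_swap (LimGroth.mapCoeff T g), _root_.map_sum,
    _root_.map_sum, ← Finset.sum_sub_distrib, ← Finset.sum_sub_distrib]
  exact Finset.sum_congr rfl fun p _ => (map_sub T _ _).symm.trans (hT _ _)

theorem PreservesCommutator.map_adIter (hT : PreservesCommutator T) (y a : A) (k : ℕ) :
    T (adIter y k a) = adIter (T y) k (T a) := by
  induction k with
  | zero => rfl
  | succ k ih => rw [adIter_succ, hT, ih, adIter_succ]

theorem PreservesCommutator.map_adSeries (hT : PreservesCommutator T) (c : ℕ → ℚ)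
    (y a : MvPowerSeries σ A) :
    LimGroth.mapCoeff T (adSeries c y a) =
      adSeries c (LimGroth.mapCoeff T y) (LimGroth.mapCoeff T a) := by
  funext m
  change T (∑ k ∈ Finset.range (m.degree + 1), c k • MvPowerSeries.coeff m (adIter y k a)) =
    ∑ k ∈ Finset.range (m.degree + 1), c k • MvPowerSeries.coeff m (adIter _ k _)
  rw [_root_.map_sum]
  refine Finset.sum_congr rfl fun k _ => ?_
  rw [map_smul, ← hT.mapCoeff.map_adIter]
  rfl

theorem mapCoeff_euler (f : MvPowerSeries σ A) :
    mapCoeff T (euler f) = euler (mapCoeff T f) := by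
  ext m
  rw [coeff_mapCoeff, coeff_euler, coeff_euler, coeff_mapCoeff, map_nsmul]

/-- `exp (T (log x))` is multiplicative in `x`. -/
theorem expSeries_mapCoeff_logSeries_mul (hT : PreservesCommutator T)
    {y z : MvPowerSeries σ A} (hy : y ∈ tail σ A 1) (hz : z ∈ tail σ A 1) :
    expSeries (mapCoeff T (logSeries (1 + (y + z + y * z)))) =
      expSeries (mapCoeff T (logSeries (1 + y))) * expSeries (mapCoeff T (logSeries (1 + z))) := by
  have hw : y + z + y * z ∈ tail σ A 1 := add_mem (add_mem hy hz) (mul_mem_tail_right _ hy)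
  have hL := logSeries_mem_tail hy
  have hM := logSeries_mem_tail hz
  have hK := logSeries_mem_tail hw
  have hyz : expSeries (logSeries (1 + (y + z + y * z))) =
      expSeries (logSeries (1 + y)) * expSeries (logSeries (1 + z)) := by
    rw [expSeries_logSeries hy, expSeries_logSeries hz, expSeries_logSeries hw]
    noncomm_ring
  generalize logSeries (1 + y) = L at *
  generalize logSeries (1 + z) = M at *
  generalize logSeries (1 + (y + z + y * z)) = K at *
  -- The logarithmic derivatives of `e^K` and `e^L e^M` agree. Only commutators and linear
  -- operations occur here, so the identity survives application of `T`; this takes the place of the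
  -- Baker-Campbell-Hausdorff formula.
  have hsource : adSeries phiCoeff K (euler K) =
      adSeries phiCoeff L (euler L) + adSeries (fun k => (k.factorial : ℚ)⁻¹) L
          (adSeries phiCoeff M (euler M)) := by
    have h := euler_expSeries_mul_expSeries hL hM
    rw [← hyz, euler_expSeries hK] at h
    have h2 := congrArg (· * expSeries (-K)) h
    simpa only [mul_assoc, expSeries_mul_neg hK, mul_one] using h2
  have htarget := congrArg (mapCoeff T) hsource
  rw [map_add, hT.map_adSeries, hT.map_adSeries, hT.map_adSeries, hT.map_adSeries,
    mapCoeff_euler, mapCoeff_euler, mapCoeff_euler] at htarget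
  -- After applying `T`, both sides solve the same Euler equation and have constant term `1`.
  refine eq_of_euler_eq (a := adSeries phiCoeff (mapCoeff T K) (euler (mapCoeff T K)))
    (adSeries_mem_tail_one _ (mapCoeff_mem_tail T hK) (euler_mem_tail_one _))
    (euler_expSeries (mapCoeff_mem_tail T hK)) ?_ ?_
  · rw [htarget]
    exact euler_expSeries_mul_expSeries (mapCoeff_mem_tail T hL) (mapCoeff_mem_tail T hM)
  · classical
    rw [coeff_zero_expSeries, MvPowerSeries.coeff_mul]
    simp [coeff_zero_expSeries]

end Euler

end

end LimGroth

/-! ### Universal property and generators of the rational algebra -/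

namespace LimGroth

noncomputable section

/-! ### The universal property of `𝒢_∞^ℚ(R)` -/

section GQ

attribute [local instance 100] LieRing.ofAssociativeRing

variable {R : Type*} [Ring R]

theorem RatR.lie_eq (a b : RatR R) : ⁅a, b⁆ = a * b - b * a := rfl

theorem T_apply (i : ℕ+) (a : RatR R) :
    T i a = TensorFamily.incl ℚ (fun _ : ℕ+ => Env R) i (UniversalEnvelopingAlgebra.ι ℚ a) := rfl

theorem T_preservesCommutator (i : ℕ+) : PreservesCommutator (T i : RatR R →ₗ[ℚ] GQ R) := by
  intro a b
  rw [T_apply, T_apply, T_apply, ← RatR.lie_eq, LieHom.map_lie, LieRing.of_associative_ring_bracket]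
  exact (map_sub _ _ _).trans (congrArg₂ _ (map_mul _ _ _) (map_mul _ _ _))

theorem T_commute {i j : ℕ+} (hij : i ≠ j) (a b : RatR R) : Commute (T i a) (T j b) := by
  rw [T_apply, T_apply]
  have h := RingQuot.mkAlgHom_rel ℚ (CommRel.comm (k := ℚ) (B := fun _ : ℕ+ => Env R) i j hij
    (UniversalEnvelopingAlgebra.ι ℚ a) (UniversalEnvelopingAlgebra.ι ℚ b))
  rw [map_mul, map_mul] at h
  exact h

variable {C : Type*} [Ring C] [Algebra ℚ C]

/-- The Lie homomorphism given by a linear map compatible with commutators. -/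
def lieHomOfPreservesCommutator (τ : RatR R →ₗ[ℚ] C) (hτ : PreservesCommutator τ) :
    RatR R →ₗ⁅ℚ⁆ C :=
  { τ with map_lie' := fun {a b} => hτ a b }

/-- The universal property maps the enveloping algebra into the subalgebra `S`; followed by the
inclusion this is the identity by uniqueness, so `S` is everything. -/
theorem env_induction {p : Env R → Prop} (hp : ∃ S : Subalgebra ℚ (Env R), ∀ x, x ∈ S ↔ p x)
    (hι : ∀ a : RatR R, p (UniversalEnvelopingAlgebra.ι ℚ a)) (x : Env R) : p x := by
  obtain ⟨S, hS⟩ := hp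
  let f : RatR R →ₗ⁅ℚ⁆ S :=
    { toFun := fun a => ⟨UniversalEnvelopingAlgebra.ι ℚ a, (hS _).2 (hι a)⟩
      map_add' := fun a b => Subtype.ext (map_add _ a b)
      map_smul' := fun c a => Subtype.ext (map_smul _ c a)
      map_lie' := fun {a b} => Subtype.ext (LieHom.map_lie _ a b) }
  have h : S.val.comp (UniversalEnvelopingAlgebra.lift ℚ f) = AlgHom.id ℚ (Env R) := by
    apply UniversalEnvelopingAlgebra.hom_ext
    ext a
    simp [f]
  rw [← hS, ← AlgHom.id_apply (R := ℚ) x, ← h]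
  exact Subtype.prop _

/-- A family of commuting linear maps compatible with commutators induces a homomorphism. -/
def liftGQ (τ : ℕ+ → RatR R →ₗ[ℚ] C) (hτ : ∀ i, PreservesCommutator (τ i))
    (hc : ∀ i j, i ≠ j → ∀ a b, Commute (τ i a) (τ j b)) : GQ R →ₐ[ℚ] C :=
  RingQuot.liftAlgHom ℚ ⟨LinearAlgebra.FreeProduct.lift ℚ (fun _ : ℕ+ => Env R)
    (fun {i} => UniversalEnvelopingAlgebra.lift ℚ (lieHomOfPreservesCommutator (τ i) (hτ i))), by
    rintro _ _ ⟨i, j, hij, x, y⟩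
    have hι : ∀ (i : ℕ+) (x : Env R), LinearAlgebra.FreeProduct.lift ℚ (fun _ : ℕ+ => Env R)
        (fun {i} => UniversalEnvelopingAlgebra.lift ℚ (lieHomOfPreservesCommutator (τ i) (hτ i)))
        (LinearAlgebra.FreeProduct.ι ℚ (fun _ : ℕ+ => Env R) i x) =
        UniversalEnvelopingAlgebra.lift ℚ (lieHomOfPreservesCommutator (τ i) (hτ i)) x := by
      intro i x
      exact DFunLike.congr_fun (LinearAlgebra.FreeProduct.lift_comp_ι ℚ (fun _ : ℕ+ => Env R)
        (fun {i} => UniversalEnvelopingAlgebra.lift ℚ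
          (lieHomOfPreservesCommutator (τ i) (hτ i)))) x
    rw [map_mul, map_mul, hι, hι]
    -- Commuting with a fixed element defines a subalgebra, a preimage of a centralizer, so it is
    -- enough to test generators: in the factor `j` here, then in the factor `i`.
    revert y
    refine env_induction ⟨(Subalgebra.centralizer ℚ
      {UniversalEnvelopingAlgebra.lift ℚ (lieHomOfPreservesCommutator (τ i) (hτ i)) x}).comap
      (UniversalEnvelopingAlgebra.lift ℚ (lieHomOfPreservesCommutator (τ j) (hτ j))), ?_⟩ ?_
    · intro y
      simp [Subalgebra.mem_centralizer_iff]
    · intro b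
      revert x
      refine env_induction ⟨(Subalgebra.centralizer ℚ
        {UniversalEnvelopingAlgebra.lift ℚ (lieHomOfPreservesCommutator (τ j) (hτ j))
          (UniversalEnvelopingAlgebra.ι ℚ b)}).comap
        (UniversalEnvelopingAlgebra.lift ℚ (lieHomOfPreservesCommutator (τ i) (hτ i))), ?_⟩ ?_
      · intro y
        simp [Subalgebra.mem_centralizer_iff, eq_comm]
      · intro a
        rw [UniversalEnvelopingAlgebra.lift_ι_apply, UniversalEnvelopingAlgebra.lift_ι_apply]
        exact hc i j hij a b⟩

theorem liftGQ_T (τ : ℕ+ → RatR R →ₗ[ℚ] C) (hτ : ∀ i, PreservesCommutator (τ i))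
    (hc : ∀ i j, i ≠ j → ∀ a b, Commute (τ i a) (τ j b)) (i : ℕ+) (a : RatR R) :
    liftGQ τ hτ hc (T i a) = τ i a := by
  rw [T_apply]
  refine (RingQuot.liftAlgHom_mkAlgHom_apply ℚ _ _ _).trans ?_
  refine (DFunLike.congr_fun (LinearAlgebra.FreeProduct.lift_comp_ι ℚ (fun _ : ℕ+ => Env R)
        (fun {i} => UniversalEnvelopingAlgebra.lift ℚ
          (lieHomOfPreservesCommutator (τ i) (hτ i)))) _).trans ?_
  rw [UniversalEnvelopingAlgebra.lift_ι_apply]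
  rfl

theorem gq_hom_ext {D : Type*} [Ring D] [Algebra ℚ D] {f g : GQ R →ₐ[ℚ] D}
    (h : ∀ i a, f (T i a) = g (T i a)) : f = g := by
  refine RingQuot.ringQuot_ext' ℚ f g ?_
  apply (LinearAlgebra.FreeProduct.lift ℚ (fun _ : ℕ+ => Env R)).symm.injective
  funext i
  apply UniversalEnvelopingAlgebra.hom_ext
  ext a
  exact h i a

/-- The identity of `GQ R` factors through the generated subalgebra, by the universal property. -/
theorem adjoin_T : Algebra.adjoin ℚ {x : GQ R | ∃ i a, x = T i a} = ⊤ := by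
  rw [eq_top_iff]
  intro x _
  let S := Algebra.adjoin ℚ {x : GQ R | ∃ i a, x = T i a}
  have hS : ∀ i a, T i a ∈ S := fun i a => Algebra.subset_adjoin ⟨i, a, rfl⟩
  let f : GQ R →ₐ[ℚ] S := liftGQ
    (fun i => (T i).codRestrict (Subalgebra.toSubmodule S) (hS i))
    (fun i a b => Subtype.ext (T_preservesCommutator i a b))
    (fun i j hij a b => Subtype.ext (T_commute hij a b))
  have hf : S.val.comp f = AlgHom.id ℚ (GQ R) := by
    apply gq_hom_ext
    intro i a
    exact congrArg Subtype.val (liftGQ_T _ _ _ i a)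
  rw [← AlgHom.id_apply (R := ℚ) x, ← hf]
  exact Subtype.prop _

end GQ

end

end LimGroth

/-! ### Infinite products, the series `∏ Θ_l(1 + y_l)`, and monomial substitutions -/

namespace LimGroth

open Finset.HasAntidiagonal (antidiagonal mem_antidiagonal)

noncomputable section

set_option linter.unusedSectionVars false

/-! ### Infinite products of power series -/

section ProdSeries

variable {σ τ : Type*} {A B : Type*} [Ring A] [Algebra ℚ A] [Ring B] [Algebra ℚ B]

/-- The product of the first `N` terms of a sequence of power series. -/
def partialProd (F : ℕ+ → MvPowerSeries σ A) (N : ℕ) : MvPowerSeries σ A :=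
  ((List.range N).map fun l => F l.succPNat).prod

theorem partialProd_zero (F : ℕ+ → MvPowerSeries σ A) : partialProd F 0 = 1 := rfl

theorem partialProd_succ (F : ℕ+ → MvPowerSeries σ A) (N : ℕ) :
    partialProd F (N + 1) = partialProd F N * F N.succPNat := by
  unfold partialProd
  rw [List.range_succ, List.map_append, List.prod_append]
  simp

theorem partialProd_congr {F : ℕ+ → MvPowerSeries σ A} (hF : ∀ l : ℕ+, F l - 1 ∈ tail σ A l)
    {M N : ℕ} (hMN : M ≤ N) : CongrBelow (M + 1) (partialProd F N) (partialProd F M) := by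
  induction N, hMN using Nat.le_induction with
  | base => exact CongrBelow.rfl'
  | succ N hN ih =>
    refine CongrBelow.trans ?_ ih
    rw [partialProd_succ]
    have h : CongrBelow (M + 1) (F N.succPNat) 1 := tail_anti (by simpa using hN) (hF _)
    simpa using (CongrBelow.rfl' (f := partialProd F N)).mul h

theorem prodSeries_congr {F : ℕ+ → MvPowerSeries σ A} (hF : ∀ l : ℕ+, F l - 1 ∈ tail σ A l)
    {M N : ℕ} (hMN : M ≤ N) : CongrBelow (M + 1) (prodSeries F) (partialProd F N) := by
  refine CongrBelow.of_coeff fun m hm => ?_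
  exact ((partialProd_congr hF (M := m.degree) (N := N) (by omega)).coeff (by omega)).symm

theorem coeff_prodSeries {F : ℕ+ → MvPowerSeries σ A} (hF : ∀ l : ℕ+, F l - 1 ∈ tail σ A l)
    {m : σ →₀ ℕ} {N : ℕ} (hN : m.degree ≤ N) :
    MvPowerSeries.coeff m (prodSeries F) = MvPowerSeries.coeff m (partialProd F N) :=
  (prodSeries_congr hF hN).coeff (Nat.lt_succ_self _)

theorem map_partialProd (φ : MvPowerSeries σ A →+* MvPowerSeries τ B)
    (F : ℕ+ → MvPowerSeries σ A) (N : ℕ) :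
    φ (partialProd F N) = partialProd (fun l => φ (F l)) N := by
  induction N with
  | zero => rw [partialProd_zero, partialProd_zero, map_one]
  | succ N ih => rw [partialProd_succ, partialProd_succ, map_mul, ih]

theorem map_prodSeries (φ : MvPowerSeries σ A →+* MvPowerSeries τ B)
    (hφ : TailPreserving (φ : MvPowerSeries σ A →+ MvPowerSeries τ B))
    {F : ℕ+ → MvPowerSeries σ A} (hF : ∀ l : ℕ+, F l - 1 ∈ tail σ A l) :
    φ (prodSeries F) = prodSeries fun l => φ (F l) := by
  have hF' : ∀ l : ℕ+, φ (F l) - 1 ∈ tail τ B l := fun l => by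
    rw [← map_one φ, ← map_sub]
    exact hφ l _ (hF l)
  refine eq_of_congrBelow fun N => ?_
  refine (hφ.congr ((prodSeries_congr hF (le_refl N)).mono (Nat.le_succ N))).trans ?_
  refine CongrBelow.trans ?_ ((prodSeries_congr hF' (le_refl N)).mono (Nat.le_succ N)).symm
  rw [← map_partialProd]
  exact CongrBelow.rfl'

/-- Interleaving the two products moves each `F` factor only past `G` factors of smaller index, so
`F l` need not commute with `G l`. -/
theorem partialProd_mul {F G : ℕ+ → MvPowerSeries σ A}
    (h : ∀ i j, i ≠ j → Commute (F i) (G j)) (N : ℕ) :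
    partialProd F N * partialProd G N = partialProd (fun l => F l * G l) N := by
  have hc : ∀ M N, N ≤ M → Commute (F M.succPNat) (partialProd G N) := by
    intro M N hN
    induction N with
    | zero => exact Commute.one_right _
    | succ N ih =>
      rw [partialProd_succ]
      refine (ih (by omega)).mul_right (h _ _ fun hh => ?_)
      rw [Nat.succPNat_inj] at hh
      omega
  induction N with
  | zero => simp [partialProd_zero]
  | succ N ih =>
    rw [partialProd_succ, partialProd_succ, partialProd_succ, ← ih, mul_assoc,
      ← mul_assoc (F _), (hc N N le_rfl).eq]
    simp only [mul_assoc]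

theorem prodSeries_mul {F G : ℕ+ → MvPowerSeries σ A} (hF : ∀ l : ℕ+, F l - 1 ∈ tail σ A l)
    (hG : ∀ l : ℕ+, G l - 1 ∈ tail σ A l) (h : ∀ i j, i ≠ j → Commute (F i) (G j)) :
    prodSeries F * prodSeries G = prodSeries fun l => F l * G l := by
  have hFG : ∀ l : ℕ+, F l * G l - 1 ∈ tail σ A l := fun l => by
    have : F l * G l - 1 = (F l - 1) * G l + (G l - 1) := by noncomm_ring
    rw [this]
    exact add_mem (mul_mem_tail_right _ (hF l)) (hG l)
  refine eq_of_congrBelow fun N => ?_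
  refine (((prodSeries_congr hF (le_refl N)).mul (prodSeries_congr hG (le_refl N))).trans
    ?_).mono (Nat.le_succ N)
  rw [partialProd_mul h]
  exact (prodSeries_congr hFG (le_refl N)).symm

theorem commute_of_coeff {f g : MvPowerSeries σ A}
    (h : ∀ i j, Commute (MvPowerSeries.coeff i f) (MvPowerSeries.coeff j g)) : Commute f g := by
  classical
  refine MvPowerSeries.ext fun m => ?_
  rw [MvPowerSeries.coeff_mul, coeff_mul_swap]
  exact Finset.sum_congr rfl fun p _ => (h _ _).eq

theorem commute_expSeries {x y : MvPowerSeries σ A} (hx : x ∈ tail σ A 1)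
    (hxy : Commute x y) : Commute (expSeries x) y := by
  refine eq_of_congrBelow fun N => ?_
  rw [expSeries_eq_evalSeries]
  refine ((evalSeries_congr _ hx le_rfl).mul CongrBelow.rfl').trans (CongrBelow.symm ?_)
  refine (CongrBelow.rfl'.mul (evalSeries_congr _ hx le_rfl)).trans ?_
  rw [((Commute.sum_left _ _ _ fun k _ => (hxy.pow_left k).smul_left _ :
    Commute (∑ k ∈ Finset.range N, ((k.factorial : ℚ)⁻¹) • x ^ k) y)).eq]
  exact CongrBelow.rfl'

end ProdSeries

/-! ### Products of the series `Θ_l` -/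

section ThetaProd

variable {R : Type*} [Ring R] {σ τ : Type*}

theorem Theta_eq (l : ℕ+) (x : MvPowerSeries σ (RatR R)) :
    Theta l x = expSeries (mapCoeff (T l) (logSeries x)) := rfl

theorem mapCoeff_T_mem_tail (l : ℕ+) {y : MvPowerSeries σ (RatR R)} {N : ℕ}
    (hy : y ∈ tail σ (RatR R) N) : mapCoeff (T l) (logSeries (1 + y)) ∈ tail σ (GQ R) N :=
  mapCoeff_mem_tail _ (logSeries_mem_tail hy)

theorem Theta_sub_one_mem_tail (l : ℕ+) {y : MvPowerSeries σ (RatR R)} {N : ℕ}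
    (hy : y ∈ tail σ (RatR R) N) : Theta l (1 + y) - 1 ∈ tail σ (GQ R) N :=
  expSeries_sub_one_mem_tail (mapCoeff_T_mem_tail l hy)

theorem Theta_mul (l : ℕ+) {y z : MvPowerSeries σ (RatR R)} (hy : y ∈ tail σ (RatR R) 1)
    (hz : z ∈ tail σ (RatR R) 1) :
    Theta l (1 + y) * Theta l (1 + z) = Theta l (1 + (y + z + y * z)) :=
  (expSeries_mapCoeff_logSeries_mul (T_preservesCommutator l) hy hz).symm

theorem Theta_commute {i j : ℕ+} (hij : i ≠ j) {y z : MvPowerSeries σ (RatR R)}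
    (hy : y ∈ tail σ (RatR R) 1) (hz : z ∈ tail σ (RatR R) 1) :
    Commute (Theta i (1 + y)) (Theta j (1 + z)) :=
  commute_expSeries (mapCoeff_T_mem_tail i hy) (commute_expSeries (mapCoeff_T_mem_tail j hz)
    (commute_of_coeff fun _ _ => T_commute hij.symm _ _)).symm

/-- The product `∏_{l ≥ 1} Θ_l(1 + y_l)`. -/
def thetaProd (y : ℕ+ → MvPowerSeries σ (RatR R)) : MvPowerSeries σ (GQ R) :=
  prodSeries fun l => Theta l (1 + y l)

/-- The condition that `y_l` has no terms of degree less than `l`. -/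
def Admissible (y : ℕ+ → MvPowerSeries σ (RatR R)) : Prop := ∀ l : ℕ+, y l ∈ tail σ (RatR R) l

theorem Admissible.mem_tail_one {y : ℕ+ → MvPowerSeries σ (RatR R)} (hy : Admissible y) (l : ℕ+) :
    y l ∈ tail σ (RatR R) 1 := tail_anti l.2 (hy l)

/-- Factors with different indices commute because `T_i` and `T_j` do, and each `Θ_l` is
multiplicative, with `(1 + y)(1 + z) = 1 + (y + z + y z)`. This is the source of closure under
multiplication of the integral form. -/
theorem thetaProd_mul {y z : ℕ+ → MvPowerSeries σ (RatR R)} (hy : Admissible y)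
    (hz : Admissible z) :
    thetaProd y * thetaProd z = thetaProd fun l => y l + z l + y l * z l := by
  unfold thetaProd
  rw [prodSeries_mul (fun l => Theta_sub_one_mem_tail l (hy l))
    (fun l => Theta_sub_one_mem_tail l (hz l))
    fun i j hij => Theta_commute hij (hy.mem_tail_one i) (hz.mem_tail_one j)]
  congr 1
  funext l
  exact Theta_mul l (hy.mem_tail_one l) (hz.mem_tail_one l)

theorem map_thetaProd (φ : MvPowerSeries σ (RatR R) →+* MvPowerSeries τ (RatR R))
    (ψ : MvPowerSeries σ (GQ R) →+* MvPowerSeries τ (GQ R))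
    (hφ : TailPreserving (φ : MvPowerSeries σ (RatR R) →+ MvPowerSeries τ (RatR R)))
    (hψ : TailPreserving (ψ : MvPowerSeries σ (GQ R) →+ MvPowerSeries τ (GQ R)))
    (h : ∀ l f, ψ (mapCoeff (T l) f) = mapCoeff (T l) (φ f))
    {y : ℕ+ → MvPowerSeries σ (RatR R)} (hy : Admissible y) :
    ψ (thetaProd y) = thetaProd fun l => φ (y l) := by
  unfold thetaProd
  rw [map_prodSeries ψ hψ fun l => Theta_sub_one_mem_tail l (hy l)]
  congr 1
  funext l
  rw [Theta_eq, map_expSeries ψ hψ (mapCoeff_T_mem_tail l (hy.mem_tail_one l)), h,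
    map_logSeries φ hφ (hy.mem_tail_one l), Theta_eq]

end ThetaProd

/-! ### Substitution of monomials for the variables -/

section Substitution

variable {σ τ κ : Type*}

/-- A multiplicative assignment of monomials in the variables `τ`, or zero, to monomials in the
variables `σ`, described by its fibres. -/
structure MonomialSubst (σ τ : Type*) where
  fib : (τ →₀ ℕ) → Finset (σ →₀ ℕ)
  degree_le : ∀ m, ∀ n ∈ fib m, n.degree ≤ m.degree
  zero_mem : 0 ∈ fib 0
  unique : ∀ a b n, n ∈ fib a → n ∈ fib b → a = b
  add_mem : ∀ a b i j, i ∈ fib a → j ∈ fib b → i + j ∈ fib (a + b)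
  split : ∀ m i j, i + j ∈ fib m → ∃ a b, a + b = m ∧ i ∈ fib a ∧ j ∈ fib b

namespace MonomialSubst

variable (s : MonomialSubst σ τ) {A : Type*} [Ring A]

/-- The ring homomorphism given by a substitution of monomials. -/
def hom (A : Type*) [Ring A] : MvPowerSeries σ A →+* MvPowerSeries τ A where
  toFun f := fun m => ∑ n ∈ s.fib m, MvPowerSeries.coeff n f
  map_zero' := by funext m; simp; rfl
  map_add' f g := by funext m; simp [Finset.sum_add_distrib]; rfl
  map_one' := by
    classical
    funext m
    change _ = MvPowerSeries.coeff m (1 : MvPowerSeries τ A)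
    simp only [MvPowerSeries.coeff_one]
    rw [Finset.sum_ite_eq']
    refine if_congr ⟨fun h => s.unique _ _ _ h s.zero_mem, ?_⟩ rfl rfl
    rintro rfl
    exact s.zero_mem
  map_mul' f g := by
    classical
    funext m
    refine Eq.trans ?_ (MvPowerSeries.coeff_mul (φ := fun m => ∑ n ∈ s.fib m,
      MvPowerSeries.coeff n f) (ψ := fun m => ∑ n ∈ s.fib m, MvPowerSeries.coeff n g) ..).symm
    simp only [MvPowerSeries.coeff_mul]
    have h : ∀ p : (τ →₀ ℕ) × (τ →₀ ℕ),
        (MvPowerSeries.coeff p.1 fun m => ∑ n ∈ s.fib m, MvPowerSeries.coeff n f) *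
          (MvPowerSeries.coeff p.2 fun m => ∑ n ∈ s.fib m, MvPowerSeries.coeff n g) =
        ∑ q ∈ s.fib p.1 ×ˢ s.fib p.2, MvPowerSeries.coeff q.1 f * MvPowerSeries.coeff q.2 g := by
      intro p
      rw [Finset.sum_product]
      exact Finset.sum_mul_sum _ _ _ _
    simp only [h]
    rw [Finset.sum_sigma', Finset.sum_sigma']
    symm
    -- Both sides sum over pairs `(i, j)`; `unique` recovers the fibres containing them, and `split`
    -- shows that every decomposition upstairs comes from one of `m`.
    refine Finset.sum_bij (fun x _ => ⟨x.2.1 + x.2.2, x.2⟩) ?_ ?_ ?_ ?_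
    · rintro ⟨⟨a, b⟩, ⟨i, j⟩⟩ hx
      simp only [Finset.mem_sigma, mem_antidiagonal, Finset.mem_product] at hx ⊢
      obtain ⟨rfl, hi, hj⟩ := hx
      exact ⟨s.add_mem _ _ _ _ hi hj, trivial⟩
    · rintro ⟨⟨a, b⟩, ⟨i, j⟩⟩ hx ⟨⟨a', b'⟩, ⟨i', j'⟩⟩ hy hxy
      simp only [Finset.mem_sigma, mem_antidiagonal, Finset.mem_product] at hx hy
      simp only [Sigma.mk.injEq, heq_eq_eq, Prod.mk.injEq] at hxy
      obtain ⟨_, rfl, rfl⟩ := hxy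
      rw [s.unique _ _ _ hx.2.1 hy.2.1, s.unique _ _ _ hx.2.2 hy.2.2]
    · rintro ⟨n, ⟨i, j⟩⟩ hx
      simp only [Finset.mem_sigma, mem_antidiagonal] at hx
      obtain ⟨hn, rfl⟩ := hx
      obtain ⟨a, b, hab, hi, hj⟩ := s.split _ _ _ hn
      exact ⟨⟨⟨a, b⟩, ⟨i, j⟩⟩, by simp [hab, hi, hj], rfl⟩
    · rintro ⟨⟨a, b⟩, ⟨i, j⟩⟩ _
      rfl

theorem coeff_hom (m : τ →₀ ℕ) (f : MvPowerSeries σ A) :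
    MvPowerSeries.coeff m (s.hom A f) = ∑ n ∈ s.fib m, MvPowerSeries.coeff n f := rfl

theorem hom_tailPreserving [Algebra ℚ A] :
    TailPreserving (s.hom A : MvPowerSeries σ A →+ MvPowerSeries τ A) := by
  intro N f hf m hm
  change ∑ n ∈ s.fib m, MvPowerSeries.coeff n f = 0
  exact Finset.sum_eq_zero fun n hn => hf n ((s.degree_le m n hn).trans_lt hm)

theorem hom_mapCoeff {B : Type*} [Algebra ℚ A] [Ring B] [Algebra ℚ B] (T : A →ₗ[ℚ] B)
    (f : MvPowerSeries σ A) : s.hom B (mapCoeff T f) = mapCoeff T (s.hom A f) := by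
  ext m
  rw [coeff_hom, coeff_mapCoeff, coeff_hom, map_sum]
  rfl

theorem hom_thetaProd {R : Type*} [Ring R] {y : ℕ+ → MvPowerSeries σ (RatR R)}
    (hy : Admissible y) : s.hom (GQ R) (thetaProd y) = thetaProd fun l => s.hom (RatR R) (y l) :=
  map_thetaProd _ _ s.hom_tailPreserving s.hom_tailPreserving (fun _ _ => s.hom_mapCoeff _ _) hy

end MonomialSubst

/-- The exponent of the monomial obtained by substituting the monomial with exponent `w k` for
the variable indexed by `k`. -/
def substExponent (w : κ → τ →₀ ℕ) (n : κ →₀ ℕ) : τ →₀ ℕ := n.sum fun k c => c • w k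

theorem substExponent_add (w : κ → τ →₀ ℕ) (m n : κ →₀ ℕ) :
    substExponent w (m + n) = substExponent w m + substExponent w n :=
  Finsupp.sum_add_index' (fun _ => zero_smul _ _) fun _ _ _ => add_smul _ _ _

theorem substExponent_single (w : κ → τ →₀ ℕ) (k : κ) (c : ℕ) :
    substExponent w (Finsupp.single k c) = c • w k :=
  Finsupp.sum_single_index (zero_smul _ _)

theorem degree_le_substExponent {w : κ → τ →₀ ℕ} (hw : ∀ k, w k ≠ 0) (n : κ →₀ ℕ) :
    n.degree ≤ (substExponent w n).degree := by
  unfold substExponent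
  rw [Finsupp.sum, map_sum, Finsupp.degree_apply]
  refine Finset.sum_le_sum fun k _ => ?_
  rw [map_nsmul, smul_eq_mul]
  refine Nat.le_mul_of_pos_right _ (Nat.pos_of_ne_zero fun h => hw k ?_)
  rwa [Finsupp.degree_eq_zero_iff] at h

theorem single_one_ne_zero (k : κ) : Finsupp.single k 1 ≠ (0 : κ →₀ ℕ) := by simp

theorem exists_embDomain_eq_of_le (e : κ ↪ σ) {n : κ →₀ ℕ} {i : σ →₀ ℕ} (hi : i ≤ n.embDomain e) :
    ∃ i' : κ →₀ ℕ, i'.embDomain e = i := by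
  refine ⟨i.comapDomain e e.injective.injOn, ?_⟩
  rw [Finsupp.embDomain_eq_mapDomain]
  refine Finsupp.mapDomain_comapDomain _ e.injective _ fun x hx => ?_
  by_contra hx'
  have := hi x
  rw [Finsupp.embDomain_of_notMem_range _ _ _ hx'] at this
  exact (Finsupp.mem_support_iff.1 hx) (Nat.le_zero.1 this)

theorem degree_embDomain (e : κ ↪ σ) (n : κ →₀ ℕ) : (n.embDomain e).degree = n.degree := by
  simp [Finsupp.degree_apply, Finsupp.support_embDomain]

/-- The restriction to the variables in the range of an injection. -/
def restrict (e : κ ↪ σ) : MonomialSubst σ κ where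
  fib m := {m.embDomain e}
  degree_le m n hn := by
    rw [Finset.mem_singleton.1 hn, degree_embDomain]
  zero_mem := Finset.mem_singleton.2 (Finsupp.embDomain_zero e).symm
  unique a b n ha hb :=
    Finsupp.embDomain_injective e ((Finset.mem_singleton.1 ha).symm.trans (Finset.mem_singleton.1 hb))
  add_mem a b i j hi hj := by
    rw [Finset.mem_singleton.1 hi, Finset.mem_singleton.1 hj, Finset.mem_singleton,
      Finsupp.embDomain_add]
  split m i j h := by
    have h := Finset.mem_singleton.1 h
    obtain ⟨i', rfl⟩ := exists_embDomain_eq_of_le e (h ▸ self_le_add_right i j)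
    obtain ⟨j', rfl⟩ := exists_embDomain_eq_of_le e (h ▸ self_le_add_left j (i'.embDomain e))
    rw [← Finsupp.embDomain_add] at h
    exact ⟨i', j', Finsupp.embDomain_injective e h, Finset.mem_singleton_self _,
      Finset.mem_singleton_self _⟩

theorem coeff_restrict (e : κ ↪ σ) {A : Type*} [Ring A] (f : MvPowerSeries σ A) (n : κ →₀ ℕ) :
    MvPowerSeries.coeff n ((restrict e).hom A f) = MvPowerSeries.coeff (n.embDomain e) f := by
  rw [MonomialSubst.coeff_hom]
  exact Finset.sum_singleton _ _

variable [Finite κ] (e : κ ↪ σ) (w : κ → τ →₀ ℕ)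

/-- Substituting nontrivial monomials does not lower degrees, and finitely many variables have
finitely many exponents of bounded degree. -/
theorem finite_setOf_substExponent_eq (hw : ∀ k, w k ≠ 0) (m : τ →₀ ℕ) :
    {n : κ →₀ ℕ | substExponent w n = m}.Finite := by
  refine (Finsupp.finite_of_degree_le m.degree).subset fun n hn => ?_
  rw [Set.mem_ofPred_eq] at hn ⊢
  rw [← hn]
  exact degree_le_substExponent hw n

open scoped Classical in
/-- The substitution of the monomial with exponent `w k` for the variable indexed by `e k`, and of
zero for the variables outside the range of `e`. -/
def finiteSubst (hw : ∀ k, w k ≠ 0) : MonomialSubst σ τ where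
  fib m := (finite_setOf_substExponent_eq w hw m).toFinset.image (Finsupp.embDomain e)
  degree_le m n hn := by
    simp only [Finset.mem_image, Set.Finite.mem_toFinset, Set.mem_ofPred_eq] at hn
    obtain ⟨n, rfl, rfl⟩ := hn
    refine le_trans (le_of_eq ?_) (degree_le_substExponent hw n)
    simp [Finsupp.degree_apply, Finsupp.support_embDomain]
  zero_mem := by
    simp only [Finset.mem_image, Set.Finite.mem_toFinset, Set.mem_ofPred_eq]
    exact ⟨0, Finsupp.sum_zero_index, Finsupp.embDomain_zero _⟩
  unique a b n ha hb := by
    simp only [Finset.mem_image, Set.Finite.mem_toFinset, Set.mem_ofPred_eq] at ha hb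
    obtain ⟨n, rfl, rfl⟩ := ha
    obtain ⟨n', rfl, h⟩ := hb
    rw [Finsupp.embDomain_injective e h]
  add_mem a b i j hi hj := by
    simp only [Finset.mem_image, Set.Finite.mem_toFinset, Set.mem_ofPred_eq] at hi hj ⊢
    obtain ⟨i, rfl, rfl⟩ := hi
    obtain ⟨j, rfl, rfl⟩ := hj
    exact ⟨i + j, substExponent_add _ _ _, Finsupp.embDomain_add _ _ _⟩
  split m i j h := by
    simp only [Finset.mem_image, Set.Finite.mem_toFinset, Set.mem_ofPred_eq] at h ⊢
    obtain ⟨n, rfl, h⟩ := h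
    obtain ⟨i', rfl⟩ := exists_embDomain_eq_of_le e (h ▸ self_le_add_right i j)
    obtain ⟨j', rfl⟩ := exists_embDomain_eq_of_le e (h ▸ self_le_add_left j (i'.embDomain e))
    rw [← Finsupp.embDomain_add] at h
    rw [Finsupp.embDomain_injective e h]
    exact ⟨_, _, (substExponent_add _ _ _).symm, ⟨_, rfl, rfl⟩, ⟨_, rfl, rfl⟩⟩

theorem coeff_finiteSubst_hom (hw : ∀ k, w k ≠ 0) {A : Type*} [Ring A] (f : MvPowerSeries σ A)
    (m : τ →₀ ℕ) :
    MvPowerSeries.coeff m ((finiteSubst e w hw).hom A f) =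
      ∑ n ∈ (finite_setOf_substExponent_eq w hw m).toFinset,
        MvPowerSeries.coeff (n.embDomain e) f := by
  classical
  rw [MonomialSubst.coeff_hom]
  exact Finset.sum_image fun _ _ _ _ h => Finsupp.embDomain_injective e h

end Substitution

end

end LimGroth

/-! ### Integrality of Θ-products carrying arbitrary elements of `R` -/

namespace LimGroth

open Finset.HasAntidiagonal (antidiagonal mem_antidiagonal)

noncomputable section

set_option linter.unusedSectionVars false

/-! ### Polynomial functions on the integers -/

section PolyFun

variable {A B : Type*} [Ring A] [Algebra ℚ A] [Ring B] [Algebra ℚ B]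

/-- The polynomial functions `ℤ → A`. -/
def polyFun (A : Type*) [Ring A] : Subring (ℤ → A) :=
  (RingHom.pi fun c : ℤ => Polynomial.eval₂RingHom' (RingHom.id A) (c : A)
    fun a => (Int.cast_commute c a).symm).range

theorem mem_polyFun {f : ℤ → A} :
    f ∈ polyFun A ↔ ∃ (n : ℕ) (a : ℕ → A), ∀ c : ℤ, f c = ∑ i ∈ Finset.range n, (c ^ i) • a i := by
  constructor
  · rintro ⟨p, rfl⟩
    refine ⟨p.natDegree + 1, p.coeff, fun c => ?_⟩
    change Polynomial.eval₂ (RingHom.id A) (c : A) p = _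
    rw [Polynomial.eval₂_eq_sum_range]
    refine Finset.sum_congr rfl fun i _ => ?_
    rw [RingHom.id_apply, zsmul_eq_mul, Int.cast_pow]
    exact ((Int.cast_commute c (p.coeff i)).pow_left i).eq.symm
  · rintro ⟨n, a, h⟩
    refine ⟨∑ i ∈ Finset.range n, Polynomial.monomial i (a i), funext fun c => ?_⟩
    change Polynomial.eval₂ (RingHom.id A) (c : A) _ = _
    rw [h, Polynomial.eval₂_finsetSum]
    refine Finset.sum_congr rfl fun i _ => ?_
    rw [Polynomial.eval₂_monomial, RingHom.id_apply, zsmul_eq_mul, Int.cast_pow]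
    exact ((Int.cast_commute c (a i)).pow_left i).eq.symm

theorem const_mem_polyFun (a : A) : (fun _ => a) ∈ polyFun A :=
  mem_polyFun.2 ⟨1, fun _ => a, fun c => by simp⟩

theorem linear_mem_polyFun (a : A) : (fun c : ℤ => c • a) ∈ polyFun A :=
  mem_polyFun.2 ⟨2, fun i => if i = 1 then a else 0, fun c => by simp⟩

theorem qsmul_mem_polyFun (q : ℚ) {f : ℤ → A} (hf : f ∈ polyFun A) :
    (fun c => q • f c) ∈ polyFun A := by
  obtain ⟨n, a, h⟩ := mem_polyFun.1 hf
  refine mem_polyFun.2 ⟨n, fun i => q • a i, fun c => ?_⟩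
  rw [h, Finset.smul_sum]
  exact Finset.sum_congr rfl fun i _ => smul_comm _ _ _

theorem map_mem_polyFun (T : A →ₗ[ℚ] B) {f : ℤ → A} (hf : f ∈ polyFun A) :
    (fun c => T (f c)) ∈ polyFun B := by
  obtain ⟨n, a, h⟩ := mem_polyFun.1 hf
  refine mem_polyFun.2 ⟨n, fun i => T (a i), fun c => ?_⟩
  rw [h, map_sum]
  exact Finset.sum_congr rfl fun i _ => map_zsmul _ _ _

/-- A polynomial function takes values in a submodule if it does so on the natural numbers. -/
theorem polyFun_neg_one_mem {f : ℤ → A} (hf : f ∈ polyFun A) (S : Submodule ℤ A)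
    (hS : ∀ n : ℕ, f n ∈ S) : f (-1) ∈ S := by
  obtain ⟨n, a, h⟩ := mem_polyFun.1 hf
  -- The `n`-th finite difference at `-1` annihilates polynomials of degree less than `n`. Its term
  -- `k = 0` is `± f (-1)`, and all other terms are integer multiples of values at natural numbers.
  have h1 : ∑ k ∈ Finset.range (n + 1), ((-1 : ℤ) ^ (n - k) * n.choose k) • f (-1 + k) = 0 := by
    simp only [h, Finset.smul_sum]
    rw [Finset.sum_comm]
    refine Finset.sum_eq_zero fun i hi => ?_
    simp only [smul_smul]
    rw [← Finset.sum_smul]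
    have h2 := congrFun (fwdDiff_iter_pow_eq_zero_of_lt (R := ℤ) (Finset.mem_range.1 hi)) (-1)
    rw [fwdDiff_iter_eq_sum_shift] at h2
    simp only [smul_eq_mul, nsmul_eq_mul, mul_one, Pi.zero_apply] at h2
    rw [h2, zero_smul]
  rw [Finset.sum_range_succ', add_eq_zero_iff_neg_eq] at h1
  have h3 : ((-1 : ℤ) ^ n) • f (-1) ∈ S := by
    have : ((-1 : ℤ) ^ (n - 0) * n.choose 0) • f (-1 + ((0 : ℕ) : ℤ)) = ((-1 : ℤ) ^ n) • f (-1) := by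
      simp
    rw [← this, ← h1]
    refine neg_mem (sum_mem fun k _ => S.smul_mem _ ?_)
    have : (-1 : ℤ) + ((k + 1 : ℕ) : ℤ) = (k : ℕ) := by push_cast; ring
    rw [this]
    exact hS k
  have h4 := S.smul_mem ((-1 : ℤ) ^ n) h3
  rwa [smul_smul, ← mul_pow, neg_one_mul, neg_neg, one_pow, one_smul] at h4

variable {σ : Type*}

/-- The coefficients of a family of power series are polynomial functions. -/
def PolySeries (f : ℤ → MvPowerSeries σ A) : Prop :=
  ∀ m, (fun c => MvPowerSeries.coeff m (f c)) ∈ polyFun A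

namespace PolySeries

variable {f g : ℤ → MvPowerSeries σ A}

theorem const (f : MvPowerSeries σ A) : PolySeries fun _ : ℤ => f := fun _ => const_mem_polyFun _

theorem sum {κ : Type*} {s : Finset κ} {F : κ → ℤ → MvPowerSeries σ A}
    (hF : ∀ k ∈ s, PolySeries (F k)) : PolySeries fun c => ∑ k ∈ s, F k c := fun m => by
  have : (fun c => MvPowerSeries.coeff m (∑ k ∈ s, F k c)) =
      ∑ k ∈ s, fun c => MvPowerSeries.coeff m (F k c) := by
    funext c
    rw [map_sum, Finset.sum_apply]
  rw [this]
  exact sum_mem fun k hk => hF k hk m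

theorem mul (hf : PolySeries f) (hg : PolySeries g) : PolySeries fun c => f c * g c := by
  classical
  intro m
  have : (fun c => MvPowerSeries.coeff m (f c * g c)) = ∑ p ∈ antidiagonal m,
      (fun c => MvPowerSeries.coeff p.1 (f c)) * fun c => MvPowerSeries.coeff p.2 (g c) := by
    funext c
    rw [MvPowerSeries.coeff_mul, Finset.sum_apply]
    rfl
  rw [this]
  exact sum_mem fun p _ => mul_mem (hf _) (hg _)

theorem pow (hf : PolySeries f) (k : ℕ) : PolySeries fun c => f c ^ k := by
  induction k with
  | zero => simpa only [pow_zero] using const 1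
  | succ k ih => simpa only [pow_succ] using ih.mul hf

theorem evalSeries (hf : PolySeries f) (q : ℕ → ℚ) :
    PolySeries fun c => LimGroth.evalSeries q (f c) := by
  intro m
  have : (fun c => MvPowerSeries.coeff m (LimGroth.evalSeries q (f c))) =
      ∑ k ∈ Finset.range (m.degree + 1), fun c => q k • MvPowerSeries.coeff m (f c ^ k) := by
    funext c
    rw [Finset.sum_apply]
    rfl
  rw [this]
  exact sum_mem fun k _ => qsmul_mem_polyFun _ (hf.pow k m)

theorem mapCoeff (T : A →ₗ[ℚ] B) (hf : PolySeries f) :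
    PolySeries fun c => LimGroth.mapCoeff T (f c) := fun m => map_mem_polyFun T (hf m)

theorem prodSeries {F : ℕ+ → ℤ → MvPowerSeries σ A} (hF : ∀ l, PolySeries (F l)) :
    PolySeries fun c => LimGroth.prodSeries fun l => F l c := by
  intro m
  have : ∀ N, PolySeries fun c => partialProd (fun l => F l c) N := by
    intro N
    induction N with
    | zero => exact const 1
    | succ N ih => simpa only [partialProd_succ] using ih.mul (hF _)
  exact this m.degree m

/-- Each coefficient of the product is a finite expression in coefficients of the `y l`, formed by
sums, products, rational multiples and the maps `T l`. -/
theorem thetaProd {R : Type*} [Ring R] {y : ℕ+ → ℤ → MvPowerSeries σ (RatR R)}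
    (hy : ∀ l, PolySeries (y l)) : PolySeries fun c => LimGroth.thetaProd fun l => y l c := by
  refine prodSeries fun l => ?_
  simp only [Theta_eq, logSeries_eq_evalSeries, expSeries_eq_evalSeries]
  exact (((hy l).evalSeries _).mapCoeff _).evalSeries _

end PolySeries

end PolyFun

/-! ### Sums of powers of monomials -/

section MonoSum

variable {R : Type*} [Ring R] {κ σ τ : Type*} [Fintype κ]

/-- The image of `R` in `ℚ ⊗ R`, as an additive map. -/
def RatR.ofHom (R : Type*) [Ring R] : R →+ RatR R :=
  (TensorProduct.mk ℤ ℚ R 1).toAddMonoidHom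

theorem RatR.ofHom_apply (x : R) : RatR.ofHom R x = RatR.of x := rfl

theorem RatR.of_mul (x y : R) : RatR.of (x * y) = RatR.of x * RatR.of y := by
  change (1 : ℚ) ⊗ₜ[ℤ] (x * y) = ((1 : ℚ) ⊗ₜ[ℤ] x) * ((1 : ℚ) ⊗ₜ[ℤ] y)
  rw [Algebra.TensorProduct.tmul_mul_tmul, one_mul]

/-- `∑ k, w_k ^ l V_k` for monomials `w_k`. -/
def monoSum (w : κ → τ →₀ ℕ) (V : κ → RatR R) (l : ℕ+) : MvPowerSeries τ (RatR R) :=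
  ∑ k, MvPowerSeries.monomial ((l : ℕ) • w k) (V k)

theorem monomial_mem_tail {m : τ →₀ ℕ} (hm : m ≠ 0) (l : ℕ+) (a : RatR R) :
    MvPowerSeries.monomial ((l : ℕ) • m) a ∈ tail τ (RatR R) l := by
  classical
  intro n hn
  rw [MvPowerSeries.coeff_monomial, if_neg]
  rintro rfl
  rw [map_nsmul, smul_eq_mul] at hn
  exact absurd hn (not_lt.2 (Nat.le_mul_of_pos_right _ (Nat.pos_of_ne_zero fun h => hm (by
    rwa [Finsupp.degree_eq_zero_iff] at h))))

theorem monoSum_admissible {w : κ → τ →₀ ℕ} (hw : ∀ k, w k ≠ 0) (V : κ → RatR R) :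
    Admissible (monoSum w V) := fun l => sum_mem fun k _ => monomial_mem_tail (hw k) l _

variable {ι : Type*} (b : Module.Basis ι ℤ R)

theorem coeff_psum (l : ℕ+) (U : ι) (m : ι × ℕ →₀ ℕ) :
    MvPowerSeries.coeff m (psum l U) =
      open scoped Classical in if ∃ i : ℕ, m = Finsupp.single (U, i) (l : ℕ) then 1 else 0 := rfl

theorem coeff_psumBasis_single (l : ℕ+) (x : ι × ℕ) :
    MvPowerSeries.coeff (Finsupp.single x (l : ℕ)) (psumBasis b l) = RatR.of (b x.1) := by
  change ∑ᶠ U : ι, MvPowerSeries.coeff _ (psum l U) • RatR.of (b U) = _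
  rw [finsum_eq_single _ x.1]
  · rw [coeff_psum, if_pos ⟨x.2, rfl⟩, one_smul]
  · intro U hU
    rw [coeff_psum, if_neg, zero_smul]
    rintro ⟨i, hi⟩
    have := (Finsupp.single_eq_single_iff _ _ _ _).1 hi
    rcases this with ⟨h, _⟩ | ⟨h, _⟩
    · exact hU (by rw [h])
    · exact l.ne_zero h

theorem coeff_psumBasis_of_ne (l : ℕ+) (m : ι × ℕ →₀ ℕ)
    (hm : ∀ x, m ≠ Finsupp.single x (l : ℕ)) :
    MvPowerSeries.coeff m (psumBasis b l) = 0 := by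
  change ∑ᶠ U : ι, MvPowerSeries.coeff _ (psum l U) • RatR.of (b U) = _
  refine finsum_eq_zero_of_forall_eq_zero fun U => ?_
  rw [coeff_psum, if_neg, zero_smul]
  rintro ⟨i, hi⟩
  exact hm _ hi

theorem psumBasis_admissible : Admissible (psumBasis b) := by
  intro l m hm
  refine coeff_psumBasis_of_ne b l m ?_
  rintro x rfl
  rw [Finsupp.degree_single] at hm
  exact lt_irrefl _ hm

/-- A variable `x_{U, i}` enters `∑_U p_l^{(U)} U` only as `x_{U, i} ^ l U`, so substituting `w k`
for it yields `w_k ^ l U`, while variables outside the range of `e` are killed. -/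
theorem finiteSubst_psumBasis (e : κ ↪ ι × ℕ) (w : κ → τ →₀ ℕ) (hw : ∀ k, w k ≠ 0) (l : ℕ+) :
    (finiteSubst e w hw).hom (RatR R) (psumBasis b l) =
      monoSum w (fun k => RatR.of (b (e k).1)) l := by
  classical
  ext m
  have hc : ∀ n : κ →₀ ℕ, MvPowerSeries.coeff (n.embDomain e) (psumBasis b l) =
      ∑ k, if n = Finsupp.single k (l : ℕ) then RatR.of (b (e k).1) else 0 := by
    intro n
    by_cases hn : ∃ k, n = Finsupp.single k (l : ℕ)
    · obtain ⟨k, rfl⟩ := hn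
      rw [Finsupp.embDomain_single, coeff_psumBasis_single, Finset.sum_eq_single k]
      · rw [if_pos rfl]
      · intro k' _ hk'
        rw [if_neg]
        rw [Finsupp.single_eq_single_iff]
        rintro (⟨h, _⟩ | ⟨h, _⟩)
        · exact hk' h.symm
        · exact l.ne_zero h
      · simp
    · rw [Finset.sum_eq_zero fun k _ => if_neg fun h => hn ⟨k, h⟩]
      refine coeff_psumBasis_of_ne b l _ fun x hx => hn ?_
      have hx' : x ∈ Set.range e := by
        by_contra hx'
        have h := DFunLike.congr_fun hx x
        rw [Finsupp.embDomain_of_notMem_range _ _ _ hx', Finsupp.single_eq_same] at h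
        exact l.ne_zero h.symm
      obtain ⟨k, rfl⟩ := hx'
      rw [← Finsupp.embDomain_single] at hx
      exact ⟨k, Finsupp.embDomain_injective e hx⟩
  rw [coeff_finiteSubst_hom, monoSum, map_sum]
  simp only [hc]
  rw [Finset.sum_comm]
  refine Finset.sum_congr rfl fun k _ => ?_
  rw [Finset.sum_ite_eq', MvPowerSeries.coeff_monomial]
  refine if_congr ?_ rfl rfl
  rw [Set.Finite.mem_toFinset, Set.mem_ofPred_eq, substExponent_single, eq_comm]

/-- The `ℤ`-span of the coefficients of `∏_{l ≥ 1} Θ_l(1 + ∑_U p_l^{(U)} U)`. -/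
def coeffSpan : Submodule ℤ (GQ R) :=
  Submodule.span ℤ (Set.range fun m => MvPowerSeries.coeff m (thetaProd (psumBasis b)))

theorem coeff_thetaProd_basis_mem (w : κ → τ →₀ ℕ) (hw : ∀ k, w k ≠ 0) (u : κ → ι) (m : τ →₀ ℕ) :
    MvPowerSeries.coeff m (thetaProd (monoSum w fun k => RatR.of (b (u k)))) ∈ coeffSpan b := by
  -- The second component keeps apart those indices `k` that carry the same basis element.
  let e : κ ↪ ι × ℕ := ⟨fun k => (u k, Fintype.equivFin κ k), fun k k' h => by
    simpa [Fin.val_inj] using congrArg Prod.snd h⟩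
  have h := (finiteSubst e w hw).hom_thetaProd (psumBasis_admissible b)
  simp only [finiteSubst_psumBasis b e w hw] at h
  change _ = thetaProd (monoSum w fun k => RatR.of (b (u k))) at h
  rw [← h, coeff_finiteSubst_hom]
  exact sum_mem fun n _ => Submodule.subset_span ⟨_, rfl⟩

/-- A nonnegative combination of basis elements attached to one monomial is spread over several
copies of that monomial, each carrying a single basis element. -/
theorem coeff_thetaProd_cone_mem (w : κ → τ →₀ ℕ) (hw : ∀ k, w k ≠ 0) (V : κ → R)
    (hV : ∀ k, V k ∈ AddSubmonoid.closure (Set.range b)) (m : τ →₀ ℕ) :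
    MvPowerSeries.coeff m (thetaProd (monoSum w fun k => RatR.of (V k))) ∈ coeffSpan b := by
  have hL : ∀ k, ∃ L : List ι, (L.map b).sum = V k := by
    intro k
    refine AddSubmonoid.closure_induction ?_ ⟨[], rfl⟩ ?_ (hV k)
    · rintro _ ⟨U, rfl⟩
      exact ⟨[U], by simp⟩
    · rintro _ _ _ _ ⟨L, rfl⟩ ⟨L', rfl⟩
      exact ⟨L ++ L', by simp⟩
  choose L hL using hL
  have h := coeff_thetaProd_basis_mem b (κ := Σ k, Fin (L k).length) (fun x => w x.1)
    (fun x => hw x.1) (fun x => (L x.1)[x.2.1]) m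
  have h2 : monoSum w (fun k => RatR.of (V k)) =
      monoSum (fun x : Σ k, Fin (L k).length => w x.1) fun x => RatR.of (b (L x.1)[x.2.1]) := by
    funext l
    unfold monoSum
    rw [Fintype.sum_sigma]
    refine Finset.sum_congr rfl fun k _ => ?_
    dsimp only
    rw [← map_sum]
    congr 1
    simp only [← RatR.ofHom_apply]
    rw [← map_sum, Fin.sum_univ_fun_getElem, hL]
  rw [h2]
  exact h

/-- The coefficients of `∏_{l ≥ 1} Θ_l(1 + ∑_k w_k ^ l V_k)` for monomials `w_k` and `V_k ∈ R`
lie in the span of the coefficients of the universal such series. -/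
theorem coeff_thetaProd_monoSum_mem (w : κ → τ →₀ ℕ) (hw : ∀ k, w k ≠ 0) (V : κ → R)
    (m : τ →₀ ℕ) :
    MvPowerSeries.coeff m (thetaProd (monoSum w fun k => RatR.of (V k))) ∈ coeffSpan b := by
  have hPN : ∀ x : R, ∃ P ∈ AddSubmonoid.closure (Set.range b),
      ∃ N ∈ AddSubmonoid.closure (Set.range b), x = P - N := by
    intro x
    have hx : x ∈ Submodule.span ℤ (Set.range b) := by rw [b.span_eq]; trivial
    induction hx using Submodule.span_induction with
    | mem x hx => exact ⟨x, AddSubmonoid.subset_closure hx, 0, zero_mem _, (sub_zero x).symm⟩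
    | zero => exact ⟨0, zero_mem _, 0, zero_mem _, (sub_zero 0).symm⟩
    | add x y _ _ hx hy =>
      obtain ⟨P, hP, N, hN, rfl⟩ := hx
      obtain ⟨P', hP', N', hN', rfl⟩ := hy
      exact ⟨P + P', add_mem hP hP', N + N', add_mem hN hN', by abel⟩
    | smul c x _ hx =>
      obtain ⟨P, hP, N, hN, rfl⟩ := hx
      obtain ⟨n, rfl | rfl⟩ := c.eq_nat_or_neg
      · exact ⟨n • P, nsmul_mem hP n, n • N, nsmul_mem hN n, by
          rw [natCast_zsmul, nsmul_sub]⟩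
      · exact ⟨n • N, nsmul_mem hN n, n • P, nsmul_mem hP n, by
          rw [neg_smul, natCast_zsmul, nsmul_sub, neg_sub]⟩
  choose P hP N hN hPN using hPN
  -- With `V = P - N`, the element `P + c N` lies in the cone for every natural `c` and equals `V`
  -- at `c = -1`. The coefficients are polynomial in `c`, so `polyFun_neg_one_mem` passes from the
  -- former to the latter.
  let y : ℕ+ → ℤ → MvPowerSeries τ (RatR R) := fun l c =>
    monoSum w (fun k => RatR.of (P (V k) + c • N (V k))) l
  have hy : ∀ l, PolySeries (y l) := by
    classical
    intro l
    refine PolySeries.sum (F := fun k c => MvPowerSeries.monomial ((l : ℕ) • w k)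
      (RatR.of (P (V k) + c • N (V k)))) fun k _ n => ?_
    simp only [MvPowerSeries.coeff_monomial]
    split_ifs with h
    · simp only [← RatR.ofHom_apply, map_add, map_zsmul]
      exact add_mem (const_mem_polyFun (A := RatR R) _) (linear_mem_polyFun (A := RatR R) _)
    · exact const_mem_polyFun (0 : RatR R)
  have h : ∀ n : ℕ, MvPowerSeries.coeff m (thetaProd fun l => y l n) ∈ coeffSpan b := fun n => by
    refine coeff_thetaProd_cone_mem b w hw (fun k => P (V k) + (n : ℤ) • N (V k)) (fun k => ?_) m
    rw [natCast_zsmul]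
    exact add_mem (hP _) (nsmul_mem (hN _) n)
  have hz : (fun l => y l (-1)) = monoSum w fun k => RatR.of (V k) := by
    funext l
    simp only [y, neg_smul, one_smul, ← sub_eq_add_neg, ← hPN]
  rw [← hz]
  exact polyFun_neg_one_mem (PolySeries.thetaProd hy m) (coeffSpan b) h

end MonoSum

end

end LimGroth

/-! ### The ring `𝒢_∞^ℤ(R)` and the series `E_U(t)` -/

namespace LimGroth

open Finset.HasAntidiagonal (antidiagonal mem_antidiagonal)

noncomputable section

set_option linter.unusedSectionVars false

/-! ### The ring spanned by the coefficients -/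

section CoeffSpan

variable {R : Type*} [Ring R] {κ σ τ : Type*} {ι : Type*} (b : Module.Basis ι ℤ R)

theorem one_mem_coeffSpan : (1 : GQ R) ∈ coeffSpan b :=
  Submodule.subset_span ⟨0, (coeff_prodSeries (N := 0)
    (fun l => Theta_sub_one_mem_tail l (psumBasis_admissible b l)) (by simp)).trans
    MvPowerSeries.coeff_zero_one⟩

theorem substExponent_single_apply [DecidableEq τ] (f : κ ↪ τ) (n : κ →₀ ℕ) (k : κ) :
    substExponent (fun k => Finsupp.single (f k) 1) n (f k) = n k := by
  have : substExponent (fun k => Finsupp.single (f k) 1) n = n.mapDomain f := by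
    simp [substExponent, Finsupp.mapDomain]
  rw [this, Finsupp.mapDomain_apply f.injective]

theorem substExponent_single_apply_of_ne (f : κ → τ) (n : κ →₀ ℕ) (t : τ) (ht : ∀ k, f k ≠ t) :
    substExponent (fun k => Finsupp.single (f k) 1) n t = 0 := by
  unfold substExponent
  rw [Finsupp.sum_apply]
  exact Finset.sum_eq_zero fun k _ => by simp [ht k]

/-- The universal series is written in two disjoint finite alphabets. The product is the Θ-product
in which `x_i`, `x'_j` and `x_i x'_j` carry `U`, `V` and `U V`, and its coefficient at a product of
two monomials is the product of the two given coefficients. Since `U V` need not be a basis element,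
the full strength of `coeff_thetaProd_monoSum_mem` is used. -/
theorem coeff_mul_coeff_mem (m n : ι × ℕ →₀ ℕ) :
    MvPowerSeries.coeff m (thetaProd (psumBasis b)) *
      MvPowerSeries.coeff n (thetaProd (psumBasis b)) ∈ coeffSpan b := by
  classical
  obtain ⟨S, hSm, hSn⟩ : ∃ S : Finset (ι × ℕ), m.support ⊆ S ∧ n.support ⊆ S :=
    ⟨_, Finset.subset_union_left, Finset.subset_union_right⟩
  let e : S ↪ ι × ℕ := Function.Embedding.subtype _
  have hS : ∀ i : ι × ℕ →₀ ℕ, i.support ⊆ S → ∃ i' : S →₀ ℕ, i'.embDomain e = i := by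
    intro i hi
    refine ⟨i.comapDomain e e.injective.injOn, ?_⟩
    rw [Finsupp.embDomain_eq_mapDomain]
    exact Finsupp.mapDomain_comapDomain _ e.injective _ fun x hx => ⟨⟨x, hi hx⟩, rfl⟩
  obtain ⟨m, rfl⟩ := hS m hSm
  obtain ⟨n, rfl⟩ := hS n hSn
  let w₁ : S → S ⊕ S →₀ ℕ := fun k => Finsupp.single (.inl k) 1
  let w₂ : S → S ⊕ S →₀ ℕ := fun k => Finsupp.single (.inr k) 1
  have hw₁ : ∀ k, w₁ k ≠ 0 := fun k => single_one_ne_zero _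
  have hw₂ : ∀ k, w₂ k ≠ 0 := fun k => single_one_ne_zero _
  let F := thetaProd (psumBasis b)
  have h₁ := (finiteSubst e w₁ hw₁).hom_thetaProd (psumBasis_admissible b)
  have h₂ := (finiteSubst e w₂ hw₂).hom_thetaProd (psumBasis_admissible b)
  simp only [finiteSubst_psumBasis] at h₁ h₂
  change _ = thetaProd (monoSum w₁ fun k => RatR.of (b (e k).1)) at h₁
  change _ = thetaProd (monoSum w₂ fun k => RatR.of (b (e k).1)) at h₂
  have hprod : MvPowerSeries.coeff (substExponent w₁ m + substExponent w₂ n)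
      (thetaProd (monoSum w₁ fun k => RatR.of (b (e k).1)) *
        thetaProd (monoSum w₂ fun k => RatR.of (b (e k).1))) ∈ coeffSpan b := by
    rw [thetaProd_mul (monoSum_admissible hw₁ _) (monoSum_admissible hw₂ _)]
    have := coeff_thetaProd_monoSum_mem b
      (Sum.elim (Sum.elim w₁ w₂) fun p : S × S => w₁ p.1 + w₂ p.2)
      (by
        rintro ((k | k) | ⟨k, k'⟩)
        · exact hw₁ k
        · exact hw₂ k
        · intro h
          exact hw₁ k (add_eq_zero.1 h).1)
      (Sum.elim (Sum.elim (fun k => b (e k).1) fun k => b (e k).1)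
        fun p : S × S => b (e p.1).1 * b (e p.2).1)
      (substExponent w₁ m + substExponent w₂ n)
    convert this using 3
    funext l
    simp only [monoSum, Fintype.sum_sum_type, Sum.elim_inl, Sum.elim_inr]
    congr 1
    rw [Finset.sum_mul_sum, Fintype.sum_prod_type]
    refine Finset.sum_congr rfl fun k _ => Finset.sum_congr rfl fun k' _ => ?_
    rw [MvPowerSeries.monomial_mul_monomial, RatR.of_mul, smul_add]
  rw [← h₁, ← h₂, MvPowerSeries.coeff_mul] at hprod
  have hll : ∀ n k, substExponent w₁ n (.inl k) = n k :=
    substExponent_single_apply ⟨Sum.inl, Sum.inl_injective⟩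
  have hrr : ∀ n k, substExponent w₂ n (.inr k) = n k :=
    substExponent_single_apply ⟨Sum.inr, Sum.inr_injective⟩
  have hlr : ∀ n k, substExponent w₁ n (.inr k) = 0 := fun n k =>
    substExponent_single_apply_of_ne _ n _ fun _ => Sum.inl_ne_inr
  have hrl : ∀ n k, substExponent w₂ n (.inl k) = 0 := fun n k =>
    substExponent_single_apply_of_ne _ n _ fun _ => Sum.inr_ne_inl
  have hinj : ∀ m' n' : S →₀ ℕ, substExponent w₁ m' + substExponent w₂ n' =
      substExponent w₁ m + substExponent w₂ n → m' = m ∧ n' = n := by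
    intro m' n' h
    constructor
    · ext k
      simpa [hll, hrl] using DFunLike.congr_fun h (Sum.inl k)
    · ext k
      simpa [hlr, hrr] using DFunLike.congr_fun h (Sum.inr k)
  have hsingle : ∀ (w : S → S ⊕ S →₀ ℕ) (hw : ∀ k, w k ≠ 0) (m : S →₀ ℕ),
      (∀ m', substExponent w m' = substExponent w m → m' = m) →
      MvPowerSeries.coeff (substExponent w m) ((finiteSubst e w hw).hom (GQ R) F) =
        MvPowerSeries.coeff (m.embDomain e) F := by
    intro w hw m hm
    rw [coeff_finiteSubst_hom, Finset.sum_eq_single m]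
    · intro m' hm' hne
      exact absurd (hm m' (by simpa using hm')) hne
    · simp
  -- Exponents in the two halves of `S ⊕ S` determine each other's parts uniquely (`hinj`), so a
  -- single term of the Cauchy product survives.
  rw [Finset.sum_eq_single (substExponent w₁ m, substExponent w₂ n)] at hprod
  · rwa [hsingle w₁ hw₁ m fun m' h => (hinj m' n (by rw [h])).1,
      hsingle w₂ hw₂ n fun n' h => (hinj m n' (by rw [h])).2] at hprod
  · rintro ⟨p, q⟩ hpq hne
    rw [coeff_finiteSubst_hom, coeff_finiteSubst_hom, Finset.sum_mul_sum]
    refine Finset.sum_eq_zero fun i hi => Finset.sum_eq_zero fun j hj => ?_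
    simp only [Set.Finite.mem_toFinset, Set.mem_ofPred_eq] at hi hj
    rw [mem_antidiagonal] at hpq
    subst hi hj
    obtain ⟨rfl, rfl⟩ := hinj i j hpq
    exact absurd rfl hne
  · simp [mem_antidiagonal]

theorem mul_mem_coeffSpan {x y : GQ R} (hx : x ∈ coeffSpan b) (hy : y ∈ coeffSpan b) :
    x * y ∈ coeffSpan b := by
  induction hx using Submodule.span_induction with
  | mem x hx =>
    obtain ⟨m, rfl⟩ := hx
    induction hy using Submodule.span_induction with
    | mem y hy =>
      obtain ⟨n, rfl⟩ := hy
      exact coeff_mul_coeff_mem b m n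
    | zero => rw [mul_zero]; exact zero_mem _
    | add y z _ _ hy hz => rw [mul_add]; exact add_mem hy hz
    | smul c y _ hy => rw [mul_smul_comm]; exact Submodule.smul_mem _ c hy
  | zero => rw [zero_mul]; exact zero_mem _
  | add x z _ _ hx hz => rw [add_mul]; exact add_mem hx hz
  | smul c x _ hx => rw [smul_mul_assoc]; exact Submodule.smul_mem _ c hx

/-- `𝒢_∞^ℤ(R)` -/
def GZ : Subalgebra ℤ (GQ R) :=
  (coeffSpan b).toSubalgebra (one_mem_coeffSpan b) fun _ _ => mul_mem_coeffSpan b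

end CoeffSpan

/-! ### The series `E_U(t)` -/

section ESeries

variable {R : Type*} [Ring R]

/-- Multiplication of all variables by `-1`. -/
def negVars (σ A : Type*) [Ring A] : MvPowerSeries σ A →+* MvPowerSeries σ A where
  toFun f := fun m => (-1 : ℤ) ^ m.degree • MvPowerSeries.coeff m f
  map_zero' := by funext m; simp; rfl
  map_add' f g := by funext m; simp; rfl
  map_one' := by
    classical
    funext m
    change _ = MvPowerSeries.coeff m (1 : MvPowerSeries σ A)
    rw [MvPowerSeries.coeff_one]
    split_ifs with h <;> simp [h]
  map_mul' f g := by
    classical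
    funext m
    refine Eq.trans ?_ (MvPowerSeries.coeff_mul
      (φ := fun m => (-1 : ℤ) ^ m.degree • MvPowerSeries.coeff m f)
      (ψ := fun m => (-1 : ℤ) ^ m.degree • MvPowerSeries.coeff m g) ..).symm
    rw [MvPowerSeries.coeff_mul, Finset.smul_sum]
    refine Finset.sum_congr rfl fun p hp => ?_
    change _ = ((-1 : ℤ) ^ p.1.degree • MvPowerSeries.coeff p.1 f) *
      ((-1 : ℤ) ^ p.2.degree • MvPowerSeries.coeff p.2 g)
    rw [smul_mul_smul_comm, ← pow_add, ← map_add, mem_antidiagonal.1 hp]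

theorem coeff_negVars {σ A : Type*} [Ring A] (m : σ →₀ ℕ) (f : MvPowerSeries σ A) :
    MvPowerSeries.coeff m (negVars σ A f) = (-1 : ℤ) ^ m.degree • MvPowerSeries.coeff m f := rfl

theorem negVars_tailPreserving (σ A : Type*) [Ring A] [Algebra ℚ A] :
    TailPreserving (negVars σ A : MvPowerSeries σ A →+ MvPowerSeries σ A) := by
  intro N f hf m hm
  change (-1 : ℤ) ^ m.degree • MvPowerSeries.coeff m f = 0
  rw [hf m hm, smul_zero]

/-- The series `-(-t)^l U`. -/
def eTerm (U : R) (l : ℕ+) : PowerSeries (RatR R) :=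
  -((-PowerSeries.X) ^ (l : ℕ) * PowerSeries.C (RatR.of U))

theorem E_eq_thetaProd (U : R) : E U = thetaProd (σ := Unit) (eTerm U) := by
  unfold E thetaProd eTerm
  simp only [sub_eq_add_neg]

theorem eTerm_eq_negVars (U : R) (l : ℕ+) :
    eTerm U l = negVars Unit (RatR R) (monoSum (fun _ : Unit => Finsupp.single () 1)
      (fun _ => RatR.of (-U)) l) := by
  classical
  have h : monoSum (fun _ : Unit => Finsupp.single () 1) (fun _ => RatR.of (-U)) l =
      -((PowerSeries.X : PowerSeries (RatR R)) ^ (l : ℕ) * PowerSeries.C (RatR.of U)) := by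
    rw [← RatR.ofHom_apply, map_neg, RatR.ofHom_apply]
    unfold monoSum
    rw [Fintype.sum_unique, map_neg]
    congr 1
    refine Eq.trans ?_ (congrArg (· * _) (MvPowerSeries.X_pow_eq () (l : ℕ)).symm)
    refine Eq.trans ?_ (MvPowerSeries.monomial_mul_monomial _ _ _ _).symm
    simp
  have hX : negVars Unit (RatR R) (PowerSeries.X : PowerSeries (RatR R)) =
      (-PowerSeries.X : PowerSeries (RatR R)) := by
    refine MvPowerSeries.ext fun m => ?_
    rw [coeff_negVars]
    change _ = MvPowerSeries.coeff m (-MvPowerSeries.X ())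
    rw [map_neg]
    change (-1 : ℤ) ^ m.degree • MvPowerSeries.coeff m (MvPowerSeries.X ()) = _
    rw [MvPowerSeries.coeff_X]
    split_ifs with hm
    · simp [hm, Finsupp.degree_single]
    · simp
  have hC : negVars Unit (RatR R) (PowerSeries.C (RatR.of U)) = PowerSeries.C (RatR.of U) := by
    refine MvPowerSeries.ext fun m => ?_
    rw [coeff_negVars]
    change (-1 : ℤ) ^ m.degree • MvPowerSeries.coeff m (MvPowerSeries.C (RatR.of U)) =
      MvPowerSeries.coeff m (MvPowerSeries.C (RatR.of U))
    rw [MvPowerSeries.coeff_C]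
    split_ifs with hm <;> simp [hm]
  rw [h]
  refine Eq.symm ((map_neg (negVars Unit (RatR R)) _).trans (congrArg Neg.neg ?_))
  refine (map_mul (negVars Unit (RatR R)) _ _).trans ?_
  rw [hC]
  exact congrArg (· * PowerSeries.C (RatR.of U))
    ((map_pow (negVars Unit (RatR R)) _ _).trans (by rw [hX]))

theorem eTerm_admissible (U : R) : Admissible (σ := Unit) (eTerm U) := by
  intro l
  rw [eTerm_eq_negVars]
  exact negVars_tailPreserving _ _ _ _
    (monoSum_admissible (fun _ => single_one_ne_zero _) _ l)

/-- The change `t ↦ -t` turns `E_U(t)` into the Θ-product with one monomial `t` carrying `-U`, so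
`coeff_thetaProd_monoSum_mem` applies up to sign. Negative elements of `R` thus occur even when `U`
is a basis element. -/
theorem E_eq_negVars (U : R) :
    E U = negVars Unit (GQ R) (thetaProd (monoSum (fun _ : Unit => Finsupp.single () 1)
      fun _ => RatR.of (-U))) := by
  rw [E_eq_thetaProd, map_thetaProd (negVars _ (RatR R)) (negVars _ (GQ R))
    (negVars_tailPreserving _ _) (negVars_tailPreserving _ _) ?_
    (monoSum_admissible (fun _ => single_one_ne_zero _) _)]
  · congr 1
    funext l
    exact eTerm_eq_negVars U l
  · intro l f
    refine MvPowerSeries.ext fun m => ?_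
    rw [coeff_negVars, coeff_mapCoeff, coeff_mapCoeff, coeff_negVars, map_zsmul]

theorem coeff_E_mem_GZ {ι : Type*} (b : Module.Basis ι ℤ R) (U : R) (r : ℕ) :
    PowerSeries.coeff r (E U) ∈ GZ b := by
  rw [E_eq_negVars]
  change (-1 : ℤ) ^ _ • _ ∈ GZ b
  exact Subalgebra.smul_mem _ (coeff_thetaProd_monoSum_mem b _
    (fun _ => single_one_ne_zero _) (fun _ => -U) _) _

/-! ### The coefficients of the `E_U(t)` generate `𝒢_∞^ℚ(R)` -/

section SeriesIn

variable {σ : Type*} {A : Type*} [Ring A] [Algebra ℚ A] (S : Subalgebra ℚ A)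

theorem coeff_mul_mem {f g : MvPowerSeries σ A} (hf : ∀ m, MvPowerSeries.coeff m f ∈ S)
    (hg : ∀ m, MvPowerSeries.coeff m g ∈ S) (m : σ →₀ ℕ) : MvPowerSeries.coeff m (f * g) ∈ S := by
  classical
  rw [MvPowerSeries.coeff_mul]
  exact sum_mem fun p _ => mul_mem (hf _) (hg _)

theorem coeff_one_mem (m : σ →₀ ℕ) : MvPowerSeries.coeff m (1 : MvPowerSeries σ A) ∈ S := by
  classical
  rw [MvPowerSeries.coeff_one]
  split_ifs
  exacts [one_mem _, zero_mem _]

theorem coeff_pow_mem {f : MvPowerSeries σ A} (hf : ∀ m, MvPowerSeries.coeff m f ∈ S) (k : ℕ)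
    (m : σ →₀ ℕ) : MvPowerSeries.coeff m (f ^ k) ∈ S := by
  induction k generalizing m with
  | zero => rw [pow_zero]; exact coeff_one_mem S m
  | succ k ih => rw [pow_succ]; exact coeff_mul_mem S ih hf m

theorem coeff_evalSeries_mem (c : ℕ → ℚ) {f : MvPowerSeries σ A}
    (hf : ∀ m, MvPowerSeries.coeff m f ∈ S) (m : σ →₀ ℕ) :
    MvPowerSeries.coeff m (evalSeries c f) ∈ S := by
  change ∑ k ∈ Finset.range (m.degree + 1), c k • MvPowerSeries.coeff m (f ^ k) ∈ S
  exact sum_mem fun k _ => S.smul_mem (coeff_pow_mem S hf k m) _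

/-- The square and higher powers of `y` start in degree at least `2 (N + 1) ≥ N + 2`. -/
theorem evalSeries_congr_linear (c : ℕ → ℚ) {y : MvPowerSeries σ A} {N : ℕ}
    (hy : y ∈ tail σ A (N + 1)) :
    CongrBelow (N + 2) (evalSeries c y) (c 0 • 1 + c 1 • y) := by
  have hy1 : y ∈ tail σ A 1 := tail_anti (by omega) hy
  refine (evalSeries_congr c hy1 le_rfl).trans ?_
  rw [Finset.sum_range_succ', Finset.sum_range_succ', add_assoc, pow_zero, zero_add, pow_one,
    add_comm (c 1 • y)]
  unfold CongrBelow
  rw [add_sub_cancel_right]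
  refine sum_mem fun k _ => Submodule.smul_mem _ _ (tail_anti ?_ (pow_mem_tail hy (k + 1 + 1)))
  nlinarith

end SeriesIn

theorem coeff_eTerm (U : R) (l : ℕ+) :
    MvPowerSeries.coeff (Finsupp.single () (l : ℕ)) (eTerm U l) =
      -((-1 : ℤ) ^ (l : ℕ) • RatR.of U) := by
  classical
  rw [eTerm_eq_negVars, coeff_negVars, Finsupp.degree_single, monoSum, Fintype.sum_unique,
    Finsupp.smul_single, smul_eq_mul, mul_one, MvPowerSeries.coeff_monomial_same,
    ← RatR.ofHom_apply, map_neg, smul_neg, RatR.ofHom_apply]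

theorem coeff_zero_thetaProd {σ : Type*} {y : ℕ+ → MvPowerSeries σ (RatR R)} (N : ℕ) :
    MvPowerSeries.coeff 0 (partialProd (fun l => Theta l (1 + y l)) N) = 1 := by
  induction N with
  | zero => rw [partialProd_zero, MvPowerSeries.coeff_zero_one]
  | succ N ih =>
    classical
    rw [partialProd_succ, MvPowerSeries.coeff_mul, Finset.HasAntidiagonal.antidiagonal_zero,
      Finset.sum_singleton, ih, Theta_eq, coeff_zero_expSeries, one_mul]

/-- The coefficient of `t ^ r` in `E_U(t)` is `T_r(U)` up to sign and an element of the subalgebra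
generated by the images of `T_1, …, T_{r-1}`. -/
theorem coeff_E_eq (U : R) (r : ℕ) :
    PowerSeries.coeff (r + 1) (E U) =
      MvPowerSeries.coeff (Finsupp.single () (r + 1))
        (partialProd (fun l => Theta l (1 + (eTerm U l : MvPowerSeries Unit (RatR R)))) r) +
      T r.succPNat (-((-1 : ℤ) ^ (r + 1) • RatR.of U)) := by
  classical
  set y : ℕ+ → MvPowerSeries Unit (RatR R) := eTerm U
  have hy : Admissible y := eTerm_admissible U
  have h0 : PowerSeries.coeff (r + 1) (E U) = MvPowerSeries.coeff (Finsupp.single () (r + 1))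
      (partialProd (fun l => Theta l (1 + y l)) (r + 1)) := by
    rw [E_eq_thetaProd]
    exact coeff_prodSeries (fun l => Theta_sub_one_mem_tail l (hy l))
      (by rw [Finsupp.degree_single])
  have hyr : y r.succPNat ∈ tail Unit (RatR R) (r + 1) := hy r.succPNat
  have hlog := evalSeries_congr_linear logCoeff hyr
  have hexp := evalSeries_congr_linear (fun k => (k.factorial : ℚ)⁻¹)
    (mapCoeff_T_mem_tail r.succPNat hyr)
  rw [← expSeries_eq_evalSeries, ← Theta_eq] at hexp
  rw [← logSeries_eq_evalSeries] at hlog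
  rw [h0, partialProd_succ]
  have hdeg : (Finsupp.single () (r + 1)).degree < r + 2 := by
    rw [Finsupp.degree_single]; omega
  -- Writing the product as `P + (Θ - 1) + (P - 1)(Θ - 1)`, the last term starts in degree `r + 2`
  -- and `Θ - 1` is linear in `y` through degree `r + 1`.
  have h1 : partialProd (fun l => Theta l (1 + y l)) r * Theta r.succPNat (1 + y r.succPNat) =
      partialProd (fun l => Theta l (1 + y l)) r +
      (Theta r.succPNat (1 + y r.succPNat) - 1) +
      (partialProd (fun l => Theta l (1 + y l)) r - 1) *
        (Theta r.succPNat (1 + y r.succPNat) - 1) := by noncomm_ring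
  have h2 : (partialProd (fun l => Theta l (1 + y l)) r - 1) *
        (Theta r.succPNat (1 + y r.succPNat) - 1) ∈ tail Unit (GQ R) (1 + (r + 1)) := by
    refine mul_mem_tail (mem_tail_one.2 ?_) (Theta_sub_one_mem_tail _ hyr)
    rw [map_sub, coeff_zero_thetaProd, MvPowerSeries.coeff_zero_one, sub_self]
  rw [h1, map_add, map_add, h2 _ (by omega), add_zero]
  congr 1
  rw [map_sub, hexp.coeff hdeg, map_add]
  simp only [Nat.factorial_zero, Nat.factorial_one, Nat.cast_one, inv_one, one_smul]
  rw [add_sub_cancel_left, coeff_mapCoeff, hlog.coeff hdeg]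
  have hc := coeff_eTerm U r.succPNat
  simp only [Nat.succPNat_coe, Nat.succ_eq_add_one] at hc
  have : logCoeff 0 • (1 : MvPowerSeries Unit (RatR R)) + logCoeff 1 • y r.succPNat =
      y r.succPNat := by
    simp [logCoeff]
  rw [this, hc]

theorem span_of : Submodule.span ℚ (Set.range (RatR.of : R → RatR R)) = ⊤ := by
  rw [eq_top_iff]
  rintro x -
  induction x using TensorProduct.induction_on with
  | zero => exact zero_mem _
  | add x y hx hy => exact add_mem hx hy
  | tmul q U =>
    have : q ⊗ₜ[ℤ] U = q • (RatR.of U) := by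
      change _ = q • ((1 : ℚ) ⊗ₜ[ℤ] U)
      rw [TensorProduct.smul_tmul', smul_eq_mul, mul_one]
    rw [this]
    exact Submodule.smul_mem _ _ (Submodule.subset_span ⟨U, rfl⟩)

/-- By the triangular shape in `coeff_E_eq`, strong induction recovers each `T_{r+1}(U)` from the
coefficient of `t ^ (r + 1)` and the earlier `T_i`. -/
theorem eq_top_of_coeff_E_mem (S : Subalgebra ℚ (GQ R))
    (hS : ∀ (U : R) (r : ℕ), PowerSeries.coeff r (E U) ∈ S) : S = ⊤ := by
  have key : ∀ (r : ℕ) (a : RatR R), T r.succPNat a ∈ S := by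
    intro r
    induction r using Nat.strong_induction_on with
    | _ r ih =>
      have hU : ∀ U : R, T r.succPNat (RatR.of U) ∈ S := by
        intro U
        have hP : ∀ N ≤ r, ∀ m, MvPowerSeries.coeff m (partialProd (fun l => Theta l
            (1 + (eTerm U l : MvPowerSeries Unit (RatR R)))) N) ∈ S := by
          intro N
          induction N with
          | zero => exact fun _ m => coeff_one_mem S m
          | succ N ihN =>
            intro hN
            rw [partialProd_succ]
            refine coeff_mul_mem S (ihN (by omega)) ?_
            rw [Theta_eq, expSeries_eq_evalSeries]
            exact coeff_evalSeries_mem S _ fun m => ih N (by omega) _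
        have h := sub_mem (hS U (r + 1)) (hP r le_rfl (Finsupp.single () (r + 1)))
        rw [coeff_E_eq, add_sub_cancel_left, map_neg, map_zsmul] at h
        have h2 := zsmul_mem (neg_mem h) ((-1 : ℤ) ^ (r + 1))
        rwa [neg_neg, smul_smul, ← mul_pow, neg_one_mul, neg_neg, one_pow, one_smul] at h2
      intro a
      have ha : a ∈ Submodule.span ℚ (Set.range (RatR.of : R → RatR R)) := by
        rw [span_of]; trivial
      have hle : Submodule.span ℚ (Set.range (RatR.of : R → RatR R)) ≤
          (Subalgebra.toSubmodule S).comap (T r.succPNat) := by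
        rw [Submodule.span_le]
        rintro _ ⟨U, rfl⟩
        exact hU U
      exact hle ha
  rw [eq_top_iff, ← adjoin_T, Algebra.adjoin_le_iff]
  rintro _ ⟨i, a, rfl⟩
  have := key i.natPred a
  rwa [PNat.succPNat_natPred] at this

theorem span_eq_top_of_coeff_E_mem (S : Subalgebra ℤ (GQ R))
    (hS : ∀ (U : R) (r : ℕ), PowerSeries.coeff r (E U) ∈ S) :
    Submodule.span ℚ (S : Set (GQ R)) = ⊤ := by
  have h := eq_top_of_coeff_E_mem (Algebra.adjoin ℚ (S : Set (GQ R)))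
    fun U r => Algebra.subset_adjoin (hS U r)
  have h2 := Algebra.adjoin_eq_span ℚ (S : Set (GQ R))
  rw [h] at h2
  -- A subring is multiplicatively closed, so its rational span is already the algebra it generates.
  have h3 : (Submonoid.closure (S : Set (GQ R)) : Set (GQ R)) = S :=
    congrArg _ (Submonoid.closure_eq S.toSubsemiring.toSubmonoid)
  rw [h3] at h2
  exact h2.symm.trans Algebra.top_toSubmodule

end ESeries

end

end LimGroth

/-! ### Primitive generators and grouplike series over `ℚ` -/

namespace LimGroth

open Finset.HasAntidiagonal (antidiagonal mem_antidiagonal)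

noncomputable section

set_option linter.unusedSectionVars false

/-! ### The Hopf algebra structure on `𝒢_∞^ℚ(R)` -/

section HopfGQ

variable {R : Type*} [Ring R]

/-- The linear map `a ↦ T_i(a) ⊗ 1 + 1 ⊗ T_i(a)`. -/
def primitiveT (i : ℕ+) : RatR R →ₗ[ℚ] GQ R ⊗[ℚ] GQ R :=
  ((Algebra.TensorProduct.includeLeft : GQ R →ₐ[ℚ] GQ R ⊗[ℚ] GQ R).toLinearMap +
    (Algebra.TensorProduct.includeRight : GQ R →ₐ[ℚ] GQ R ⊗[ℚ] GQ R).toLinearMap) ∘ₗ T i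

theorem primitiveT_apply (i : ℕ+) (a : RatR R) :
    primitiveT i a = T i a ⊗ₜ[ℚ] (1 : GQ R) + (1 : GQ R) ⊗ₜ[ℚ] T i a := rfl

/-- The comultiplication for which the elements `T_i(a)` are primitive. -/
def comulGQ (R : Type*) [Ring R] : GQ R →ₐ[ℚ] GQ R ⊗[ℚ] GQ R :=
  liftGQ primitiveT
    (fun i a b => by
      simp only [primitiveT_apply, T_preservesCommutator i a b, add_mul, mul_add,
        Algebra.TensorProduct.tmul_mul_tmul, one_mul, mul_one, TensorProduct.sub_tmul,
        TensorProduct.tmul_sub]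
      abel)
    (fun i j hij a b => by
      simp only [Commute, SemiconjBy, primitiveT_apply, add_mul, mul_add,
        Algebra.TensorProduct.tmul_mul_tmul, one_mul, mul_one, (T_commute hij a b).eq]
      abel)

theorem comulGQ_T (i : ℕ+) (a : RatR R) :
    comulGQ R (T i a) = T i a ⊗ₜ[ℚ] (1 : GQ R) + (1 : GQ R) ⊗ₜ[ℚ] T i a :=
  liftGQ_T _ _ _ i a

/-- The counit vanishing on the elements `T_i(a)`. -/
def counitGQ (R : Type*) [Ring R] : GQ R →ₐ[ℚ] ℚ :=
  liftGQ (fun _ => 0) (fun i a b => by simp) (fun i j hij a b => by simp)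

theorem counitGQ_T (i : ℕ+) (a : RatR R) : counitGQ R (T i a) = 0 := liftGQ_T _ _ _ i a

/-- The antipode as a homomorphism to the opposite algebra. -/
def antipodeOpGQ (R : Type*) [Ring R] : GQ R →ₐ[ℚ] (GQ R)ᵐᵒᵖ :=
  liftGQ (fun i => -((MulOpposite.opLinearEquiv ℚ).toLinearMap ∘ₗ T i))
    (fun i a b => by
      apply MulOpposite.unop_injective
      simp [T_preservesCommutator i a b])
    (fun i j hij a b => by
      apply MulOpposite.unop_injective
      simp [(T_commute hij a b).eq])

theorem antipodeOpGQ_T (i : ℕ+) (a : RatR R) :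
    antipodeOpGQ R (T i a) = MulOpposite.op (-T i a) := liftGQ_T _ _ _ i a

/-- The antipode with `S(T_i(a)) = -T_i(a)`. -/
def antipodeGQ (R : Type*) [Ring R] : GQ R →ₗ[ℚ] GQ R :=
  (MulOpposite.opLinearEquiv ℚ).symm.toLinearMap ∘ₗ (antipodeOpGQ R).toLinearMap

theorem antipodeGQ_T (i : ℕ+) (a : RatR R) : antipodeGQ R (T i a) = -T i a :=
  congrArg MulOpposite.unop (antipodeOpGQ_T i a)

theorem antipodeGQ_one : antipodeGQ R 1 = 1 := congrArg MulOpposite.unop (map_one (antipodeOpGQ R))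

theorem antipodeGQ_mul (x y : GQ R) :
    antipodeGQ R (x * y) = antipodeGQ R y * antipodeGQ R x :=
  congrArg MulOpposite.unop (map_mul (antipodeOpGQ R) x y)

theorem gq_induction {p : GQ R → Prop} (h1 : ∀ c : ℚ, p (algebraMap ℚ _ c))
    (hT : ∀ i a, p (T i a)) (hadd : ∀ x y, p x → p y → p (x + y))
    (hmul : ∀ x y, p x → p y → p (x * y)) (x : GQ R) : p x := by
  have hx : x ∈ Algebra.adjoin ℚ {x : GQ R | ∃ i a, x = T i a} := by rw [adjoin_T]; trivial
  induction hx using Algebra.adjoin_induction with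
  | mem x hx => obtain ⟨i, a, rfl⟩ := hx; exact hT i a
  | algebraMap c => exact h1 c
  | add x y _ _ hx hy => exact hadd x y hx hy
  | mul x y _ _ hx hy => exact hmul x y hx hy

theorem antipodeGQ_mul_left (x : GQ R) :
    LinearMap.mul' ℚ (GQ R) ((antipodeGQ R).rTensor (GQ R) (comulGQ R x)) =
      algebraMap ℚ (GQ R) (counitGQ R x) := by
  refine gq_induction (p := fun x => LinearMap.mul' ℚ (GQ R)
      ((antipodeGQ R).rTensor (GQ R) (comulGQ R x)) = algebraMap ℚ (GQ R) (counitGQ R x))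
    (fun c => ?_) (fun i a => ?_) (fun x y hx hy => ?_) (fun x y hx hy => ?_) x
  · rw [AlgHom.commutes, AlgHom.commutes, Algebra.TensorProduct.algebraMap_apply,
      LinearMap.rTensor_tmul, LinearMap.mul'_apply, mul_one, Algebra.algebraMap_eq_smul_one,
      map_smul, antipodeGQ_one, ← Algebra.algebraMap_eq_smul_one]
    rfl
  · rw [comulGQ_T, counitGQ_T, map_add, map_add, LinearMap.rTensor_tmul, LinearMap.rTensor_tmul,
      LinearMap.mul'_apply, LinearMap.mul'_apply, antipodeGQ_T, antipodeGQ_one]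
    simp
  · rw [map_add, map_add, map_add, hx, hy, map_add, map_add]
  · rw [map_mul, map_mul (counitGQ R), map_mul (algebraMap ℚ (GQ R)), ← hx, ← hy]
    -- On a product the convolution nests as `S(v') (S(u') u'') v''`; the inner part is a scalar by
    -- induction and can be moved out.
    have key : ∀ u v : GQ R ⊗[ℚ] GQ R,
        (∃ c, LinearMap.mul' ℚ (GQ R) ((antipodeGQ R).rTensor (GQ R) u) = algebraMap ℚ _ c) →
        LinearMap.mul' ℚ (GQ R) ((antipodeGQ R).rTensor (GQ R) (u * v)) =
          LinearMap.mul' ℚ (GQ R) ((antipodeGQ R).rTensor (GQ R) u) *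
          LinearMap.mul' ℚ (GQ R) ((antipodeGQ R).rTensor (GQ R) v) := by
      intro u v hu
      induction v using TensorProduct.induction_on with
      | zero => simp
      | add v w hv hw => rw [mul_add, map_add, map_add, hv, hw, map_add, map_add, mul_add]
      | tmul p q =>
        have h2 : ∀ u : GQ R ⊗[ℚ] GQ R,
            LinearMap.mul' ℚ (GQ R) ((antipodeGQ R).rTensor (GQ R) (u * (p ⊗ₜ q))) =
            antipodeGQ R p *
              LinearMap.mul' ℚ (GQ R) ((antipodeGQ R).rTensor (GQ R) u) * q := by
          intro u
          induction u using TensorProduct.induction_on with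
          | zero => simp
          | add v w hv hw => rw [add_mul, map_add, map_add, hv, hw, map_add, map_add, mul_add,
              add_mul]
          | tmul r s =>
            rw [Algebra.TensorProduct.tmul_mul_tmul, LinearMap.rTensor_tmul,
              LinearMap.rTensor_tmul, LinearMap.mul'_apply, LinearMap.mul'_apply,
              antipodeGQ_mul]
            simp only [mul_assoc]
        obtain ⟨c, hc⟩ := hu
        rw [h2, hc, LinearMap.rTensor_tmul, LinearMap.mul'_apply, ← Algebra.commutes, mul_assoc]
    exact key _ _ ⟨_, hx⟩

theorem antipodeGQ_mul_right (x : GQ R) :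
    LinearMap.mul' ℚ (GQ R) ((antipodeGQ R).lTensor (GQ R) (comulGQ R x)) =
      algebraMap ℚ (GQ R) (counitGQ R x) := by
  refine gq_induction (p := fun x => LinearMap.mul' ℚ (GQ R)
      ((antipodeGQ R).lTensor (GQ R) (comulGQ R x)) = algebraMap ℚ (GQ R) (counitGQ R x))
    (fun c => ?_) (fun i a => ?_) (fun x y hx hy => ?_) (fun x y hx hy => ?_) x
  · rw [AlgHom.commutes, AlgHom.commutes, Algebra.TensorProduct.algebraMap_apply,
      LinearMap.lTensor_tmul, LinearMap.mul'_apply, antipodeGQ_one, mul_one]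
    rfl
  · rw [comulGQ_T, counitGQ_T, map_add, map_add, LinearMap.lTensor_tmul, LinearMap.lTensor_tmul,
      LinearMap.mul'_apply, LinearMap.mul'_apply, antipodeGQ_T, antipodeGQ_one]
    simp
  · rw [map_add, map_add, map_add, hx, hy, map_add, map_add]
  · rw [map_mul, map_mul (counitGQ R), map_mul (algebraMap ℚ (GQ R)), ← hx, ← hy]
    -- Mirror image of the previous case: `u' (v' S(v'')) S(u'')`, so now the convolution of `v`
    -- must be a scalar.
    have key : ∀ u v : GQ R ⊗[ℚ] GQ R,
        (∃ c, LinearMap.mul' ℚ (GQ R) ((antipodeGQ R).lTensor (GQ R) v) = algebraMap ℚ _ c) →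
        LinearMap.mul' ℚ (GQ R) ((antipodeGQ R).lTensor (GQ R) (u * v)) =
          LinearMap.mul' ℚ (GQ R) ((antipodeGQ R).lTensor (GQ R) u) *
          LinearMap.mul' ℚ (GQ R) ((antipodeGQ R).lTensor (GQ R) v) := by
      intro u v hv
      induction u using TensorProduct.induction_on with
      | zero => simp
      | add u w hu hw => rw [add_mul, map_add, map_add, hu, hw, map_add, map_add, add_mul]
      | tmul p q =>
        have h2 : ∀ v : GQ R ⊗[ℚ] GQ R,
            LinearMap.mul' ℚ (GQ R) ((antipodeGQ R).lTensor (GQ R) ((p ⊗ₜ q) * v)) =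
            p * LinearMap.mul' ℚ (GQ R) ((antipodeGQ R).lTensor (GQ R) v) *
              antipodeGQ R q := by
          intro v
          induction v using TensorProduct.induction_on with
          | zero => simp
          | add v w hv hw => rw [mul_add, map_add, map_add, hv, hw, map_add, map_add, mul_add,
              add_mul]
          | tmul r s =>
            rw [Algebra.TensorProduct.tmul_mul_tmul, LinearMap.lTensor_tmul,
              LinearMap.lTensor_tmul, LinearMap.mul'_apply, LinearMap.mul'_apply,
              antipodeGQ_mul]
            simp only [mul_assoc]
        obtain ⟨c, hc⟩ := hv
        rw [h2, hc, LinearMap.lTensor_tmul, LinearMap.mul'_apply, mul_assoc, Algebra.commutes,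
          ← mul_assoc]
    exact key _ _ ⟨_, hy⟩

/-- The Hopf algebra structure on `𝒢_∞^ℚ(R)` for which the elements `T_i(a)` are primitive. -/
def hopfGQ (R : Type*) [Ring R] : HopfStructure ℚ (GQ R) where
  comul := comulGQ R
  counit := counitGQ R
  antipode := antipodeGQ R
  coassoc := by
    apply gq_hom_ext
    intro i a
    simp [comulGQ_T, TensorProduct.add_tmul, TensorProduct.tmul_add,
      Algebra.TensorProduct.one_def, add_assoc]
  rTensor_counit := by
    apply gq_hom_ext
    intro i a
    simp [comulGQ_T, counitGQ_T]
  lTensor_counit := by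
    apply gq_hom_ext
    intro i a
    simp [comulGQ_T, counitGQ_T]
  mul_antipode_rTensor := LinearMap.ext antipodeGQ_mul_left
  mul_antipode_lTensor := LinearMap.ext antipodeGQ_mul_right

/-! ### Grouplike power series -/

section Grouplike

variable {σ : Type*}

theorem map_tailPreserving {A B : Type*} [Ring A] [Algebra ℚ A] [Ring B] [Algebra ℚ B]
    (f : A →+* B) : TailPreserving (MvPowerSeries.map (σ := σ) f :
      MvPowerSeries σ A →+ MvPowerSeries σ B) := by
  intro N g hg m hm
  refine (MvPowerSeries.coeff_map f m g).trans ?_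
  rw [hg m hm, map_zero]

/-- The inclusion of the left tensor factor. -/
def inclL (R : Type*) [Ring R] : GQ R →+* GQ R ⊗[ℚ] GQ R :=
  (Algebra.TensorProduct.includeLeft : GQ R →ₐ[ℚ] GQ R ⊗[ℚ] GQ R)

/-- The inclusion of the right tensor factor. -/
def inclR (R : Type*) [Ring R] : GQ R →+* GQ R ⊗[ℚ] GQ R :=
  (Algebra.TensorProduct.includeRight : GQ R →ₐ[ℚ] GQ R ⊗[ℚ] GQ R)

theorem commute_inclL_inclR (f g : MvPowerSeries σ (GQ R)) :
    Commute (MvPowerSeries.map (inclL R) f) (MvPowerSeries.map (inclR R) g) := by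
  refine commute_of_coeff fun i j => ?_
  rw [MvPowerSeries.coeff_map, MvPowerSeries.coeff_map]
  change (_ ⊗ₜ[ℚ] (1 : GQ R)) * ((1 : GQ R) ⊗ₜ[ℚ] _) = ((1 : GQ R) ⊗ₜ[ℚ] _) * (_ ⊗ₜ[ℚ] (1 : GQ R))
  simp [Algebra.TensorProduct.tmul_mul_tmul]

/-- The exponent has primitive coefficients, so its coproduct is the sum of its left and right
copies; these commute, and the exponential of the sum splits. -/
theorem map_comul_Theta (l : ℕ+) {y : MvPowerSeries σ (RatR R)} (hy : y ∈ tail σ (RatR R) 1) :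
    MvPowerSeries.map (comulGQ R : GQ R →+* _) (Theta l (1 + y)) =
      MvPowerSeries.map (inclL R) (Theta l (1 + y)) *
        MvPowerSeries.map (inclR R) (Theta l (1 + y)) := by
  have h := mapCoeff_T_mem_tail l hy
  rw [Theta_eq, map_expSeries _ (map_tailPreserving _) h, map_expSeries _ (map_tailPreserving _) h,
    map_expSeries _ (map_tailPreserving _) h]
  have hadd := expSeries_add
    (x := MvPowerSeries.map (inclL R) (mapCoeff (T l) (logSeries (1 + y))))
    (y := MvPowerSeries.map (inclR R) (mapCoeff (T l) (logSeries (1 + y))))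
    (map_tailPreserving (inclL R) 1 _ h) (map_tailPreserving (inclR R) 1 _ h)
    (commute_inclL_inclR _ _)
  rw [← hadd]
  congr 1
  refine MvPowerSeries.ext fun m => ?_
  rw [map_add, MvPowerSeries.coeff_map, MvPowerSeries.coeff_map, MvPowerSeries.coeff_map]
  exact comulGQ_T _ _

theorem map_comul_thetaProd {y : ℕ+ → MvPowerSeries σ (RatR R)} (hy : Admissible y) :
    MvPowerSeries.map (comulGQ R : GQ R →+* _) (thetaProd y) =
      MvPowerSeries.map (inclL R) (thetaProd y) * MvPowerSeries.map (inclR R) (thetaProd y) := by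
  have hF : ∀ l : ℕ+, Theta l (1 + y l) - 1 ∈ tail σ (GQ R) l := fun l => Theta_sub_one_mem_tail l (hy l)
  have hF' : ∀ (f : GQ R →+* GQ R ⊗[ℚ] GQ R) (l : ℕ+),
      MvPowerSeries.map f (Theta l (1 + y l)) - 1 ∈ tail σ (GQ R ⊗[ℚ] GQ R) l := fun f l => by
    rw [← map_one (MvPowerSeries.map f), ← map_sub]
    exact map_tailPreserving f _ _ (hF l)
  unfold thetaProd
  rw [map_prodSeries _ (map_tailPreserving _) hF, map_prodSeries _ (map_tailPreserving _) hF,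
    map_prodSeries _ (map_tailPreserving _) hF,
    prodSeries_mul (hF' _) (hF' _) fun i j _ => commute_inclL_inclR _ _]
  congr 1
  funext l
  exact map_comul_Theta l (hy.mem_tail_one l)

theorem map_counit_thetaProd {y : ℕ+ → MvPowerSeries σ (RatR R)} (hy : Admissible y) :
    MvPowerSeries.map (counitGQ R : GQ R →+* ℚ) (thetaProd y) = 1 := by
  have hF : ∀ l : ℕ+, Theta l (1 + y l) - 1 ∈ tail σ (GQ R) l := fun l => Theta_sub_one_mem_tail l (hy l)
  have h1 : ∀ l, MvPowerSeries.map (counitGQ R : GQ R →+* ℚ) (Theta l (1 + y l)) = 1 := by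
    intro l
    have h := mapCoeff_T_mem_tail l (hy.mem_tail_one l)
    rw [Theta_eq, map_expSeries _ (map_tailPreserving _) h]
    refine Eq.trans (congrArg expSeries ?_) expSeries_zero
    refine MvPowerSeries.ext fun m => ?_
    rw [MvPowerSeries.coeff_map]
    exact counitGQ_T _ _
  have h2 : ∀ N, partialProd (fun _ => (1 : MvPowerSeries σ ℚ)) N = 1 := by
    intro N
    induction N with
    | zero => rfl
    | succ N ih => rw [partialProd_succ, ih, mul_one]
  unfold thetaProd
  rw [map_prodSeries _ (map_tailPreserving _) hF]
  simp only [h1]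
  refine eq_of_congrBelow fun N => ?_
  refine ((prodSeries_congr (fun l => ?_) (le_refl N)).mono (Nat.le_succ N)).trans ?_
  · rw [sub_self]; exact zero_mem _
  · rw [h2]; exact CongrBelow.rfl'

end Grouplike

end HopfGQ

/-- For a grouplike power series the antipode is determined by the coproduct and the counit. -/
theorem HopfStructure.antipode_coeff {k : Type*} {A σ : Type*} [CommRing k] [Ring A] [Algebra k A]
    [DecidableEq σ] (H : HopfStructure k A) {F : MvPowerSeries σ A}
    (hΔ : ∀ m, H.comul (MvPowerSeries.coeff m F) = ∑ p ∈ antidiagonal m,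
      MvPowerSeries.coeff p.1 F ⊗ₜ[k] MvPowerSeries.coeff p.2 F)
    (hε : ∀ m, H.counit (MvPowerSeries.coeff m F) = if m = 0 then 1 else 0) (m : σ →₀ ℕ) :
    (∑ p ∈ antidiagonal m,
      H.antipode (MvPowerSeries.coeff p.1 F) * MvPowerSeries.coeff p.2 F =
      if m = 0 then 1 else 0) ∧
    (∑ p ∈ antidiagonal m,
      MvPowerSeries.coeff p.1 F * H.antipode (MvPowerSeries.coeff p.2 F) =
      if m = 0 then 1 else 0) := by
  constructor
  · have h := LinearMap.congr_fun H.mul_antipode_rTensor (MvPowerSeries.coeff m F)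
    simp only [LinearMap.comp_apply, AlgHom.toLinearMap_apply, hΔ, hε, map_sum,
      LinearMap.rTensor_tmul, LinearMap.mul'_apply, Algebra.linearMap_apply] at h
    rw [h]
    split_ifs <;> simp
  · have h := LinearMap.congr_fun H.mul_antipode_lTensor (MvPowerSeries.coeff m F)
    simp only [LinearMap.comp_apply, AlgHom.toLinearMap_apply, hΔ, hε, map_sum,
      LinearMap.lTensor_tmul, LinearMap.mul'_apply, Algebra.linearMap_apply] at h
    rw [h]
    split_ifs <;> simp

/-- Only the coproduct and the counit need checking: the antipode axioms applied to the coefficients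
then say that `S(F)` is a two-sided inverse of `F`. -/
theorem HopfStructure.isGrouplike_of_coeff {k : Type*} {A : Type*} [CommRing k] [Ring A]
    [Algebra k A] (H : HopfStructure k A) {F : PowerSeries A}
    (hΔ : ∀ n, H.comul (PowerSeries.coeff n F) = ∑ p ∈ antidiagonal n,
      PowerSeries.coeff p.1 F ⊗ₜ[k] PowerSeries.coeff p.2 F)
    (hε : ∀ n, H.counit (PowerSeries.coeff n F) = if n = 0 then 1 else 0) :
    H.IsGrouplike F where
  comul_eq := by
    ext n
    rw [PowerSeries.coeff_map, PowerSeries.coeff_mul]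
    simp only [PowerSeries.coeff_map]
    refine (hΔ n).trans (Finset.sum_congr rfl fun p _ => ?_)
    change _ = (_ ⊗ₜ[k] (1 : A)) * ((1 : A) ⊗ₜ[k] _)
    rw [Algebra.TensorProduct.tmul_mul_tmul, one_mul, mul_one]
  counit_eq := by
    ext n
    rw [PowerSeries.coeff_map, PowerSeries.coeff_one]
    exact hε n
  antipode_mul := by
    ext n
    have h := LinearMap.congr_fun H.mul_antipode_rTensor (PowerSeries.coeff n F)
    simp only [LinearMap.comp_apply, AlgHom.toLinearMap_apply, hΔ, hε, map_sum,
      LinearMap.rTensor_tmul, LinearMap.mul'_apply, Algebra.linearMap_apply] at h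
    rw [PowerSeries.coeff_mul, PowerSeries.coeff_one]
    simp only [PowerSeries.coeff_mk]
    rw [h]
    split_ifs <;> simp
  mul_antipode := by
    ext n
    have h := LinearMap.congr_fun H.mul_antipode_lTensor (PowerSeries.coeff n F)
    simp only [LinearMap.comp_apply, AlgHom.toLinearMap_apply, hΔ, hε, map_sum,
      LinearMap.lTensor_tmul, LinearMap.mul'_apply, Algebra.linearMap_apply] at h
    rw [PowerSeries.coeff_mul, PowerSeries.coeff_one]
    simp only [PowerSeries.coeff_mk]
    rw [h]
    split_ifs <;> simp

end

end LimGroth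

/-! ### The bialternant formula in finitely many variables -/

namespace LimGroth

open Finset.HasAntidiagonal (antidiagonal mem_antidiagonal)

noncomputable section

set_option linter.unusedSectionVars false

/-! ### Alternants and the Jacobi-Trudi determinant in finitely many variables -/

section Alternant

section CompleteSum

variable {σ : Type*} [DecidableEq σ]

/-- The sum of all monomials of degree `k` in the variables from `S`. -/
def completeSum (S : Finset σ) (k : ℤ) : MvPowerSeries σ ℤ :=
  fun m => if (m.degree : ℤ) = k ∧ m.support ⊆ S then 1 else 0

theorem coeff_completeSum (S : Finset σ) (k : ℤ) (m : σ →₀ ℕ) :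
    MvPowerSeries.coeff m (completeSum S k) =
      if (m.degree : ℤ) = k ∧ m.support ⊆ S then 1 else 0 := rfl

theorem completeSum_of_neg (S : Finset σ) {k : ℤ} (hk : k < 0) : completeSum S k = 0 := by
  ext m
  rw [coeff_completeSum, if_neg (by omega), map_zero]

theorem completeSum_zero (S : Finset σ) : completeSum S 0 = 1 := by
  ext m
  rw [coeff_completeSum, MvPowerSeries.coeff_one]
  refine if_congr ⟨fun h => ?_, ?_⟩ rfl rfl
  · exact (Finsupp.degree_eq_zero_iff m).1 (by exact_mod_cast h.1)
  · rintro rfl; simp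

theorem completeSum_singleton (i : σ) (k : ℕ) :
    completeSum {i} k = (MvPowerSeries.X i : MvPowerSeries σ ℤ) ^ k := by
  ext m
  rw [coeff_completeSum, MvPowerSeries.coeff_X_pow]
  refine if_congr ⟨fun h => ?_, ?_⟩ rfl rfl
  · obtain ⟨h1, h2⟩ := h
    rw [Finsupp.support_subset_singleton] at h2
    rw [h2, Finsupp.degree_single] at h1
    rw [h2]
    congr 1
    exact_mod_cast h1
  · rintro rfl; exact ⟨by simp, Finsupp.support_single_subset⟩

/-- Multiplying by `x_j` matches the monomials of degree `k - 1` with those of degree `k` divisible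
by `x_j`; what remains is free of `x_j`. -/
theorem completeSum_insert {S : Finset σ} {j : σ} (hj : j ∉ S) (k : ℤ) :
    completeSum (insert j S) k - MvPowerSeries.X j * completeSum (insert j S) (k - 1) =
      completeSum S k := by
  ext m
  rw [map_sub, MvPowerSeries.X, MvPowerSeries.coeff_monomial_mul]
  simp only [coeff_completeSum, Finsupp.single_le_iff]
  rcases Nat.eq_zero_or_pos (m j) with h0 | hpos
  · rw [if_neg (by omega : ¬ 1 ≤ m j), sub_zero]
    refine if_congr (and_congr_right fun _ => ?_) rfl rfl
    rw [Finset.subset_insert_iff_of_notMem (by simpa using h0)]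
  · rw [if_pos (by omega : 1 ≤ m j)]
    obtain ⟨m', rfl⟩ : ∃ m', m = m' + Finsupp.single j 1 :=
      ⟨m - Finsupp.single j 1, (tsub_add_cancel_of_le (Finsupp.single_le_iff.2 hpos)).symm⟩
    have hs : (m' + Finsupp.single j 1).support = insert j m'.support := by
      ext x
      by_cases hx : x = j
      · subst hx; simp
      · simp [hx]
    rw [add_tsub_cancel_right, hs, map_add, Finsupp.degree_single,
      one_mul, if_neg (show ¬(_ ∧ insert j m'.support ⊆ S) from
        fun h => hj (h.2 (Finset.mem_insert_self _ _)))]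
    have : ((((m'.degree + 1 : ℕ) : ℤ) = k ∧ insert j m'.support ⊆ insert j S) ↔
        ((m'.degree : ℤ) = k - 1 ∧ m'.support ⊆ insert j S)) := by
      rw [Finset.insert_subset_iff]
      push_cast
      constructor
      · rintro ⟨h1, -, h2⟩; exact ⟨by omega, h2⟩
      · rintro ⟨h1, h2⟩; exact ⟨by omega, Finset.mem_insert_self _ _, h2⟩
    rw [if_congr this rfl rfl, sub_self]

/-- The shift of sequences. -/
def shiftSeq (P : Type*) [CommRing P] : Module.End P (ℤ → P) := LinearMap.funLeft P P fun k => k - 1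

theorem shiftSeq_pow_apply {P : Type*} [CommRing P] (f : ℤ → P) (i : ℕ) (k : ℤ) :
    (shiftSeq P ^ i) f k = f (k - i) := by
  induction i generalizing k with
  | zero => simp
  | succ i ih =>
    rw [pow_succ', Module.End.mul_apply]
    change (shiftSeq P ^ i) f (k - 1) = _
    rw [ih]
    congr 1
    push_cast
    ring

/-- The product of the polynomials `1 - x_j t` for `j ∈ S`. -/
def elemPoly (S : Finset σ) : Polynomial (MvPowerSeries σ ℤ) :=
  ∏ j ∈ S, (1 - Polynomial.C (MvPowerSeries.X j) * Polynomial.X)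

theorem natDegree_elemPoly (S : Finset σ) : (elemPoly S).natDegree ≤ S.card := by
  unfold elemPoly
  refine (Polynomial.natDegree_prod_le _ _).trans ?_
  rw [Finset.card_eq_sum_ones]
  refine Finset.sum_le_sum fun j _ => ?_
  compute_degree

/-- With `t` acting as the shift of sequences, each factor `1 - x_j t` removes the variable `x_j`
from the complete sums, until only `x_i` is left. -/
theorem aeval_elemPoly (S : Finset σ) (i : σ) (hi : i ∉ S) :
    Polynomial.aeval (shiftSeq (MvPowerSeries σ ℤ)) (elemPoly S) (completeSum (insert i S)) =
      completeSum {i} := by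
  induction S using Finset.induction_on with
  | empty => simp [elemPoly]
  | insert j S hj ih =>
    rw [Finset.mem_insert, not_or] at hi
    have hj' : j ∉ insert i S := by
      rw [Finset.mem_insert, not_or]
      exact ⟨Ne.symm hi.1, hj⟩
    have h : elemPoly (insert j S) =
        elemPoly S * (1 - Polynomial.C (MvPowerSeries.X j) * Polynomial.X) := by
      unfold elemPoly
      rw [Finset.prod_insert hj, mul_comm]
    rw [h, map_mul, Module.End.mul_apply, Finset.insert_comm]
    rw [← ih hi.2]
    congr 1
    funext k
    rw [← completeSum_insert hj' k]
    simp only [map_sub, map_one, map_mul, Polynomial.aeval_C, Polynomial.aeval_X]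
    rfl

/-- The expansion of `x_i ^ a` in complete symmetric functions of all variables; the coefficients,
signed elementary symmetric functions of the other variables, do not depend on `a`, which is what
factors the alternant matrix. -/
theorem X_pow_eq_sum [Fintype σ] (i : σ) (a : ℕ) :
    (MvPowerSeries.X i : MvPowerSeries σ ℤ) ^ a =
      ∑ k ∈ Finset.range (Fintype.card σ),
        (elemPoly (Finset.univ.erase i)).coeff k * completeSum Finset.univ ((a : ℤ) - k) := by
  have h := aeval_elemPoly (Finset.univ.erase i) i (Finset.notMem_erase _ _)
  have hd : (elemPoly (Finset.univ.erase i)).natDegree < Fintype.card σ := by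
    refine (natDegree_elemPoly _).trans_lt ?_
    rw [Finset.card_erase_of_mem (Finset.mem_univ i), Finset.card_univ]
    exact Nat.sub_lt (Fintype.card_pos_iff.2 ⟨i⟩) one_pos
  rw [Finset.insert_erase (Finset.mem_univ i), Polynomial.aeval_eq_sum_range' hd] at h
  rw [← completeSum_singleton, ← h, LinearMap.sum_apply, Finset.sum_apply]
  refine Finset.sum_congr rfl fun k _ => ?_
  rw [LinearMap.smul_apply, Pi.smul_apply, shiftSeq_pow_apply, smul_eq_mul]

end CompleteSum

variable {n : ℕ}

/-- The Jacobi-Trudi determinant with `n` rows, in `n` variables. -/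
def jacobiTrudi (r : Fin n → ℕ) : MvPowerSeries (Fin n) ℤ :=
  Matrix.det (Matrix.of fun i j : Fin n =>
    completeSum Finset.univ ((r i : ℤ) - ((i : ℕ) : ℤ) + ((j : ℕ) : ℤ)))

/-- The alternant with exponents `r_j + n - 1 - j`. -/
def alternant (r : Fin n → ℕ) : MvPowerSeries (Fin n) ℤ :=
  Matrix.det (Matrix.of fun i j : Fin n =>
    (MvPowerSeries.X i : MvPowerSeries (Fin n) ℤ) ^ (r j + (Fin.rev j : ℕ)))

theorem jacobiTrudi_zero : jacobiTrudi (0 : Fin n → ℕ) = 1 := by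
  unfold jacobiTrudi
  rw [Matrix.det_of_isUpperTriangular]
  · refine Finset.prod_eq_one fun i _ => ?_
    simp [completeSum_zero]
  · intro i j hij
    have hij : (j : ℕ) < i := hij
    rw [Matrix.of_apply]
    refine completeSum_of_neg _ ?_
    simp only [Pi.zero_apply]
    omega

/-- The matrix of the coefficients of the polynomials `∏_{j ≠ i} (1 - x_j t)`. -/
def elemMatrix (n : ℕ) : Matrix (Fin n) (Fin n) (MvPowerSeries (Fin n) ℤ) :=
  Matrix.of fun i l => (elemPoly (Finset.univ.erase i)).coeff (Fin.rev l : ℕ)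

theorem alternant_eq_det_mul (r : Fin n → ℕ) :
    alternant r = (elemMatrix n).det * jacobiTrudi r := by
  unfold alternant jacobiTrudi
  rw [← Matrix.det_transpose (Matrix.of fun i j : Fin n =>
    completeSum Finset.univ ((r i : ℤ) - ((i : ℕ) : ℤ) + ((j : ℕ) : ℤ))), ← Matrix.det_mul]
  congr 1
  ext1 i j
  rw [Matrix.mul_apply, Matrix.of_apply, X_pow_eq_sum, Fintype.card_fin,
    ← Fin.sum_univ_eq_sum_range (fun k => (elemPoly (Finset.univ.erase i)).coeff k *
      completeSum Finset.univ (((r j + (Fin.rev j : ℕ) : ℕ) : ℤ) - k)),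
    ← Equiv.sum_comp Fin.revPerm]
  refine Finset.sum_congr rfl fun l _ => ?_
  rw [Matrix.transpose_apply, Matrix.of_apply, elemMatrix, Matrix.of_apply, Fin.revPerm_apply]
  congr 2
  have h1 := Fin.val_rev j
  have h2 := Fin.val_rev l
  omega

/-- The case `r = 0` identifies the determinant of `elemMatrix n` with the Vandermonde alternant, so
it never has to be computed. -/
theorem alternant_eq_mul (r : Fin n → ℕ) : alternant r = alternant 0 * jacobiTrudi r := by
  rw [alternant_eq_det_mul r, alternant_eq_det_mul 0, jacobiTrudi_zero, mul_one]

/-- The exponent of `∏_i x_{w i} ^ {a_i}`. -/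
def permExponent (a : Fin n → ℕ) (w : Equiv.Perm (Fin n)) : Fin n →₀ ℕ :=
  Finsupp.equivFunOnFinite.symm (a ∘ w.symm)

theorem prod_X_pow_perm (a : Fin n → ℕ) (w : Equiv.Perm (Fin n)) :
    ∏ i, (MvPowerSeries.X (w i) : MvPowerSeries (Fin n) ℤ) ^ a i =
      MvPowerSeries.monomial (permExponent a w) 1 := by
  rw [← Equiv.prod_comp w.symm]
  simp only [Equiv.apply_symm_apply, MvPowerSeries.X_pow_eq]
  rw [MvPowerSeries.prod_monomial, Finset.prod_const_one]
  refine congrArg (fun e => MvPowerSeries.monomial e (1 : ℤ)) ?_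
  exact Finsupp.univ_sum_single (Finsupp.equivFunOnFinite.symm (a ∘ w.symm))

theorem alternant_eq_sum (r : Fin n → ℕ) :
    alternant r = ∑ w : Equiv.Perm (Fin n), ((Equiv.Perm.sign w : ℤ) : MvPowerSeries (Fin n) ℤ) *
      MvPowerSeries.monomial (permExponent (fun i => r i + (Fin.rev i : ℕ)) w) 1 := by
  unfold alternant
  rw [Matrix.det_apply']
  refine Finset.sum_congr rfl fun w _ => ?_
  rw [← prod_X_pow_perm]
  rfl

theorem coeff_intCast_mul {σ : Type*} (c : ℤ) (f : MvPowerSeries σ ℤ) (m : σ →₀ ℕ) :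
    MvPowerSeries.coeff m ((c : MvPowerSeries σ ℤ) * f) = c * MvPowerSeries.coeff m f := by
  rw [← zsmul_eq_mul, map_zsmul, smul_eq_mul]

theorem strictAnti_add_rev {r : Fin n → ℕ} (hr : Antitone r) :
    StrictAnti fun i => r i + (Fin.rev i : ℕ) := fun _ _ hij =>
  add_lt_add_of_le_of_lt (hr hij.le) (Fin.rev_lt_rev.2 hij)

/-- A permutation carrying one strictly decreasing sequence to another preserves the order of `Fin
n`, hence is trivial. -/
theorem eq_one_of_permExponent_eq {a b : Fin n → ℕ} (ha : StrictAnti a) (hb : StrictAnti b)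
    {w : Equiv.Perm (Fin n)} (h : permExponent a w = Finsupp.equivFunOnFinite.symm b) : w = 1 := by
  have h : a ∘ w.symm = b := Finsupp.equivFunOnFinite.symm.injective h
  have hw : StrictMono w.symm := fun i j hij => by
    have := hb hij
    rw [← h] at this
    exact ha.lt_iff_gt.1 this
  have : (w.symm : Fin n → Fin n) = id :=
    congrArg (fun e : Fin n ≃o Fin n => (e : Fin n → Fin n)) (Subsingleton.elim
      (hw.orderIsoOfSurjective _ w.symm.surjective) (OrderIso.refl _))
  ext i
  have h2 := congrFun this (w i)
  simp only [Equiv.symm_apply_apply, id] at h2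
  rw [← h2]
  rfl

theorem coeff_alternant {r ν : Fin n → ℕ} (hr : Antitone r) (hν : Antitone ν) :
    MvPowerSeries.coeff (Finsupp.equivFunOnFinite.symm fun i => ν i + (Fin.rev i : ℕ))
      (alternant r) = if r = ν then 1 else 0 := by
  rw [alternant_eq_sum, map_sum, Finset.sum_eq_single 1]
  · rw [coeff_intCast_mul, MvPowerSeries.coeff_monomial]
    simp only [Equiv.Perm.sign_one, Units.val_one, one_mul]
    refine if_congr ⟨fun h => ?_, ?_⟩ rfl rfl
    · have h := Finsupp.equivFunOnFinite.symm.injective h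
      funext i
      have := congrFun h i
      simp only [Function.comp] at this
      exact (Nat.add_right_cancel this).symm
    · rintro rfl; rfl
  · intro w _ hw
    rw [coeff_intCast_mul, MvPowerSeries.coeff_monomial, if_neg, mul_zero]
    exact fun h => hw (eq_one_of_permExponent_eq (strictAnti_add_rev hr) (strictAnti_add_rev hν)
      h.symm)
  · simp

/-- The exponents `ν + δ - w(δ)`. -/
def shiftedExponent (ν : Fin n → ℕ) (w : Equiv.Perm (Fin n)) : Fin n →₀ ℕ :=
  (Finsupp.equivFunOnFinite.symm fun i => ν i + (Fin.rev i : ℕ)) -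
    permExponent (fun i => (Fin.rev i : ℕ)) w

/-- The condition `w(δ) ≤ ν + δ`. -/
def ShiftAdmissible (ν : Fin n → ℕ) (w : Equiv.Perm (Fin n)) : Prop :=
  permExponent (fun i => (Fin.rev i : ℕ)) w ≤
    Finsupp.equivFunOnFinite.symm fun i => ν i + (Fin.rev i : ℕ)

theorem degree_shiftedExponent {ν : Fin n → ℕ} {w : Equiv.Perm (Fin n)}
    (h : ShiftAdmissible ν w) : (shiftedExponent ν w).degree = ∑ i, ν i := by
  have h1 : (shiftedExponent ν w).degree + (permExponent (fun i => (Fin.rev i : ℕ)) w).degree =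
      (Finsupp.equivFunOnFinite.symm fun i => ν i + (Fin.rev i : ℕ)).degree := by
    rw [← map_add, shiftedExponent, tsub_add_cancel_of_le h]
  simp only [Finsupp.degree_eq_sum, permExponent, Finsupp.equivFunOnFinite_symm_apply_apply,
    Function.comp] at h1
  rw [Equiv.sum_comp w.symm (fun i => (Fin.rev i : ℕ)), Finset.sum_add_distrib] at h1
  rw [Finsupp.degree_eq_sum]
  exact Nat.add_right_cancel h1

-- This compares the coefficients at `ν + δ` in `a_{r + δ} = a_δ s_r`, with `a_δ` expanded over
-- permutations. It is an explicit integral inverse of the matrix of Schur coefficients.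
-- `ShiftAdmissible` discards the `w` for which `ν + δ - w(δ)` has a negative entry, where
-- subtraction of exponents would truncate.
open scoped Classical in
theorem sum_sign_mul_coeff_jacobiTrudi {r ν : Fin n → ℕ} (hr : Antitone r) (hν : Antitone ν) :
    ∑ w : Equiv.Perm (Fin n), (Equiv.Perm.sign w : ℤ) * (if ShiftAdmissible ν w then
      MvPowerSeries.coeff (shiftedExponent ν w) (jacobiTrudi r) else 0) =
      if r = ν then 1 else 0 := by
  rw [← coeff_alternant hr hν, alternant_eq_mul r, alternant_eq_sum, Finset.sum_mul, map_sum]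
  refine Finset.sum_congr rfl fun w _ => ?_
  rw [mul_assoc, coeff_intCast_mul, MvPowerSeries.coeff_monomial_mul, one_mul]
  simp only [Pi.zero_apply, zero_add]
  congr 1
  exact if_congr Iff.rfl rfl rfl

end Alternant

end

end LimGroth

/-! ### Symmetry, partitions, and inversion of the Kostka matrix -/

namespace LimGroth

open Finset.HasAntidiagonal (antidiagonal mem_antidiagonal)

noncomputable section

set_option linter.unusedSectionVars false

/-! ### Symmetry of the coefficients -/

section BlockSymmetry

variable {ι : Type*} {R : Type*} [Ring R] {e : Equiv.Perm (ι × ℕ)}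

theorem fst_symm_of_fst (he : ∀ v, (e v).1 = v.1) (v : ι × ℕ) : (e.symm v).1 = v.1 := by
  rw [← he, Equiv.apply_symm_apply]

theorem coeff_embDomain_psum (he : ∀ v, (e v).1 = v.1) (l : ℕ+) (U : ι) (n : ι × ℕ →₀ ℕ) :
    MvPowerSeries.coeff (n.embDomain e.toEmbedding) (psum l U) =
      MvPowerSeries.coeff n (psum l U) := by
  classical
  refine if_congr ⟨?_, ?_⟩ rfl rfl
  · rintro ⟨i, hi⟩
    refine ⟨(e.symm (U, i)).2, Finsupp.embDomain_injective e.toEmbedding ?_⟩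
    rw [hi, Finsupp.embDomain_single]
    congr 1
    have h : (U, (e.symm (U, i)).2) = e.symm (U, i) := Prod.ext (fst_symm_of_fst he (U, i)).symm rfl
    rw [h]
    exact (e.apply_symm_apply _).symm
  · rintro ⟨i, rfl⟩
    refine ⟨(e (U, i)).2, ?_⟩
    rw [Finsupp.embDomain_single]
    congr 1
    exact Prod.ext (he (U, i)) rfl

theorem restrict_psumBasis (he : ∀ v, (e v).1 = v.1) (b : Module.Basis ι ℤ R) (l : ℕ+) :
    (restrict e.toEmbedding).hom (RatR R) (psumBasis b l) = psumBasis b l := by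
  refine MvPowerSeries.ext fun n => ?_
  rw [coeff_restrict]
  exact finsum_congr fun U => by rw [coeff_embDomain_psum he]

/-- Symmetry of the universal series in each alphabet; it reduces comparisons of coefficients to
exponents that are weakly decreasing in each alphabet. -/
theorem coeff_embDomain_thetaProd_psumBasis (he : ∀ v, (e v).1 = v.1) (b : Module.Basis ι ℤ R)
    (n : ι × ℕ →₀ ℕ) :
    MvPowerSeries.coeff (n.embDomain e.toEmbedding) (thetaProd (psumBasis b)) =
      MvPowerSeries.coeff n (thetaProd (psumBasis b)) := by
  rw [← coeff_restrict, MonomialSubst.hom_thetaProd _ (psumBasis_admissible b)]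
  simp only [restrict_psumBasis he]

theorem restrict_hsum (he : ∀ v, (e v).1 = v.1) (k : ℤ) (U : ι) :
    (restrict e.toEmbedding).hom ℤ (hsum k U) = hsum k U := by
  classical
  refine MvPowerSeries.ext fun n => ?_
  rw [coeff_restrict]
  refine if_congr ?_ rfl rfl
  rw [degree_embDomain, Finsupp.support_embDomain]
  refine and_congr_right fun _ => ?_
  simp only [Finset.mem_map, forall_exists_index, and_imp, forall_apply_eq_imp_iff₂]
  exact forall₂_congr fun v _ => by rw [← he v]; rfl

theorem restrict_schur (he : ∀ v, (e v).1 = v.1) (μ : YoungDiagram) (U : ι) :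
    (restrict e.toEmbedding).hom ℤ (schur μ U) = schur μ U := by
  unfold schur
  rw [RingHom.map_det]
  congr 1
  ext1 i j
  exact restrict_hsum he _ _

theorem coeff_embDomain_schur (he : ∀ v, (e v).1 = v.1) (μ : YoungDiagram) (U : ι)
    (n : ι × ℕ →₀ ℕ) :
    MvPowerSeries.coeff (n.embDomain e.toEmbedding) (schur μ U) =
      MvPowerSeries.coeff n (schur μ U) := by
  rw [← coeff_restrict, restrict_schur he]

theorem coeff_embDomain_schurProd (he : ∀ v, (e v).1 = v.1) (lam : Multipartition ι)
    (n : ι × ℕ →₀ ℕ) :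
    MvPowerSeries.coeff (n.embDomain e.toEmbedding) (schurProd lam) =
      MvPowerSeries.coeff n (schurProd lam) := by
  rw [← coeff_restrict]
  unfold schurProd
  rw [map_prod]
  simp only [restrict_schur he]

end BlockSymmetry

/-! ### Young diagrams and their row lengths -/

section Young

theorem card_eq_sum_rowLen (μ : YoungDiagram) {n : ℕ} (hn : μ.colLen 0 ≤ n) :
    μ.card = ∑ i ∈ Finset.range n, μ.rowLen i := by
  unfold YoungDiagram.card
  rw [Finset.card_eq_sum_card_fiberwise (f := Prod.fst) (t := Finset.range n)]
  · exact Finset.sum_congr rfl fun i _ => (μ.rowLen_eq_card).symm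
  · rintro ⟨i, j⟩ h
    have h : (i, j) ∈ μ := h
    have := YoungDiagram.mem_iff_lt_colLen.1 (μ.up_left_mem le_rfl (Nat.zero_le j) h)
    simp only [Finset.coe_range, Set.mem_Iio]
    omega

theorem colLen_zero_le_card (μ : YoungDiagram) : μ.colLen 0 ≤ μ.card := by
  rw [YoungDiagram.colLen_eq_card]
  exact Finset.card_le_card (Finset.filter_subset _ _)

theorem rowLen_eq_zero (μ : YoungDiagram) {i : ℕ} (hi : μ.colLen 0 ≤ i) : μ.rowLen i = 0 := by
  by_contra h
  have := YoungDiagram.mem_iff_lt_colLen.1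
    (YoungDiagram.mem_iff_lt_rowLen.2 (Nat.pos_of_ne_zero h))
  omega

theorem eq_of_rowLen_eq {μ ν : YoungDiagram} (h : ∀ i, μ.rowLen i = ν.rowLen i) : μ = ν := by
  refine YoungDiagram.ext (Finset.ext fun c => ?_)
  rw [YoungDiagram.mem_cells, YoungDiagram.mem_cells, YoungDiagram.mem_iff_lt_rowLen,
    YoungDiagram.mem_iff_lt_rowLen, h]

theorem finite_setOf_card_eq (d : ℕ) : {μ : YoungDiagram | μ.card = d}.Finite := by
  have hinj : Function.Injective YoungDiagram.cells := fun μ ν h => YoungDiagram.ext h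
  refine ((Finset.range d ×ˢ Finset.range d).powerset.finite_toSet.preimage
    hinj.injOn).subset fun μ hμ => ?_
  simp only [Set.mem_preimage, Finset.mem_coe, Finset.mem_powerset]
  rintro ⟨i, j⟩ hc
  have hc : (i, j) ∈ μ := hc
  have h1 := YoungDiagram.mem_iff_lt_colLen.1 (μ.up_left_mem le_rfl (Nat.zero_le j) hc)
  have h2 := YoungDiagram.mem_iff_lt_rowLen.1 hc
  have h3 : μ.rowLen i ≤ μ.card := by
    rw [YoungDiagram.rowLen_eq_card]
    exact Finset.card_le_card (Finset.filter_subset _ _)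
  have h4 := colLen_zero_le_card μ
  have hμ : μ.card = d := hμ
  rw [Finset.mem_product, Finset.mem_range, Finset.mem_range]
  constructor <;> dsimp only <;> omega

/-- The Young diagrams with `d` cells. -/
def diagrams (d : ℕ) : Finset YoungDiagram := (finite_setOf_card_eq d).toFinset

theorem mem_diagrams {d : ℕ} {μ : YoungDiagram} : μ ∈ diagrams d ↔ μ.card = d := by
  simp [diagrams]

/-- The sequence of row lengths. -/
def rowExp (μ : YoungDiagram) : ℕ →₀ ℕ :=
  Finsupp.onFinset (Finset.range (μ.colLen 0)) μ.rowLen fun i hi => by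
    rw [Finset.mem_range]
    by_contra h
    exact hi (rowLen_eq_zero μ (not_lt.1 h))

theorem rowExp_injective : Function.Injective rowExp := fun _ _ h =>
  eq_of_rowLen_eq fun i => DFunLike.congr_fun h i

theorem degree_rowExp (μ : YoungDiagram) : (rowExp μ).degree = μ.card := by
  rw [card_eq_sum_rowLen μ le_rfl, Finsupp.degree_apply]
  exact Finset.sum_subset Finsupp.support_onFinset_subset fun i _ hi =>
    Finsupp.notMem_support_iff.1 hi

theorem rowExp_bot : rowExp ⊥ = 0 := by
  rw [← Finsupp.degree_eq_zero_iff, degree_rowExp]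
  rfl

theorem eq_bot_of_card_eq_zero {μ : YoungDiagram} (h : μ.card = 0) : μ = ⊥ := by
  apply rowExp_injective
  rw [rowExp_bot, ← Finsupp.degree_eq_zero_iff, degree_rowExp, h]

theorem card_bot : (⊥ : YoungDiagram).card = 0 := rfl

theorem exists_rowLen_eq {a : ℕ → ℕ} (ha : Antitone a) {n : ℕ} (hn : ∀ i, n ≤ i → a i = 0) :
    ∃ μ : YoungDiagram, ∀ i, μ.rowLen i = a i := by
  refine ⟨⟨(Finset.range n ×ˢ Finset.range (a 0)).filter fun c => c.2 < a c.1, ?_⟩, fun i => ?_⟩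
  · rintro ⟨i, j⟩ ⟨i', j'⟩ ⟨h1, h2⟩ h
    simp only [Finset.coe_filter, Finset.mem_product, Finset.mem_range, Set.mem_ofPred_eq] at h ⊢
    dsimp only at h1 h2
    have := ha h1
    omega
  · refine eq_of_forall_lt_iff fun j => ?_
    rw [← YoungDiagram.mem_iff_lt_rowLen]
    change (i, j) ∈ (Finset.range n ×ˢ Finset.range (a 0)).filter (fun c => c.2 < a c.1) ↔ _
    rw [Finset.mem_filter, Finset.mem_product, Finset.mem_range, Finset.mem_range]
    refine ⟨fun h => h.2, fun h => ⟨⟨?_, h.trans_le (ha (Nat.zero_le i))⟩, h⟩⟩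
    by_contra hi
    have := hn i (not_lt.1 hi)
    omega

theorem exists_embDomain_rowExp (g : ℕ →₀ ℕ) :
    ∃ (p : Equiv.Perm ℕ) (μ : YoungDiagram), (rowExp μ).embDomain p.toEmbedding = g := by
  obtain ⟨n, hn⟩ : ∃ n, ∀ i, n ≤ i → g i = 0 := by
    refine ⟨g.support.sup id + 1, fun i hi => ?_⟩
    by_contra h
    have := Finset.le_sup (f := id) (Finsupp.mem_support_iff.2 h)
    simp only [id] at this
    omega
  -- The order dual makes `Tuple.sort` arrange the exponents in decreasing order.
  let f : Fin n → ℕᵒᵈ := fun i => OrderDual.toDual (g i)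
  let q : Equiv.Perm (Fin n) := Tuple.sort f
  have hq : Monotone (f ∘ q) := Tuple.monotone_sort f
  let p : Equiv.Perm ℕ := q.extendDomain Fin.equivSubtype
  have hp1 : ∀ i : Fin n, p i = q i := fun i => Equiv.Perm.extendDomain_apply_image q _ i
  have hp2 : ∀ i, n ≤ i → p i = i := fun i hi =>
    Equiv.Perm.extendDomain_apply_not_subtype q _ (not_lt.2 hi)
  have ha : Antitone fun i => g (p i) := by
    intro i j hij
    dsimp only
    rcases lt_or_ge j n with hj | hj
    · have := hq (show (⟨i, hij.trans_lt hj⟩ : Fin n) ≤ ⟨j, hj⟩ from hij)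
      have h1 := hp1 ⟨i, hij.trans_lt hj⟩
      have h2 := hp1 ⟨j, hj⟩
      dsimp only at h1 h2
      rw [h1, h2]
      exact this
    · rw [hp2 j hj, hn j hj]
      exact Nat.zero_le _
  obtain ⟨μ, hμ⟩ := exists_rowLen_eq ha (n := n) fun i hi => by rw [hp2 i hi, hn i hi]
  refine ⟨p, μ, Finsupp.ext fun i => ?_⟩
  obtain ⟨j, rfl⟩ := p.surjective i
  exact (Finsupp.embDomain_apply_self p.toEmbedding _ j).trans (hμ j)

end Young

/-! ### The Kostka numbers -/

section Kostka

variable {ι : Type*}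

/-- The inclusion of the alphabet of `U`. -/
def blockEmb (U : ι) : ℕ ↪ ι × ℕ := ⟨fun i => (U, i), fun _ _ h => congrArg Prod.snd h⟩

/-- The coefficient of the Schur function `s_λ^{(U)}` at `∏_i x_{U, i} ^ {μ_i}`. -/
def kostka (U : ι) (lam μ : YoungDiagram) : ℤ :=
  MvPowerSeries.coeff ((rowExp μ).embDomain (blockEmb U)) (schur lam U)

/-- The action of a permutation of `ℕ` on the alphabet of `U`. -/
theorem embDomain_blockEmb_embDomain (U : ι) (p : Equiv.Perm ℕ) (g : ℕ →₀ ℕ) :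
    (g.embDomain p.toEmbedding).embDomain (blockEmb U) =
      (g.embDomain (blockEmb U)).embDomain
        (Equiv.prodCongr (Equiv.refl ι) p : Equiv.Perm (ι × ℕ)).toEmbedding := by
  rw [← Finsupp.embDomain_trans_apply, ← Finsupp.embDomain_trans_apply]
  rfl

theorem restrict_hsum_eq_completeSum (U : ι) (n : ℕ) (k : ℤ) :
    (restrict (Fin.valEmbedding.trans (blockEmb U))).hom ℤ (hsum k U) =
      completeSum (Finset.univ : Finset (Fin n)) k := by
  classical
  refine MvPowerSeries.ext fun m => ?_
  rw [coeff_restrict, coeff_completeSum]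
  refine if_congr ?_ rfl rfl
  rw [degree_embDomain, Finsupp.support_embDomain]
  refine and_congr_right fun _ => ?_
  simp only [Finset.subset_univ, iff_true, Finset.mem_map]
  rintro _ ⟨i, _, rfl⟩
  rfl

/-- Enlarging the determinant to `n` rows adds rows of length zero only. Their diagonal block is
unitriangular and the block to its left vanishes, so the determinant is unchanged. -/
theorem restrict_schur_eq_jacobiTrudi (U : ι) {n : ℕ} (μ : YoungDiagram) (hn : μ.colLen 0 ≤ n) :
    (restrict ((Fin.valEmbedding : Fin n ↪ ℕ).trans (blockEmb U))).hom ℤ (schur μ U) =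
      jacobiTrudi fun i : Fin n => μ.rowLen i := by
  obtain ⟨k, rfl⟩ := Nat.exists_eq_add_of_le hn
  unfold schur jacobiTrudi
  rw [RingHom.map_det]
  generalize hc : μ.colLen 0 = c at *
  rw [← Matrix.det_submatrix_equiv_self (finSumFinEquiv (m := c) (n := k))
    (Matrix.of fun i j : Fin (c + k) => _)]
  have hblock : (Matrix.of fun i j : Fin (c + k) => completeSum (Finset.univ : Finset (Fin (c + k)))
      ((μ.rowLen i : ℤ) - ((i : ℕ) : ℤ) + ((j : ℕ) : ℤ))).submatrix finSumFinEquiv finSumFinEquiv =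
      Matrix.fromBlocks
        (Matrix.of fun i j : Fin c => completeSum (Finset.univ : Finset (Fin (c + k)))
          ((μ.rowLen i : ℤ) - ((i : ℕ) : ℤ) + ((j : ℕ) : ℤ)))
        (Matrix.of fun (i : Fin c) (j : Fin k) => completeSum (Finset.univ : Finset (Fin (c + k)))
          ((μ.rowLen i : ℤ) - ((i : ℕ) : ℤ) + ((c + j : ℕ) : ℤ)))
        0
        (Matrix.of fun i j : Fin k => completeSum (Finset.univ : Finset (Fin (c + k)))
          (((j : ℕ) : ℤ) - ((i : ℕ) : ℤ))) := by
    ext1 i j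
    rcases i with i | i <;> rcases j with j | j
    · simp [Fin.val_castAdd]
    · simp [Fin.val_castAdd, Fin.val_natAdd]
    · rw [Matrix.fromBlocks_apply₂₁, Matrix.submatrix_apply, Matrix.of_apply, Matrix.zero_apply]
      refine completeSum_of_neg _ ?_
      simp only [finSumFinEquiv_apply_left, finSumFinEquiv_apply_right, Fin.val_castAdd,
        Fin.val_natAdd]
      rw [rowLen_eq_zero μ (by omega)]
      have := j.2
      push_cast
      omega
    · rw [Matrix.fromBlocks_apply₂₂, Matrix.submatrix_apply, Matrix.of_apply, Matrix.of_apply]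
      simp only [finSumFinEquiv_apply_right, Fin.val_natAdd]
      rw [rowLen_eq_zero μ (by omega)]
      congr 1
      push_cast
      ring
  rw [hblock, Matrix.det_fromBlocks_zero₂₁]
  have h1 : (Matrix.of fun i j : Fin k => completeSum (Finset.univ : Finset (Fin (c + k)))
      (((j : ℕ) : ℤ) - ((i : ℕ) : ℤ))).det = 1 := by
    rw [Matrix.det_of_isUpperTriangular]
    · exact Finset.prod_eq_one fun i _ => by simp [completeSum_zero]
    · intro i j hij
      have hij : (j : ℕ) < i := hij
      rw [Matrix.of_apply]
      exact completeSum_of_neg _ (by omega)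
  rw [h1, mul_one]
  congr 1
  ext1 i j
  exact restrict_hsum_eq_completeSum U _ _

theorem exists_coeff_schur_eq_kostka (U : ι) (g : ℕ →₀ ℕ) :
    ∃ μ : YoungDiagram, μ.card = g.degree ∧
      ∀ lam, MvPowerSeries.coeff (g.embDomain (blockEmb U)) (schur lam U) = kostka U lam μ := by
  obtain ⟨p, μ, rfl⟩ := exists_embDomain_rowExp g
  refine ⟨μ, by rw [degree_embDomain, degree_rowExp], fun lam => ?_⟩
  rw [embDomain_blockEmb_embDomain]
  exact coeff_embDomain_schur (by intro v; rfl) _ _ _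

/-- A diagram with `d` cells has at most `d` rows, so `d` variables suffice. In
`sum_sign_mul_coeff_jacobiTrudi` each exponent `ν + δ - w(δ)` is replaced by its sorted
rearrangement `μ`, and the signs of the `w` leading to `μ` are collected into `L μ ν`. -/
theorem exists_kostka_inverse (U : ι) (d : ℕ) :
    ∃ L : YoungDiagram → YoungDiagram → ℤ, ∀ lam ν : YoungDiagram, lam.card = d → ν.card = d →
      ∑ μ ∈ diagrams d, kostka U lam μ * L μ ν = open scoped Classical in if lam = ν then 1 else 0 := by
  classical
  have hs : ∀ g : Fin d →₀ ℕ, ∃ μ : YoungDiagram, μ.card = g.degree ∧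
      ∀ lam : YoungDiagram, lam.card = d →
        MvPowerSeries.coeff g (jacobiTrudi fun i : Fin d => lam.rowLen i) = kostka U lam μ := by
    intro g
    obtain ⟨μ, h1, h2⟩ := exists_coeff_schur_eq_kostka U (g.embDomain Fin.valEmbedding)
    refine ⟨μ, by rw [h1, degree_embDomain], fun lam hlam => ?_⟩
    rw [← restrict_schur_eq_jacobiTrudi U lam (hlam ▸ colLen_zero_le_card lam), coeff_restrict,
      Finsupp.embDomain_trans_apply, h2]
  choose s hs1 hs2 using hs
  refine ⟨fun μ ν => ∑ w : Equiv.Perm (Fin d), (Equiv.Perm.sign w : ℤ) *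
    (if ShiftAdmissible (fun i : Fin d => ν.rowLen i) w then
      (if s (shiftedExponent (fun i : Fin d => ν.rowLen i) w) = μ then 1 else 0) else 0),
    fun lam ν hlam hν => ?_⟩
  have hanti : ∀ κ : YoungDiagram, Antitone fun i : Fin d => κ.rowLen i := fun κ i j hij =>
    κ.rowLen_anti _ _ hij
  have hiff : ((fun i : Fin d => lam.rowLen i) = fun i : Fin d => ν.rowLen i) ↔ lam = ν := by
    refine ⟨fun h => eq_of_rowLen_eq fun i => ?_, fun h => by rw [h]⟩
    rcases lt_or_ge i d with hi | hi
    · exact congrFun h ⟨i, hi⟩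
    · rw [rowLen_eq_zero lam ((colLen_zero_le_card lam).trans (hlam ▸ hi)),
        rowLen_eq_zero ν ((colLen_zero_le_card ν).trans (hν ▸ hi))]
  rw [← if_congr hiff rfl rfl, ← sum_sign_mul_coeff_jacobiTrudi (hanti lam) (hanti ν)]
  simp only [Finset.mul_sum]
  rw [Finset.sum_comm]
  refine Finset.sum_congr rfl fun w _ => ?_
  split_ifs with hw
  · rw [hs2 _ lam hlam, Finset.sum_eq_single (s (shiftedExponent (fun i : Fin d => ν.rowLen i) w))]
    · rw [if_pos rfl, mul_one, mul_comm]
    · intro μ _ hμ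
      rw [if_neg (Ne.symm hμ), mul_zero, mul_zero]
    · intro h
      refine absurd (mem_diagrams.2 ?_) h
      rw [hs1, degree_shiftedExponent hw, Fin.sum_univ_eq_sum_range (fun i => ν.rowLen i),
        ← card_eq_sum_rowLen ν ((colLen_zero_le_card ν).trans hν.le), hν]
  · simp

end Kostka

end

end LimGroth

/-! ### Multipartitions, block systems, and the elements `Z_λ` -/

namespace LimGroth

open Finset.HasAntidiagonal (antidiagonal mem_antidiagonal)

noncomputable section

set_option linter.unusedSectionVars false

/-! ### Products of Schur functions in different alphabets -/

section Pure

variable {ι : Type*}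

/-- A homogeneous power series of degree `k` in the alphabet of `U`. -/
def IsPure (U : ι) (k : ℤ) (f : MvPowerSeries (ι × ℕ) ℤ) : Prop :=
  ∀ m, MvPowerSeries.coeff m f ≠ 0 → (m.degree : ℤ) = k ∧ ∀ v ∈ m.support, v.1 = U

theorem IsPure.one (U : ι) : IsPure U 0 1 := by
  classical
  intro m hm
  rw [MvPowerSeries.coeff_one] at hm
  obtain rfl : m = 0 := by
    by_contra h
    exact hm (if_neg h)
  simp

theorem IsPure.mul {U : ι} {j k : ℤ} {f g : MvPowerSeries (ι × ℕ) ℤ} (hf : IsPure U j f)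
    (hg : IsPure U k g) : IsPure U (j + k) (f * g) := by
  classical
  intro m hm
  rw [MvPowerSeries.coeff_mul] at hm
  obtain ⟨p, hp, hne⟩ := Finset.exists_ne_zero_of_sum_ne_zero hm
  obtain ⟨h1, h2⟩ := hf p.1 (left_ne_zero_of_mul hne)
  obtain ⟨h3, h4⟩ := hg p.2 (right_ne_zero_of_mul hne)
  rw [mem_antidiagonal] at hp
  subst hp
  refine ⟨by rw [map_add]; push_cast; omega, fun v hv => ?_⟩
  rcases Finset.mem_union.1 (Finsupp.support_add hv) with h | h
  · exact h2 v h
  · exact h4 v h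

theorem IsPure.prod {U : ι} {κ : Type*} (s : Finset κ) {k : κ → ℤ}
    {f : κ → MvPowerSeries (ι × ℕ) ℤ} (hf : ∀ i ∈ s, IsPure U (k i) (f i)) :
    IsPure U (∑ i ∈ s, k i) (∏ i ∈ s, f i) := by
  classical
  induction s using Finset.induction_on with
  | empty => simpa using IsPure.one U
  | insert a s ha ih =>
    rw [Finset.sum_insert ha, Finset.prod_insert ha]
    exact (hf a (Finset.mem_insert_self _ _)).mul
      (ih fun i hi => hf i (Finset.mem_insert_of_mem hi))

theorem IsPure.intCast_mul {U : ι} {k : ℤ} {f : MvPowerSeries (ι × ℕ) ℤ} (hf : IsPure U k f)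
    (c : ℤ) : IsPure U k ((c : MvPowerSeries (ι × ℕ) ℤ) * f) := by
  intro m hm
  rw [coeff_intCast_mul] at hm
  exact hf m (right_ne_zero_of_mul hm)

theorem IsPure.sum {U : ι} {k : ℤ} {κ : Type*} (s : Finset κ) {f : κ → MvPowerSeries (ι × ℕ) ℤ}
    (hf : ∀ i ∈ s, IsPure U k (f i)) : IsPure U k (∑ i ∈ s, f i) := by
  intro m hm
  rw [map_sum] at hm
  obtain ⟨i, hi, hne⟩ := Finset.exists_ne_zero_of_sum_ne_zero hm
  exact hf i hi m hne

theorem isPure_hsum (k : ℤ) (U : ι) : IsPure U k (hsum k U) := by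
  classical
  intro m hm
  by_contra h
  exact hm (if_neg h)

theorem isPure_schur (μ : YoungDiagram) (U : ι) : IsPure U μ.card (schur μ U) := by
  unfold schur
  rw [Matrix.det_apply']
  refine IsPure.sum _ fun w _ => IsPure.intCast_mul ?_ _
  have h := IsPure.prod (U := U) Finset.univ (fun (i : Fin (μ.colLen 0)) _ =>
    isPure_hsum ((μ.rowLen (w i : ℕ) : ℤ) - ((w i : ℕ) : ℤ) + ((i : ℕ) : ℤ)) U)
  have hdeg : ∑ i : Fin (μ.colLen 0),
      ((μ.rowLen (w i : ℕ) : ℤ) - ((w i : ℕ) : ℤ) + ((i : ℕ) : ℤ)) = μ.card := by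
    rw [Finset.sum_add_distrib, Finset.sum_sub_distrib,
      Equiv.sum_comp w (fun i : Fin (μ.colLen 0) => (μ.rowLen i : ℤ)),
      Equiv.sum_comp w (fun i : Fin (μ.colLen 0) => ((i : ℕ) : ℤ)), sub_add_cancel,
      card_eq_sum_rowLen μ le_rfl, ← Fin.sum_univ_eq_sum_range]
    push_cast
    rfl
  rw [hdeg] at h
  exact h

theorem schur_bot (U : ι) : schur ⊥ U = 1 := by
  have : IsEmpty (Fin ((⊥ : YoungDiagram).colLen 0)) := by
    rw [Nat.le_zero.1 (colLen_zero_le_card ⊥)]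
    infer_instance
  exact Matrix.det_isEmpty

-- The factors live in disjoint alphabets, so the only factorization of the monomial that
-- contributes is the one into its parts in the separate alphabets.
open scoped Classical in
theorem coeff_prod_of_isPure (s : Finset ι) {k : ι → ℤ} {f : ι → MvPowerSeries (ι × ℕ) ℤ}
    (hf : ∀ U ∈ s, IsPure U (k U) (f U)) {m : ι × ℕ →₀ ℕ} (hm : ∀ v ∈ m.support, v.1 ∈ s) :
    MvPowerSeries.coeff m (∏ U ∈ s, f U) =
      ∏ U ∈ s, MvPowerSeries.coeff (m.filter fun v => v.1 = U) (f U) := by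
  have h0 : ∀ U, U ∉ s → (m.filter fun v => v.1 = U) = 0 := by
    intro U hU
    ext v
    rw [Finsupp.filter_apply]
    split_ifs with h
    · by_contra hv
      exact hU (h ▸ hm v (Finsupp.mem_support_iff.2 hv))
    · rfl
  let l₀ : ι →₀ (ι × ℕ →₀ ℕ) := Finsupp.onFinset s (fun U => m.filter fun v => v.1 = U)
    fun U h => by
      by_contra hU
      exact h (h0 U hU)
  rw [MvPowerSeries.coeff_prod, Finset.sum_eq_single l₀]
  · rfl
  · intro l hl hne
    by_contra hprod
    refine hne ?_
    rw [Finset.mem_finsuppAntidiag] at hl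
    obtain ⟨hsum, hsupp⟩ := hl
    have hpure : ∀ U ∈ s, ∀ v, v.1 ≠ U → l U v = 0 := by
      intro U hU v hv
      by_contra h
      exact hv ((hf U hU (l U) (Finset.prod_ne_zero_iff.1 hprod U hU)).2 v
        (Finsupp.mem_support_iff.2 h))
    ext1 U
    by_cases hU : U ∈ s
    · ext v
      change l U v = (m.filter fun v => v.1 = U) v
      rw [Finsupp.filter_apply]
      split_ifs with h
      · rw [← hsum, Finsupp.finsetSum_apply, Finset.sum_eq_single_of_mem U hU]
        intro U' hU' hne'
        exact hpure U' hU' v (by rw [h]; exact hne'.symm)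
      · exact hpure U hU v h
    · rw [Finsupp.notMem_support_iff.1 fun h => hU (hsupp h)]
      exact (h0 U hU).symm
  · intro h
    refine absurd ?_ h
    rw [Finset.mem_finsuppAntidiag]
    refine ⟨?_, Finsupp.support_onFinset_subset⟩
    ext v
    rw [Finsupp.finsetSum_apply]
    change ∑ U ∈ s, (m.filter fun v => v.1 = U) v = m v
    simp only [Finsupp.filter_apply]
    rw [Finset.sum_ite_eq]
    split_ifs with hv
    · rfl
    · by_contra hne
      exact hv (hm v (Finsupp.mem_support_iff.2 (Ne.symm hne)))

end Pure

section Multi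

variable {ι : Type*}

/-- The sizes of the components of a multipartition. -/
def Multipartition.size (lam : Multipartition ι) (U : ι) : ℕ := (lam.1 U).card

/-- The set of indices of the nonempty components of a multipartition. -/
def Multipartition.supp (lam : Multipartition ι) : Finset ι := lam.2.toFinset

theorem Multipartition.mem_supp {lam : Multipartition ι} {U : ι} :
    U ∈ lam.supp ↔ lam.size U ≠ 0 := by
  simp [supp, size]

theorem Multipartition.supp_congr {lam μ : Multipartition ι} (h : lam.size = μ.size) :
    lam.supp = μ.supp := by
  ext U
  rw [mem_supp, mem_supp, h]

theorem Multipartition.apply_of_notMem {lam : Multipartition ι} {U : ι} (h : U ∉ lam.supp) :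
    lam.1 U = ⊥ := by
  rw [mem_supp, not_not] at h
  exact eq_bot_of_card_eq_zero h

/-- The exponent of `∏_{U, i} x_{U, i} ^ {μ(U)_i}`. -/
def Multipartition.exponent (μ : Multipartition ι) : ι × ℕ →₀ ℕ :=
  Finsupp.ofSupportFinite (fun v => (μ.1 v.1).rowLen v.2) <| by
    refine (μ.supp.finite_toSet.biUnion fun U _ =>
      ((rowExp (μ.1 U)).support.finite_toSet.image (blockEmb U))).subset ?_
    rintro ⟨U, i⟩ h
    have h : (μ.1 U).rowLen i ≠ 0 := h
    simp only [Set.mem_iUnion, exists_prop]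
    refine ⟨U, ?_, i, Finsupp.mem_support_iff.2 h, rfl⟩
    by_contra hU
    rw [Finset.mem_coe] at hU
    rw [μ.apply_of_notMem hU] at h
    exact h (DFunLike.congr_fun rowExp_bot i)

theorem Multipartition.exponent_apply (μ : Multipartition ι) (v : ι × ℕ) :
    μ.exponent v = (μ.1 v.1).rowLen v.2 := rfl

theorem Multipartition.fst_mem_supp (μ : Multipartition ι) {v : ι × ℕ}
    (hv : v ∈ μ.exponent.support) : v.1 ∈ μ.supp := by
  by_contra hU
  rw [Finsupp.mem_support_iff, exponent_apply, μ.apply_of_notMem hU] at hv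
  exact hv (DFunLike.congr_fun rowExp_bot v.2)

open scoped Classical in
theorem Multipartition.filter_exponent (μ : Multipartition ι) (U : ι) :
    (μ.exponent.filter fun v => v.1 = U) = (rowExp (μ.1 U)).embDomain (blockEmb U) := by
  ext ⟨V, i⟩
  rw [Finsupp.filter_apply]
  split_ifs with h
  · dsimp only at h
    subst h
    exact (Finsupp.embDomain_apply_self (blockEmb V) (rowExp (μ.1 V)) i).symm
  · rw [Finsupp.embDomain_of_notMem_range]
    rintro ⟨j, hj⟩
    exact h (congrArg Prod.fst hj).symm

theorem exists_embDomain_exponent (m : ι × ℕ →₀ ℕ) :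
    ∃ (e : Equiv.Perm (ι × ℕ)) (μ : Multipartition ι), (∀ v, (e v).1 = v.1) ∧
      μ.exponent.embDomain e.toEmbedding = m := by
  have h := fun U : ι =>
    exists_embDomain_rowExp (m.comapDomain (blockEmb U) (blockEmb U).injective.injOn)
  choose p μ hμ using h
  refine ⟨Equiv.prodShear (Equiv.refl ι) p, ⟨μ, ?_⟩, fun v => rfl, ?_⟩
  · refine (m.support.finite_toSet.image Prod.fst).subset fun U hU => ?_
    have hU : (μ U).card ≠ 0 := hU
    rw [← degree_rowExp, ← degree_embDomain (p U).toEmbedding, hμ, Ne, Finsupp.degree_eq_zero_iff,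
      DFunLike.ext_iff, not_forall] at hU
    obtain ⟨i, hi⟩ := hU
    exact ⟨(U, i), Finset.mem_coe.2 (Finsupp.mem_support_iff.2 hi), rfl⟩
  · ext v
    obtain ⟨⟨U, i⟩, rfl⟩ := (Equiv.prodShear (Equiv.refl ι) p).surjective v
    refine (Finsupp.embDomain_apply_self (Equiv.prodShear (Equiv.refl ι) p).toEmbedding
      _ (U, i)).trans ?_
    have h := DFunLike.congr_fun (hμ U) (p U i)
    exact (Finsupp.embDomain_apply_self (p U).toEmbedding _ i).symm.trans h

theorem schurProd_eq_prod (lam : Multipartition ι) {s : Finset ι} (hs : lam.supp ⊆ s) :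
    schurProd lam = ∏ U ∈ s, schur (lam.1 U) U :=
  Finset.prod_subset hs fun U _ hU => by rw [lam.apply_of_notMem hU, schur_bot]

theorem coeff_exponent_schurProd (lam μ : Multipartition ι) {s : Finset ι} (hs : lam.supp ⊆ s)
    (hs' : μ.supp ⊆ s) : MvPowerSeries.coeff μ.exponent (schurProd lam) =
      ∏ U ∈ s, kostka U (lam.1 U) (μ.1 U) := by
  classical
  rw [schurProd_eq_prod lam hs, coeff_prod_of_isPure s (fun U _ => isPure_schur (lam.1 U) U)
    fun v hv => hs' (μ.fst_mem_supp hv)]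
  exact Finset.prod_congr rfl fun U _ => by rw [μ.filter_exponent]; rfl

theorem card_eq_of_kostka_ne_zero {U : ι} {lam μ : YoungDiagram} (h : kostka U lam μ ≠ 0) :
    lam.card = μ.card := by
  have := (isPure_schur lam U _ h).1
  rw [degree_embDomain, degree_rowExp] at this
  exact_mod_cast this.symm

/-- Hence the infinite linear system for the `Z_λ` splits into finite blocks, one for each
prescribed family of component sizes. -/
theorem size_eq_of_coeff_ne_zero {lam μ : Multipartition ι}
    (h : MvPowerSeries.coeff μ.exponent (schurProd lam) ≠ 0) : lam.size = μ.size := by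
  classical
  rw [coeff_exponent_schurProd lam μ Finset.subset_union_left Finset.subset_union_right,
    Finset.prod_ne_zero_iff] at h
  funext U
  by_cases hU : U ∈ lam.supp ∪ μ.supp
  · exact card_eq_of_kostka_ne_zero (h U hU)
  · rw [Finset.mem_union, not_or, Multipartition.mem_supp, Multipartition.mem_supp, not_not,
      not_not] at hU
    rw [hU.1, hU.2]

open scoped Classical in
/-- Extension of a family of Young diagrams by empty ones. -/
def Multipartition.extend (s : Finset ι) (x : s → YoungDiagram) : Multipartition ι :=
  ⟨fun U => if h : U ∈ s then x ⟨U, h⟩ else ⊥, s.finite_toSet.subset fun U hU => by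
    by_contra h
    exact hU (congrArg YoungDiagram.card (dif_neg h))⟩

theorem Multipartition.extend_apply (s : Finset ι) (x : s → YoungDiagram) (U : s) :
    (extend s x).1 U = x U := dif_pos U.2

theorem Multipartition.extend_injective (s : Finset ι) :
    Function.Injective (extend s) := fun x y h => by
  funext U
  rw [← extend_apply s x, ← extend_apply s y, h]

theorem Multipartition.extend_restrict (μ : Multipartition ι) {s : Finset ι} (hs : μ.supp ⊆ s) :
    extend s (fun U => μ.1 U) = μ := by
  refine Subtype.ext (funext fun U => ?_)
  by_cases hU : U ∈ s
  · exact extend_apply s _ ⟨U, hU⟩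
  · rw [μ.apply_of_notMem fun h => hU (hs h)]
    exact dif_neg hU

open scoped Classical in
/-- The multipartitions with components of the same sizes as those of `ν`. -/
def Multipartition.block (ν : Multipartition ι) : Finset (Multipartition ι) :=
  (Fintype.piFinset fun U : ν.supp => diagrams (ν.size U)).image (extend ν.supp)

theorem Multipartition.mem_block {μ ν : Multipartition ι} : μ ∈ ν.block ↔ μ.size = ν.size := by
  classical
  simp only [block, Finset.mem_image, Fintype.mem_piFinset, mem_diagrams]
  constructor
  · rintro ⟨x, hx, rfl⟩
    funext U
    by_cases hU : U ∈ ν.supp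
    · exact (congrArg YoungDiagram.card (extend_apply ν.supp x ⟨U, hU⟩)).trans (hx ⟨U, hU⟩)
    · rw [mem_supp, not_not] at hU
      rw [hU]
      refine (congrArg YoungDiagram.card (dif_neg ?_)).trans card_bot
      rw [mem_supp, not_not, hU]
  · intro h
    exact ⟨fun U => μ.1 U, fun U => congrFun h U, μ.extend_restrict (supp_congr h).le⟩

/-- On a block the coefficient matrix is the tensor product of the Kostka matrices of the nonempty
components, so the product of their inverses inverts it. -/
theorem exists_schurProd_inverse (ι : Type*) : ∃ L : Multipartition ι → Multipartition ι → ℤ,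
    ∀ lam ν : Multipartition ι, lam.size = ν.size →
      ∑ μ ∈ ν.block, MvPowerSeries.coeff μ.exponent (schurProd lam) * L μ ν =
        open scoped Classical in if lam = ν then 1 else 0 := by
  classical
  choose L hL using fun (U : ι) (d : ℕ) => exists_kostka_inverse U d
  refine ⟨fun μ ν => ∏ U ∈ ν.supp, L U (ν.size U) (μ.1 U) (ν.1 U), fun lam ν h => ?_⟩
  have h1 : ∀ μ ∈ ν.block, MvPowerSeries.coeff μ.exponent (schurProd lam) *
      ∏ U ∈ ν.supp, L U (ν.size U) (μ.1 U) (ν.1 U) =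
      ∏ U : ν.supp, kostka U.1 (lam.1 U) (μ.1 U) * L U (ν.size U) (μ.1 U) (ν.1 U) := by
    intro μ hμ
    rw [coeff_exponent_schurProd lam μ (Multipartition.supp_congr h).le
      (Multipartition.supp_congr (Multipartition.mem_block.1 hμ)).le, ← Finset.prod_mul_distrib]
    exact (Finset.prod_coe_sort ν.supp fun U =>
      kostka U (lam.1 U) (μ.1 U) * L U (ν.size U) (μ.1 U) (ν.1 U)).symm
  rw [Finset.sum_congr rfl h1, Multipartition.block,
    Finset.sum_image (Multipartition.extend_injective _).injOn]
  simp only [Multipartition.extend_apply]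
  rw [← Finset.prod_univ_sum (fun U : ν.supp => diagrams (ν.size U)) fun U μ =>
    kostka U.1 (lam.1 U) μ * L U (ν.size U) μ (ν.1 U)]
  rw [Finset.prod_congr rfl fun (U : ν.supp) _ => hL U.1 (ν.size U) (lam.1 U) (ν.1 U) (congrFun h U) rfl,
    Finset.prod_ite_zero, Finset.prod_const_one]
  refine ite_congr (propext ⟨fun hU => ?_, fun hU U _ => by rw [hU]⟩) (fun _ => rfl) fun _ => rfl
  exact (lam.extend_restrict (Multipartition.supp_congr h).le).symm.trans
    ((congrArg (Multipartition.extend ν.supp) (funext fun U => hU U (Finset.mem_univ U))).trans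
      (ν.extend_restrict le_rfl))

end Multi

/-! ### Infinite systems of linear equations with finite invertible blocks -/

section BlockSystem

variable {Λ τ M : Type*} [AddCommGroup M] {t : Λ → τ} {B : Λ → Finset Λ} {K L : Λ → Λ → ℤ}

-- Each block is a finite square matrix over a commutative ring, for which a right inverse is also a
-- left inverse.
open scoped Classical in
theorem block_inverse_comm (hB : ∀ μ ν, μ ∈ B ν ↔ t μ = t ν)
    (h : ∀ lam ν, t lam = t ν → ∑ μ ∈ B ν, K lam μ * L μ ν = if lam = ν then 1 else 0)
    {lam ν : Λ} (hν : t lam = t ν) :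
    ∑ μ ∈ B ν, L lam μ * K μ ν = if lam = ν then 1 else 0 := by
  have hB' : ∀ μ, t μ = t ν → B μ = B ν := fun μ hμ => by
    ext x; rw [hB, hB, hμ]
  let K' : Matrix (B ν) (B ν) ℤ := Matrix.of fun i j => K i j
  let L' : Matrix (B ν) (B ν) ℤ := Matrix.of fun i j => L i j
  have h1 : K' * L' = 1 := by
    ext i j
    rw [Matrix.mul_apply, Matrix.one_apply]
    have hj := (hB _ _).1 j.2
    refine (Finset.sum_coe_sort (B ν) fun μ => K i μ * L μ j).trans ?_
    refine (congrArg (fun s => ∑ μ ∈ s, K i μ * L μ j) (hB' _ hj).symm).trans ?_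
    rw [h _ _ (((hB _ _).1 i.2).trans hj.symm)]
    exact if_congr Subtype.ext_iff.symm rfl rfl
  have h1' : L' * K' = 1 := mul_eq_one_comm.1 h1
  have h2 := congrFun (congrFun h1' ⟨lam, (hB _ _).2 hν⟩) ⟨ν, (hB _ _).2 rfl⟩
  rw [Matrix.mul_apply, Matrix.one_apply] at h2
  refine ((Finset.sum_coe_sort (B ν) fun μ => L lam μ * K μ ν).symm.trans h2).trans ?_
  exact if_congr Subtype.ext_iff rfl rfl

open scoped Classical in
theorem block_system_apply (hB : ∀ μ ν, μ ∈ B ν ↔ t μ = t ν)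
    (h : ∀ lam ν, t lam = t ν → ∑ μ ∈ B ν, K lam μ * L μ ν = if lam = ν then 1 else 0)
    (F : Λ → M) (ν : Λ) :
    ∑ lam ∈ B ν, K lam ν • ∑ μ ∈ B lam, L μ lam • F μ = F ν := by
  have hB' : ∀ μ, t μ = t ν → B μ = B ν := fun μ hμ => by
    ext x; rw [hB, hB, hμ]
  have h1 : ∀ lam ∈ B ν, K lam ν • ∑ μ ∈ B lam, L μ lam • F μ =
      ∑ μ ∈ B ν, (L μ lam * K lam ν) • F μ := by
    intro lam hlam
    rw [hB' lam ((hB _ _).1 hlam), Finset.smul_sum]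
    exact Finset.sum_congr rfl fun μ _ => by rw [smul_smul, mul_comm]
  rw [Finset.sum_congr rfl h1, Finset.sum_comm]
  simp only [← Finset.sum_smul]
  rw [Finset.sum_congr rfl fun μ hμ => by rw [block_inverse_comm hB h ((hB _ _).1 hμ)],
    Finset.sum_eq_single_of_mem ν ((hB _ _).2 rfl)]
  · simp
  · intro μ _ hμ
    rw [if_neg hμ, zero_smul]

open scoped Classical in
theorem block_system_unique (hB : ∀ μ ν, μ ∈ B ν ↔ t μ = t ν)
    (h : ∀ lam ν, t lam = t ν → ∑ μ ∈ B ν, K lam μ * L μ ν = if lam = ν then 1 else 0)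
    {F Z : Λ → M} (hZ : ∀ μ, ∑ lam ∈ B μ, K lam μ • Z lam = F μ) (ν : Λ) :
    Z ν = ∑ μ ∈ B ν, L μ ν • F μ := by
  have hB' : ∀ μ, t μ = t ν → B μ = B ν := fun μ hμ => by
    ext x; rw [hB, hB, hμ]
  have h1 : ∀ μ ∈ B ν, L μ ν • F μ = ∑ lam ∈ B ν, (K lam μ * L μ ν) • Z lam := by
    intro μ hμ
    rw [← hZ, hB' μ ((hB _ _).1 hμ), Finset.smul_sum]
    exact Finset.sum_congr rfl fun lam _ => by rw [smul_smul, mul_comm]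
  rw [Finset.sum_congr rfl h1, Finset.sum_comm]
  simp only [← Finset.sum_smul]
  rw [Finset.sum_congr rfl fun lam hlam => by rw [h lam ν ((hB _ _).1 hlam)],
    Finset.sum_eq_single_of_mem ν ((hB _ _).2 rfl)]
  · simp
  · intro lam _ hlam
    rw [if_neg hlam, zero_smul]

-- Both the matrix and its inverse have integer entries, which is why solutions and right-hand sides
-- span the same `ℤ`-module.
open scoped Classical in
theorem block_system_existsUnique (hB : ∀ μ ν, μ ∈ B ν ↔ t μ = t ν)
    (h : ∀ lam ν, t lam = t ν → ∑ μ ∈ B ν, K lam μ * L μ ν = if lam = ν then 1 else 0)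
    (F : Λ → M) : ∃ Z : Λ → M, (∀ μ, ∑ lam ∈ B μ, K lam μ • Z lam = F μ) ∧
      (∀ Z' : Λ → M, (∀ μ, ∑ lam ∈ B μ, K lam μ • Z' lam = F μ) → Z' = Z) ∧
      Submodule.span ℤ (Set.range Z) = Submodule.span ℤ (Set.range F) := by
  have hZ := block_system_apply hB h F
  refine ⟨fun ν => ∑ μ ∈ B ν, L μ ν • F μ, hZ,
    fun Z' hZ' => funext (block_system_unique hB h hZ'), le_antisymm (Submodule.span_le.2 ?_)
      (Submodule.span_le.2 ?_)⟩
  · rintro _ ⟨ν, rfl⟩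
    exact sum_mem fun μ _ => Submodule.smul_mem _ _ (Submodule.subset_span ⟨_, rfl⟩)
  · rintro _ ⟨ν, rfl⟩
    rw [← hZ ν]
    exact sum_mem fun lam _ => Submodule.smul_mem _ _ (Submodule.subset_span ⟨_, rfl⟩)

end BlockSystem

/-! ### The elements `Z_λ` -/

section ZFamily

variable {ι R : Type*} [Ring R] (b : Module.Basis ι ℤ R)

/-- Both sides are symmetric in every alphabet and every monomial can be sorted, so the exponents of
multipartitions suffice; there only one block of the sum is nonzero. -/
theorem isZFamily_iff (Z : Multipartition ι → GQ R) : IsZFamily b Z ↔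
    ∀ μ : Multipartition ι, ∑ lam ∈ μ.block,
      MvPowerSeries.coeff μ.exponent (schurProd lam) • Z lam =
        MvPowerSeries.coeff μ.exponent (thetaProd (psumBasis b)) := by
  have hsum : ∀ μ : Multipartition ι,
      ∑ᶠ lam : Multipartition ι, MvPowerSeries.coeff μ.exponent (schurProd lam) • Z lam =
      ∑ lam ∈ μ.block, MvPowerSeries.coeff μ.exponent (schurProd lam) • Z lam := by
    intro μ
    refine finsum_eq_sum_of_support_subset _ fun lam hlam => ?_
    rw [Finset.mem_coe, Multipartition.mem_block]
    refine size_eq_of_coeff_ne_zero fun h => hlam ?_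
    dsimp only
    rw [h, zero_smul]
  constructor
  · intro h μ
    rw [← hsum]
    exact h μ.exponent
  · intro h m
    obtain ⟨e, μ, he, rfl⟩ := exists_embDomain_exponent m
    simp only [coeff_embDomain_schurProd he]
    rw [hsum, h]
    exact (coeff_embDomain_thetaProd_psumBasis he b _).symm

theorem exists_isZFamily : ∃ Z : Multipartition ι → GQ R,
    (IsZFamily b Z ∧ ∀ Z' : Multipartition ι → GQ R, IsZFamily b Z' → Z' = Z) ∧
      Submodule.span ℤ (Set.range Z) = coeffSpan b := by
  obtain ⟨L, hL⟩ := exists_schurProd_inverse ι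
  obtain ⟨Z, hZ, huniq, hspan⟩ := block_system_existsUnique (t := Multipartition.size)
    (B := Multipartition.block)
    (K := fun lam μ => MvPowerSeries.coeff μ.exponent (schurProd lam)) (L := L)
    (fun _ _ => Multipartition.mem_block) hL
    (fun μ => MvPowerSeries.coeff μ.exponent (thetaProd (psumBasis b)))
  refine ⟨Z, ⟨(isZFamily_iff b Z).2 hZ, fun Z' hZ' => huniq Z' ((isZFamily_iff b Z').1 hZ')⟩, ?_⟩
  rw [hspan]
  refine le_antisymm (Submodule.span_mono ?_) (Submodule.span_mono ?_)
  · rintro _ ⟨μ, rfl⟩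
    exact ⟨μ.exponent, rfl⟩
  · rintro _ ⟨m, rfl⟩
    obtain ⟨e, μ, he, rfl⟩ := exists_embDomain_exponent m
    exact ⟨μ, (coeff_embDomain_thetaProd_psumBasis he b μ.exponent).symm⟩

end ZFamily

end

end LimGroth

/-! ### Descent of the Hopf structure to `ℤ` and its uniqueness -/

namespace LimGroth

open Finset.HasAntidiagonal (antidiagonal mem_antidiagonal)

noncomputable section

set_option linter.unusedSectionVars false

/-! ### Tensor products over `ℤ` inside tensor products over `ℚ` -/

section TensorRat

variable {M N V W : Type*} [AddCommGroup M] [AddCommGroup N] [AddCommGroup V] [AddCommGroup W]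
  [Module ℚ V] [Module ℚ W]

theorem isTorsionFree_int_of_rat (V : Type*) [AddCommGroup V] [Module ℚ V] :
    Module.IsTorsionFree ℤ V := Module.IsTorsionFree.trans ℚ

theorem flat_int_of_injective (f : M →ₗ[ℤ] V) (hf : Function.Injective f) : Module.Flat ℤ M := by
  have := isTorsionFree_int_of_rat V
  have : Module.IsTorsionFree ℤ M := hf.moduleIsTorsionFree f f.map_smul
  infer_instance

/-- The map `M ⊗_ℤ N → V ⊗_ℚ W` induced by maps to rational vector spaces. -/
def tensorRat (f : M →ₗ[ℤ] V) (g : N →ₗ[ℤ] W) : M ⊗[ℤ] N →ₗ[ℤ] V ⊗[ℚ] W :=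
  TensorProduct.mapOfCompatibleSMul ℚ ℤ ℤ V W ∘ₗ TensorProduct.map f g

/-- Torsion-free `ℤ`-modules are flat, so the map of tensor products over `ℤ` stays injective; for
rational vector spaces tensoring over `ℤ` and over `ℚ` agree. -/
theorem tensorRat_injective {f : M →ₗ[ℤ] V} {g : N →ₗ[ℤ] W} (hf : Function.Injective f)
    (hg : Function.Injective g) : Function.Injective (tensorRat f g) := by
  have : Module.Flat ℤ V := flat_int_of_injective (LinearMap.id : V →ₗ[ℤ] V) fun _ _ h => h
  have : Module.Flat ℤ N := flat_int_of_injective g hg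
  have : TensorProduct.CompatibleSMul ℤ ℚ V W :=
    IsLocalization.tensorProduct_compatibleSMul (nonZeroDivisors ℤ) ℚ V W
  exact (TensorProduct.equivOfCompatibleSMul ℚ ℤ ℤ V W).injective.comp
    (TensorProduct.map_injective_of_flat_flat f g hf hg)

theorem exists_zsmul_mem_of_mem_span_rat (S : AddSubgroup V) {x : V}
    (hx : x ∈ Submodule.span ℚ (S : Set V)) : ∃ N : ℤ, N ≠ 0 ∧ N • x ∈ S := by
  induction hx using Submodule.span_induction with
  | mem x hx => exact ⟨1, one_ne_zero, by rw [one_smul]; exact hx⟩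
  | zero => exact ⟨1, one_ne_zero, by rw [smul_zero]; exact zero_mem _⟩
  | add x y _ _ hx hy =>
    obtain ⟨m, hm, hmx⟩ := hx
    obtain ⟨n, hn, hny⟩ := hy
    refine ⟨n * m, mul_ne_zero hn hm, ?_⟩
    rw [smul_add, mul_smul, mul_comm, mul_smul]
    exact add_mem (zsmul_mem hmx n) (zsmul_mem hny m)
  | smul q x _ hx =>
    obtain ⟨m, hm, hmx⟩ := hx
    refine ⟨m * q.den, mul_ne_zero hm (by exact_mod_cast q.den_nz), ?_⟩
    have h : (m * (q.den : ℤ)) • q • x = q.num • m • x := by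
      rw [← Int.cast_smul_eq_zsmul ℚ, ← Int.cast_smul_eq_zsmul ℚ q.num,
        ← Int.cast_smul_eq_zsmul ℚ m, smul_smul, smul_smul]
      congr 1
      have := Rat.mul_den_eq_num q
      push_cast
      rw [mul_assoc, mul_comm (q.den : ℚ), this, mul_comm]
    rw [h]
    exact zsmul_mem hmx _

end TensorRat

/-! ### The Hopf algebra structure on a subring -/

section Restrict

variable {R : Type*} [Ring R] {A : Subalgebra ℤ (GQ R)}

theorem tensorIncl_injective (A : Subalgebra ℤ (GQ R)) : Function.Injective (tensorIncl A) :=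
  tensorRat_injective (f := A.val.toLinearMap) (g := A.val.toLinearMap)
    Subtype.val_injective Subtype.val_injective

/-- The threefold tensor power of an algebra. -/
abbrev TensorCube (k B : Type*) [CommRing k] [Ring B] [Algebra k B] := B ⊗[k] (B ⊗[k] B)

/-- The map `A ⊗ (A ⊗ A) → 𝒢 ⊗ (𝒢 ⊗ 𝒢)` induced by the inclusion. -/
def tripleIncl (A : Subalgebra ℤ (GQ R)) :
    TensorCube ℤ A →ₐ[ℤ] GQ R ⊗[ℚ] (GQ R ⊗[ℚ] GQ R) :=
  (Algebra.TensorProduct.mapOfCompatibleSMul ℚ ℤ ℤ (GQ R) (GQ R ⊗[ℚ] GQ R)).comp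
    (Algebra.TensorProduct.map A.val (tensorIncl A))

theorem tripleIncl_injective (A : Subalgebra ℤ (GQ R)) : Function.Injective (tripleIncl A) :=
  tensorRat_injective (f := A.val.toLinearMap) (g := (tensorIncl A).toLinearMap)
    Subtype.val_injective (tensorIncl_injective A)

variable (HQ : HopfStructure ℚ (GQ R))

/-- The restriction of the comultiplication to a subring. -/
def comulRestrict (hΔ : ∀ a : A, HQ.comul a ∈ (tensorIncl A).range) : A →ₐ[ℤ] A ⊗[ℤ] A :=
  ((AlgEquiv.ofInjective (tensorIncl A) (tensorIncl_injective A)).symm : _ →ₐ[ℤ] _).comp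
    (AlgHom.codRestrict ((HQ.comul.restrictScalars ℤ).comp A.val) (tensorIncl A).range hΔ)

theorem tensorIncl_comulRestrict (hΔ : ∀ a : A, HQ.comul a ∈ (tensorIncl A).range) (a : A) :
    tensorIncl A (comulRestrict HQ hΔ a) = HQ.comul a :=
  congrArg Subtype.val ((AlgEquiv.ofInjective (tensorIncl A) (tensorIncl_injective A)).apply_symm_apply
    ⟨HQ.comul a, hΔ a⟩)

theorem algebra_ofId_int_rat_injective : Function.Injective (Algebra.ofId ℤ ℚ) :=
  Int.cast_injective

/-- The restriction of the counit to a subring. -/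
def counitRestrict (hε : ∀ a : A, HQ.counit a ∈ (Algebra.ofId ℤ ℚ).range) : A →ₐ[ℤ] ℤ :=
  ((AlgEquiv.ofInjective (Algebra.ofId ℤ ℚ) algebra_ofId_int_rat_injective).symm : _ →ₐ[ℤ] _).comp
    (AlgHom.codRestrict ((HQ.counit.restrictScalars ℤ).comp A.val) (Algebra.ofId ℤ ℚ).range hε)

theorem intCast_counitRestrict (hε : ∀ a : A, HQ.counit a ∈ (Algebra.ofId ℤ ℚ).range) (a : A) :
    (counitRestrict HQ hε a : ℚ) = HQ.counit a :=
  congrArg Subtype.val ((AlgEquiv.ofInjective (Algebra.ofId ℤ ℚ)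
    algebra_ofId_int_rat_injective).apply_symm_apply ⟨HQ.counit a, hε a⟩)

/-- The restriction of the antipode to a subring. -/
def antipodeRestrict (hS : ∀ a : A, HQ.antipode a ∈ A) : A →ₗ[ℤ] A where
  toFun a := ⟨HQ.antipode a, hS a⟩
  map_add' x y := Subtype.ext (map_add HQ.antipode (x : GQ R) y)
  map_smul' n x := Subtype.ext (map_zsmul HQ.antipode n (x : GQ R))

theorem coe_antipodeRestrict (hS : ∀ a : A, HQ.antipode a ∈ A) (a : A) :
    (antipodeRestrict HQ hS a : GQ R) = HQ.antipode a := rfl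

/-- Each axiom over `ℤ` is checked after an injection into the corresponding object over `ℚ`, where
it is an axiom of `HQ`. Coassociativity is the case that requires the threefold tensor power. -/
theorem exists_hopfStructure_restrict (hΔ : ∀ a : A, HQ.comul a ∈ (tensorIncl A).range)
    (hε : ∀ a : A, HQ.counit a ∈ (Algebra.ofId ℤ ℚ).range) (hS : ∀ a : A, HQ.antipode a ∈ A) :
    ∃ H : HopfStructure ℤ A, HQ.Extends H := by
  have hΔ' := tensorIncl_comulRestrict HQ hΔ
  have hε' := intCast_counitRestrict HQ hε
  have hS' := coe_antipodeRestrict HQ hS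
  generalize comulRestrict HQ hΔ = Δ at hΔ'
  generalize counitRestrict HQ hε = ε at hε'
  generalize antipodeRestrict HQ hS = S at hS'
  have smul_eq : ∀ (a x : A), ((ε a • x : A) : GQ R) = HQ.counit a • (x : GQ R) := fun a x => by
    rw [← hε', Int.cast_smul_eq_zsmul]
    rfl
  refine ⟨⟨Δ, ε, S, ?_, ?_, ?_, ?_, ?_⟩, fun a => (hΔ' a).symm, fun a => (hε' a).symm,
    fun a => (hS' a).symm⟩
  · refine AlgHom.ext fun a => tripleIncl_injective A ?_
    have h1 : ∀ (y : A ⊗[ℤ] A) (q : A),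
        tripleIncl A (Algebra.TensorProduct.assoc ℤ ℤ ℤ A A A (y ⊗ₜ q)) =
          Algebra.TensorProduct.assoc ℚ ℚ ℚ (GQ R) (GQ R) (GQ R)
            (tensorIncl A y ⊗ₜ[ℚ] (q : GQ R)) := by
      intro y q
      induction y using TensorProduct.induction_on with
      | zero => simp
      | add x y hx hy => simp only [TensorProduct.add_tmul, map_add, hx, hy]
      | tmul p r => rfl
    have h2 : ∀ x : A ⊗[ℤ] A, tripleIncl A (Algebra.TensorProduct.assoc ℤ ℤ ℤ A A A
        (Algebra.TensorProduct.map Δ (.id ℤ A) x)) =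
          Algebra.TensorProduct.assoc ℚ ℚ ℚ (GQ R) (GQ R) (GQ R)
            (Algebra.TensorProduct.map HQ.comul (.id ℚ (GQ R)) (tensorIncl A x)) := by
      intro x
      induction x using TensorProduct.induction_on with
      | zero => simp
      | add x y hx hy => simp only [map_add, hx, hy]
      | tmul p q =>
        rw [Algebra.TensorProduct.map_tmul, AlgHom.id_apply, h1, hΔ']
        rfl
    have h3 : ∀ x : A ⊗[ℤ] A, tripleIncl A (Algebra.TensorProduct.map (.id ℤ A) Δ x) =
        Algebra.TensorProduct.map (.id ℚ (GQ R)) HQ.comul (tensorIncl A x) := by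
      intro x
      induction x using TensorProduct.induction_on with
      | zero => simp
      | add x y hx hy => simp only [map_add, hx, hy]
      | tmul p q =>
        exact congrArg (fun z => (p : GQ R) ⊗ₜ[ℚ] z) (hΔ' q)
    refine (h2 (Δ a)).trans (Eq.trans ?_ (h3 (Δ a)).symm)
    rw [hΔ']
    exact AlgHom.congr_fun HQ.coassoc (a : GQ R)
  · refine AlgHom.ext fun a => (Algebra.TensorProduct.lid ℤ A).injective (Subtype.ext ?_)
    have h1 : ∀ x : A ⊗[ℤ] A, ((Algebra.TensorProduct.lid ℤ A
        (Algebra.TensorProduct.map ε (.id ℤ A) x) : A) : GQ R) =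
          Algebra.TensorProduct.lid ℚ (GQ R)
            (Algebra.TensorProduct.map HQ.counit (.id ℚ (GQ R)) (tensorIncl A x)) := by
      intro x
      induction x using TensorProduct.induction_on with
      | zero => simp
      | add x y hx hy => simp only [map_add, ← hx, ← hy]; rfl
      | tmul p q =>
        rw [Algebra.TensorProduct.map_tmul, Algebra.TensorProduct.lid_tmul, smul_eq]
        rfl
    refine (h1 (Δ a)).trans ?_
    rw [hΔ']
    refine (congrArg (Algebra.TensorProduct.lid ℚ (GQ R))
      (AlgHom.congr_fun HQ.rTensor_counit (a : GQ R))).trans ?_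
    refine (AlgEquiv.apply_symm_apply (Algebra.TensorProduct.lid ℚ (GQ R)) _).trans ?_
    exact congrArg Subtype.val (AlgEquiv.apply_symm_apply (Algebra.TensorProduct.lid ℤ A) a).symm
  · refine AlgHom.ext fun a => (Algebra.TensorProduct.rid ℤ ℤ A).injective (Subtype.ext ?_)
    have h1 : ∀ x : A ⊗[ℤ] A, ((Algebra.TensorProduct.rid ℤ ℤ A
        (Algebra.TensorProduct.map (.id ℤ A) ε x) : A) : GQ R) =
          Algebra.TensorProduct.rid ℚ ℚ (GQ R)
            (Algebra.TensorProduct.map (.id ℚ (GQ R)) HQ.counit (tensorIncl A x)) := by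
      intro x
      induction x using TensorProduct.induction_on with
      | zero => simp
      | add x y hx hy => simp only [map_add, ← hx, ← hy]; rfl
      | tmul p q =>
        rw [Algebra.TensorProduct.map_tmul, Algebra.TensorProduct.rid_tmul, smul_eq]
        rfl
    refine (h1 (Δ a)).trans ?_
    rw [hΔ']
    refine (congrArg (Algebra.TensorProduct.rid ℚ ℚ (GQ R))
      (AlgHom.congr_fun HQ.lTensor_counit (a : GQ R))).trans ?_
    refine (AlgEquiv.apply_symm_apply (Algebra.TensorProduct.rid ℚ ℚ (GQ R)) _).trans ?_
    exact congrArg Subtype.val (AlgEquiv.apply_symm_apply (Algebra.TensorProduct.rid ℤ ℤ A) a).symm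
  · refine LinearMap.ext fun a => Subtype.ext ?_
    have h1 : ∀ x : A ⊗[ℤ] A, ((LinearMap.mul' ℤ A (S.rTensor A x) : A) : GQ R) =
        LinearMap.mul' ℚ (GQ R) (HQ.antipode.rTensor (GQ R) (tensorIncl A x)) := by
      intro x
      induction x using TensorProduct.induction_on with
      | zero => simp
      | add x y hx hy => simp only [map_add, ← hx, ← hy]; rfl
      | tmul p q =>
        rw [LinearMap.rTensor_tmul, LinearMap.mul'_apply, Subalgebra.coe_mul, hS']
        rfl
    refine (h1 (Δ a)).trans ?_
    rw [hΔ']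
    refine (LinearMap.congr_fun HQ.mul_antipode_rTensor (a : GQ R)).trans ?_
    change algebraMap ℚ (GQ R) (HQ.counit a) = _
    rw [← hε', map_intCast]
    exact (map_intCast A.val (ε a)).symm
  · refine LinearMap.ext fun a => Subtype.ext ?_
    have h1 : ∀ x : A ⊗[ℤ] A, ((LinearMap.mul' ℤ A (S.lTensor A x) : A) : GQ R) =
        LinearMap.mul' ℚ (GQ R) (HQ.antipode.lTensor (GQ R) (tensorIncl A x)) := by
      intro x
      induction x using TensorProduct.induction_on with
      | zero => simp
      | add x y hx hy => simp only [map_add, ← hx, ← hy]; rfl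
      | tmul p q =>
        rw [LinearMap.lTensor_tmul, LinearMap.mul'_apply, Subalgebra.coe_mul, hS']
        rfl
    refine (h1 (Δ a)).trans ?_
    rw [hΔ']
    refine (LinearMap.congr_fun HQ.mul_antipode_lTensor (a : GQ R)).trans ?_
    change algebraMap ℚ (GQ R) (HQ.counit a) = _
    rw [← hε', map_intCast]
    exact (map_intCast A.val (ε a)).symm

end Restrict

/-! ### Uniqueness of Hopf algebra structures -/

section Unique

/-- The antipode is the convolution inverse of the identity, and a left inverse equals a right
inverse. -/
theorem HopfStructure.ext_of_comul_counit {k A : Type*} [CommRing k] [Ring A] [Algebra k A]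
    {H H' : HopfStructure k A} (hΔ : H.comul = H'.comul) (hε : H.counit = H'.counit) : H = H' := by
  refine HopfStructure.ext hΔ hε ?_
  let _ : Bialgebra k A :=
    Bialgebra.ofAlgHom H.comul H.counit H.coassoc H.rTensor_counit H.lTensor_counit
  have h1 : WithConv.toConv H.antipode * WithConv.toConv (LinearMap.id : A →ₗ[k] A) = 1 :=
    congrArg WithConv.toConv H.mul_antipode_rTensor
  have h2 : WithConv.toConv (LinearMap.id : A →ₗ[k] A) * WithConv.toConv H'.antipode = 1 := by
    have h := H'.mul_antipode_lTensor
    rw [← hΔ, ← hε] at h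
    exact congrArg WithConv.toConv h
  exact WithConv.toConv_injective (left_inv_eq_right_inv h1 h2)

variable {R : Type*} [Ring R] {A : Subalgebra ℤ (GQ R)}

/-- The equalizer contains all coefficients of the `E_U(t)`, hence spans `GQ R` over `ℚ`. Some
nonzero integer multiple of each element of `A` lies in it, and the multiple can be cancelled in the
torsion-free target. -/
theorem algHom_eq_of_coeff_E {P : Type*} [Ring P] [Module.IsTorsionFree ℤ P]
    (hE : ∀ (U : R) (r : ℕ), PowerSeries.coeff r (E U) ∈ A) {f g : A →ₐ[ℤ] P}
    (h : ∀ (U : R) (r : ℕ), f ⟨_, hE U r⟩ = g ⟨_, hE U r⟩) : f = g := by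
  have htop := span_eq_top_of_coeff_E_mem ((AlgHom.equalizer f g).map A.val)
    fun U r => ⟨⟨_, hE U r⟩, h U r, rfl⟩
  refine AlgHom.ext fun a => ?_
  obtain ⟨N, hN, a', ha', haa'⟩ := exists_zsmul_mem_of_mem_span_rat
    (Subalgebra.toSubmodule ((AlgHom.equalizer f g).map A.val)).toAddSubgroup
    (x := (a : GQ R)) (by
      change (a : GQ R) ∈ Submodule.span ℚ (((AlgHom.equalizer f g).map A.val : Subalgebra ℤ (GQ R)) : Set (GQ R))
      rw [htop]; trivial)
  obtain rfl : a' = N • a := Subtype.ext haa'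
  have ha' : f (N • a) = g (N • a) := ha'
  rw [map_zsmul, map_zsmul] at ha'
  exact smul_right_injective P hN ha'

theorem HopfStructure.eq_of_isGrouplike_E
    (hE : ∀ (U : R) (r : ℕ), PowerSeries.coeff r (E U) ∈ A) {H H' : HopfStructure ℤ A}
    (h : ∀ U : R, H.IsGrouplike (restrictSeries (E U) (hE U)))
    (h' : ∀ U : R, H'.IsGrouplike (restrictSeries (E U) (hE U))) : H = H' := by
  have hcoeff : ∀ (U : R) (r : ℕ), PowerSeries.coeff r (restrictSeries (E U) (hE U)) =
      ⟨_, hE U r⟩ := fun U r => PowerSeries.coeff_mk _ _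
  have htf : Module.IsTorsionFree ℤ (A ⊗[ℤ] A) := by
    have := isTorsionFree_int_of_rat (GQ R ⊗[ℚ] GQ R)
    exact (tensorIncl_injective A).moduleIsTorsionFree (tensorIncl A)
      (tensorIncl A).toLinearMap.map_smul
  refine HopfStructure.ext_of_comul_counit ?_ ?_
  · refine algHom_eq_of_coeff_E hE fun U r => ?_
    have := congrArg (PowerSeries.coeff r) ((h U).comul_eq.trans (h' U).comul_eq.symm)
    rw [PowerSeries.coeff_map, PowerSeries.coeff_map, hcoeff] at this
    exact this
  · refine algHom_eq_of_coeff_E hE fun U r => ?_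
    have := congrArg (PowerSeries.coeff r) ((h U).counit_eq.trans (h' U).counit_eq.symm)
    rw [PowerSeries.coeff_map, PowerSeries.coeff_map, hcoeff] at this
    exact this

end Unique

/-! ### The Hopf algebra structure on `𝒢_∞^ℤ(R)` -/

section HopfGZ

variable {ι R : Type*} [Ring R] (b : Module.Basis ι ℤ R)

theorem comul_coeff_thetaProd {σ : Type*} [DecidableEq σ] {y : ℕ+ → MvPowerSeries σ (RatR R)} (hy : Admissible y)
    (m : σ →₀ ℕ) : (hopfGQ R).comul (MvPowerSeries.coeff m (thetaProd y)) =
      ∑ p ∈ antidiagonal m, MvPowerSeries.coeff p.1 (thetaProd y) ⊗ₜ[ℚ]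
        MvPowerSeries.coeff p.2 (thetaProd y) := by
  have h := congrArg (MvPowerSeries.coeff m) (map_comul_thetaProd hy)
  rw [MvPowerSeries.coeff_map, MvPowerSeries.coeff_mul] at h
  refine h.trans (Finset.sum_congr rfl fun p _ => ?_)
  rw [MvPowerSeries.coeff_map, MvPowerSeries.coeff_map]
  change (_ ⊗ₜ[ℚ] (1 : GQ R)) * ((1 : GQ R) ⊗ₜ[ℚ] _) = _
  rw [Algebra.TensorProduct.tmul_mul_tmul, one_mul, mul_one]

theorem counit_coeff_thetaProd {σ : Type*} [DecidableEq σ] {y : ℕ+ → MvPowerSeries σ (RatR R)} (hy : Admissible y)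
    (m : σ →₀ ℕ) : (hopfGQ R).counit (MvPowerSeries.coeff m (thetaProd y)) =
      if m = 0 then 1 else 0 := by
  have h := congrArg (MvPowerSeries.coeff m) (map_counit_thetaProd hy)
  rw [MvPowerSeries.coeff_map, MvPowerSeries.coeff_one] at h
  exact h

theorem coeff_thetaProd_psumBasis_mem (m : ι × ℕ →₀ ℕ) :
    MvPowerSeries.coeff m (thetaProd (psumBasis b)) ∈ GZ b :=
  Submodule.subset_span ⟨m, rfl⟩

theorem comul_mem_range (a : GZ b) : (hopfGQ R).comul a ∈ (tensorIncl (GZ b)).range := by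
  classical
  obtain ⟨a, ha'⟩ := a
  have ha : a ∈ coeffSpan b := ha'
  change (hopfGQ R).comul a ∈ _
  clear ha'
  unfold coeffSpan at ha
  induction ha using Submodule.span_induction with
  | mem x hx =>
    obtain ⟨m, rfl⟩ := hx
    rw [comul_coeff_thetaProd (psumBasis_admissible b)]
    exact sum_mem fun p _ => ⟨⟨_, coeff_thetaProd_psumBasis_mem b p.1⟩ ⊗ₜ
      ⟨_, coeff_thetaProd_psumBasis_mem b p.2⟩, rfl⟩
  | zero => rw [map_zero]; exact zero_mem _
  | add x y _ _ hx hy => rw [map_add]; exact add_mem hx hy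
  | smul n x _ hx => rw [map_zsmul]; exact zsmul_mem hx n

theorem counit_mem_range (a : GZ b) : (hopfGQ R).counit a ∈ (Algebra.ofId ℤ ℚ).range := by
  classical
  obtain ⟨a, ha'⟩ := a
  have ha : a ∈ coeffSpan b := ha'
  change (hopfGQ R).counit a ∈ _
  clear ha'
  unfold coeffSpan at ha
  induction ha using Submodule.span_induction with
  | mem x hx =>
    obtain ⟨m, rfl⟩ := hx
    rw [counit_coeff_thetaProd (psumBasis_admissible b)]
    split_ifs
    · exact one_mem _
    · exact zero_mem _
  | zero => rw [map_zero]; exact zero_mem _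
  | add x y _ _ hx hy => rw [map_add]; exact add_mem hx hy
  | smul n x _ hx => rw [map_zsmul]; exact zsmul_mem hx n

/-- The relation `S(F) F = 1` expresses the antipode of the coefficient at `m` through antipodes of
coefficients of smaller degree, and `GZ b` is closed under products. -/
theorem antipode_coeff_thetaProd_mem (m : ι × ℕ →₀ ℕ) :
    (hopfGQ R).antipode (MvPowerSeries.coeff m (thetaProd (psumBasis b))) ∈ GZ b := by
  classical
  induction hd : m.degree using Nat.strong_induction_on generalizing m with
  | _ d ih =>
    subst hd
    have hy := psumBasis_admissible b
    have h0 : MvPowerSeries.coeff 0 (thetaProd (psumBasis b)) = 1 := by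
      have h := coeff_prodSeries (fun l : ℕ+ => Theta_sub_one_mem_tail l (hy l))
        (N := 0) (m := (0 : ι × ℕ →₀ ℕ)) (by simp)
      exact h.trans (by simp [partialProd])
    have h := ((hopfGQ R).antipode_coeff (comul_coeff_thetaProd hy) (counit_coeff_thetaProd hy) m).1
    -- The term `(m, 0)` is split off; its second factor is the constant coefficient `1`, so it is
    -- the antipode sought.
    rw [← Finset.add_sum_erase (antidiagonal m) _ (a := (m, 0))
      (mem_antidiagonal.2 (add_zero m)), h0,
      mul_one] at h
    rw [eq_sub_of_add_eq h]
    refine sub_mem ?_ (sum_mem fun p hp => mul_mem (ih _ ?_ p.1 rfl)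
      (coeff_thetaProd_psumBasis_mem b p.2))
    · split_ifs
      · exact one_mem _
      · exact zero_mem _
    · rw [Finset.mem_erase, mem_antidiagonal] at hp
      obtain ⟨hne, rfl⟩ := hp
      rw [map_add]
      refine Nat.lt_add_of_pos_right (Nat.pos_of_ne_zero fun h => hne ?_)
      rw [Finsupp.degree_eq_zero_iff] at h
      exact Prod.ext (by rw [h, add_zero]) h

theorem antipode_mem (a : GZ b) : (hopfGQ R).antipode a ∈ GZ b := by
  obtain ⟨a, ha'⟩ := a
  have ha : a ∈ coeffSpan b := ha'
  change (hopfGQ R).antipode a ∈ _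
  clear ha'
  unfold coeffSpan at ha
  induction ha using Submodule.span_induction with
  | mem x hx => obtain ⟨m, rfl⟩ := hx; exact antipode_coeff_thetaProd_mem b m
  | zero => rw [map_zero]; exact zero_mem _
  | add x y _ _ hx hy => rw [map_add]; exact add_mem hx hy
  | smul n x _ hx => rw [map_zsmul]; exact zsmul_mem hx n

theorem comul_coeff_E (U : R) (n : ℕ) : (hopfGQ R).comul (PowerSeries.coeff n (E U)) =
    ∑ p ∈ antidiagonal n, PowerSeries.coeff p.1 (E U) ⊗ₜ[ℚ] PowerSeries.coeff p.2 (E U) := by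
  have h : PowerSeries.map (comulGQ R : GQ R →+* _) (E U) =
      PowerSeries.map (inclL R) (E U) * PowerSeries.map (inclR R) (E U) := by
    rw [E_eq_thetaProd]
    exact map_comul_thetaProd (eTerm_admissible U)
  have h := congrArg (PowerSeries.coeff n) h
  rw [PowerSeries.coeff_map, PowerSeries.coeff_mul] at h
  refine h.trans (Finset.sum_congr rfl fun p _ => ?_)
  rw [PowerSeries.coeff_map, PowerSeries.coeff_map]
  change (_ ⊗ₜ[ℚ] (1 : GQ R)) * ((1 : GQ R) ⊗ₜ[ℚ] _) = _
  rw [Algebra.TensorProduct.tmul_mul_tmul, one_mul, mul_one]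

theorem counit_coeff_E (U : R) (n : ℕ) :
    (hopfGQ R).counit (PowerSeries.coeff n (E U)) = if n = 0 then 1 else 0 := by
  have h : PowerSeries.map (counitGQ R : GQ R →+* ℚ) (E U) = 1 := by
    rw [E_eq_thetaProd]
    exact map_counit_thetaProd (eTerm_admissible U)
  have h := congrArg (PowerSeries.coeff n) h
  rw [PowerSeries.coeff_map, PowerSeries.coeff_one] at h
  exact h

theorem isGrouplike_E_of_extends {A : Subalgebra ℤ (GQ R)} {H : HopfStructure ℤ A}
    (hH : (hopfGQ R).Extends H) (U : R) (hE : ∀ r, PowerSeries.coeff r (E U) ∈ A) :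
    H.IsGrouplike (restrictSeries (E U) hE) := by
  refine H.isGrouplike_of_coeff (fun n => tensorIncl_injective A ?_) fun n => ?_
  · rw [← hH.comul_eq, map_sum, restrictSeries, PowerSeries.coeff_mk]
    simp only [PowerSeries.coeff_mk]
    exact comul_coeff_E U n
  · have h := hH.counit_eq ⟨_, hE n⟩
    rw [counit_coeff_E] at h
    rw [restrictSeries, PowerSeries.coeff_mk]
    refine Int.cast_injective (α := ℚ) (h.symm.trans ?_)
    split_ifs <;> simp

end HopfGZ

end

end LimGroth

/-! ### Assembly of the theorem -/

theorem theorem8p1 {R : Type*} [Ring R] {ι : Type*} (b : Module.Basis ι ℤ R) :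
    ∃ Z : Multipartition ι → GQ R,
      -- the defining generating function determines the elements `Z_λ`
      (IsZFamily b Z ∧ ∀ Z' : Multipartition ι → GQ R, IsZFamily b Z' → Z' = Z) ∧
      -- their `ℤ`-span is a subring `A`, which contains all `e_r(U)`
      ∃ A : Subalgebra ℤ (GQ R), Subalgebra.toSubmodule A = Submodule.span ℤ (Set.range Z) ∧
      ∃ hE : ∀ (U : R) (r : ℕ), PowerSeries.coeff r (E U) ∈ A,
      -- there is a unique Hopf algebra structure on `A` with the required values on all `E_U(t)`
      ∃ H : HopfStructure ℤ A,
        (∀ U : R, H.IsGrouplike (restrictSeries (E U) (hE U))) ∧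
        (∀ H' : HopfStructure ℤ A,
          (∀ U : R, H'.IsGrouplike (restrictSeries (E U) (hE U))) → H' = H) ∧
        -- it extends to `ℚ ⊗ A = 𝒢_∞^ℚ(R)`, where all `T_i(U)` are primitive
        Submodule.span ℚ (A : Set (GQ R)) = ⊤ ∧
        ∃ HQ : HopfStructure ℚ (GQ R), HQ.Extends H ∧
          ∀ (i : ℕ+) (U : R), HQ.comul (T i (RatR.of U)) =
            T i (RatR.of U) ⊗ₜ[ℚ] (1 : GQ R) + (1 : GQ R) ⊗ₜ[ℚ] T i (RatR.of U) := by
  obtain ⟨Z, hZ, hspan⟩ := exists_isZFamily b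
  obtain ⟨H, hH⟩ := exists_hopfStructure_restrict (hopfGQ _) (comul_mem_range b)
    (counit_mem_range b) (antipode_mem b)
  have hE := fun U r => coeff_E_mem_GZ b U r
  have hgl := fun U => isGrouplike_E_of_extends hH U (hE U)
  exact ⟨Z, hZ, GZ b, hspan.symm, hE, H, hgl,
    fun _ hH' => HopfStructure.eq_of_isGrouplike_E hE hH' hgl,
    span_eq_top_of_coeff_E_mem (GZ b) hE, hopfGQ _, hH, fun i U => comulGQ_T i (RatR.of U)⟩
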